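/- Let $m>4$ and $n>1$ be integers such that $M:=m-2n\notin\{1,2\}$. Let $[a]\in\{0,1\}$ be the parity of the $a$-th standard basis vector of $\mathbb{C}^{m|2n}$, and let $g=(g_{ab})$ be a complex orthosymplectic metric: $g_{ab}=0$ if $[a]\neq[b]$, $g_{ba}=(-1)^{[a][b]}g_{ab}$, and $\sum_c g_{ca}g_{cb}=\delta_{ab}$; put $g^{ab}=g_{ab}$. Let $\mathfrak g=\mathfrak{osp}(m|2n)\subset\mathfrak{gl}(m|2n;\mathbb C)$ be the Lie superalgebra of all $A=(A^a{}_b)$ with $$\sum_c\left(g_{ac}A^c{}_b+(-1)^{[b]([a]+[c])}A^c{}_a\,g_{cb}\right)=0\quad\text{for all }a,b,$$ with the Lie superbracket $[A,B]=AB-(-1)^{|A||B|}BA$ and the invariant form $\langle X,Y\rangle=\sum_{a,b}X_{ab}Y^{ba}$, where $X_{ab}=\sum_c g_{ac}X^c{}_b$ and $Y^{ab}=\sum_c g^{cb}Y^a{}_c$. Let $\mathfrak g$ act on $\mathfrak g\otimes\mathfrak g$ by $X\cdot(U\otimes V)=[X,U]\otimes V+(-1)^{|X||U|}U\otimes[X,V]$.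 Put $d=\lfloor m/2\rfloor$ and choose a Cartan subalgebra of $\mathfrak g$ (given by a Witt basis of $\mathbb C^{m|2n}$), with dual basis $\epsilon_1,\dots,\epsilon_d,\delta_1,\dots,\delta_n$ and the system of simple roots $\epsilon_1-\epsilon_2,\dots,\epsilon_{d-1}-\epsilon_d,\ \epsilon_d-\delta_1,\ \delta_1-\delta_2,\dots,\delta_{n-1}-\delta_n$, together with $2\delta_n$ if $m$ is even and $\delta_n$ if $m$ is odd. Let $v_+$ be a highest weight vector of the adjoint representation for this system, and let $\mathfrak g\circledcirc_1\mathfrak g\subset\mathfrak g\otimes\mathfrak g$ be the $\mathfrak g$-submodule generated by $v_+\otimes v_+$ (the Cartan product). Then there is exactly one $\mathfrak g$-invariant projection $\Pi$ from $\mathfrak g\otimes\mathfrak g$ onto $\mathfrak g\circledcirc_1\mathfrak g$; write $X\circledcirc_1Y:=\Pi(X\otimes Y)$. Moreover, if $\lambda\in\mathbb C$ and $$\lambda\neq-\frac{M-4}{4(M-1)},$$ then the two-sided ideal $\mathcal J^1_\lambda$ of the tensor algebra $\otimes\mathfrak g=\bigoplus_{k\ge0}\otimes^k\mathfrak g$ generated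 by the elements $$X\otimes Y-X\circledcirc_1Y-\tfrac12[X,Y]-\lambda\langle X,Y\rangle,\qquad X,Y\in\mathfrak g,$$ contains $\mathfrak g$. -/

import Mathlib

open scoped TensorProduct Matrix

noncomputable section

namespace OSp

/-- Indices of the standard basis of `ℂ^{m|2n}`: the left summand labels the even basis vectors,
the right summand the odd ones. -/
abbrev Idx (m n : ℕ) : Type := Fin m ⊕ Fin (2 * n)

/-- The parity `[a]` of an index (`0` or `1`). -/
def par {m n : ℕ} : Idx m n → ℕ := Sum.elim (fun _ => 0) (fun _ => 1)

/-- An orthosymplectic metric `g_{ab}`: even, super symmetric, and such that `g^{ab} = g_{ab}`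
raises indices inversely to lowering them, i.e. `∑_c g^{ca} g_{cb} = δ_{ab}`. -/
structure Metric (m n : ℕ) where
  /-- the components `g_{ab} = g^{ab}` -/
  g : Matrix (Idx m n) (Idx m n) ℂ
  even : ∀ a b, par a ≠ par b → g a b = 0
  supersymm : ∀ a b, g b a = (-1 : ℂ) ^ (par a * par b) * g a b
  inv : ∀ a b, ∑ c, g c a * g c b = if a = b then 1 else 0

section gl

variable {m n : ℕ}

/-- The even part of an endomorphism `A` of `ℂ^{m|2n}`, where `A a b` stands for `A^a{}_b`. -/
def evenPart : Matrix (Idx m n) (Idx m n) ℂ →ₗ[ℂ] Matrix (Idx m n) (Idx m n) ℂ where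
  toFun A := Matrix.of fun a b => if par a = par b then A a b else 0
  map_add' A B := by ext a b; simp only [Matrix.of_apply, Matrix.add_apply]; split_ifs <;> simp
  map_smul' c A := by ext a b; simp

/-- The odd part of an endomorphism of `ℂ^{m|2n}`. -/
def oddPart : Matrix (Idx m n) (Idx m n) ℂ →ₗ[ℂ] Matrix (Idx m n) (Idx m n) ℂ where
  toFun A := Matrix.of fun a b => if par a = par b then 0 else A a b
  map_add' A B := by ext a b; simp only [Matrix.of_apply, Matrix.add_apply]; split_ifs <;> simp
  map_smul' c A := by ext a b; simp

/-- The Lie superbracket of `gl(m|2n)`: the bilinear extension of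
`[A, B] = A B - (-1)^{|A||B|} B A` for homogeneous `A`, `B`. -/
def superBracket (A B : Matrix (Idx m n) (Idx m n) ℂ) : Matrix (Idx m n) (Idx m n) ℂ :=
  (evenPart A * evenPart B - evenPart B * evenPart A)
    + (evenPart A * oddPart B - oddPart B * evenPart A)
    + (oddPart A * evenPart B - evenPart B * oddPart A)
    + (oddPart A * oddPart B + oddPart B * oddPart A)

end gl

variable {m n : ℕ} (G : Metric m n)

/-- The underlying vector space of `osp(m|2n)` inside `gl(m|2n)`. -/
def osp : Submodule ℂ (Matrix (Idx m n) (Idx m n) ℂ) where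
  carrier := {A | ∀ a b, ∑ c, (G.g a c * A c b
    + (-1 : ℂ) ^ (par b * (par a + par c)) * A c a * G.g c b) = 0}
  zero_mem' := by intro a b; simp
  add_mem' := by
    intro A B hA hB a b
    have h := congrArg₂ (· + ·) (hA a b) (hB a b)
    simp only [add_zero, ← Finset.sum_add_distrib] at h
    rw [← h]
    refine Finset.sum_congr rfl fun c _ => ?_
    simp only [Matrix.add_apply]; ring
  smul_mem' := by
    intro r A hA a b
    have h := congrArg (r * ·) (hA a b)
    simp only [mul_zero, Finset.mul_sum] at h
    rw [← h]
    refine Finset.sum_congr rfl fun c _ => ?_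
    simp only [Matrix.smul_apply, smul_eq_mul]; ring

section closure

variable {G}

/-- The diagonal matrix with entries `(-1)^{[a]}`. -/
def parityMatrix (m n : ℕ) : Matrix (Idx m n) (Idx m n) ℂ :=
  Matrix.diagonal fun a => (-1 : ℂ) ^ par a

theorem par_cases (a : Idx m n) : par a = 0 ∨ par a = 1 := by
  rcases a with a | a <;> simp [par]

theorem mul_evenPart_apply (A : Matrix (Idx m n) (Idx m n) ℂ) (a b : Idx m n) :
    (G.g * evenPart A) a b = if par a = par b then (G.g * A) a b else 0 := by
  simp only [Matrix.mul_apply, evenPart, LinearMap.coe_mk, AddHom.coe_mk, Matrix.of_apply]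
  by_cases hab : par a = par b
  · rw [if_pos hab]
    refine Finset.sum_congr rfl fun c _ => ?_
    by_cases hc : par a = par c
    · rw [if_pos (hc.symm.trans hab)]
    · rw [G.even _ _ hc, zero_mul, zero_mul]
  · rw [if_neg hab]
    refine Finset.sum_eq_zero fun c _ => ?_
    by_cases hc : par a = par c
    · rw [if_neg (fun h => hab (hc.trans h)), mul_zero]
    · rw [G.even _ _ hc, zero_mul]

theorem evenPart_add_oddPart (A : Matrix (Idx m n) (Idx m n) ℂ) :
    evenPart A + oddPart A = A := by
  ext a b
  simp only [evenPart, oddPart, LinearMap.coe_mk, AddHom.coe_mk, Matrix.of_apply,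
    Matrix.add_apply]
  by_cases h : par a = par b <;> simp [h]

theorem oddPart_eq (A : Matrix (Idx m n) (Idx m n) ℂ) : oddPart A = A - evenPart A := by
  rw [eq_sub_iff_add_eq, add_comm, evenPart_add_oddPart]

theorem transpose_evenPart_mul_apply (A : Matrix (Idx m n) (Idx m n) ℂ) (a b : Idx m n) :
    ((evenPart A)ᵀ * G.g) a b = if par a = par b then (Aᵀ * G.g) a b else 0 := by
  simp only [Matrix.mul_apply, evenPart, LinearMap.coe_mk, AddHom.coe_mk, Matrix.of_apply,
    Matrix.transpose_apply]
  by_cases hab : par a = par b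
  · rw [if_pos hab]
    refine Finset.sum_congr rfl fun c _ => ?_
    by_cases hc : par c = par b
    · rw [if_pos (hc.trans hab.symm)]
    · rw [G.even _ _ hc, mul_zero, mul_zero]
  · rw [if_neg hab]
    refine Finset.sum_eq_zero fun c _ => ?_
    by_cases hc : par c = par b
    · rw [if_neg (fun h => hab (h.symm.trans hc)), zero_mul]
    · rw [G.even _ _ hc, mul_zero]

theorem mem_osp_iff_apply (A : Matrix (Idx m n) (Idx m n) ℂ) :
    A ∈ osp G ↔ ∀ a b, (G.g * A) a b
      + (-1 : ℂ) ^ (par b * (par a + par b)) * (Aᵀ * G.g) a b = 0 := by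
  refine forall_congr' fun a => forall_congr' fun b => ?_
  rw [Finset.sum_add_distrib, Matrix.mul_apply, Matrix.mul_apply, Finset.mul_sum]
  have : ∀ c, (-1 : ℂ) ^ (par b * (par a + par c)) * A c a * G.g c b
      = (-1 : ℂ) ^ (par b * (par a + par b)) * (Aᵀ a c * G.g c b) := by
    intro c
    by_cases hc : par c = par b
    · rw [hc, Matrix.transpose_apply]; ring
    · rw [G.even _ _ hc]; ring
  simp only [this]

theorem mem_osp_iff (A : Matrix (Idx m n) (Idx m n) ℂ) :
    A ∈ osp G ↔ G.g * evenPart A = -((evenPart A)ᵀ * G.g)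
      ∧ G.g * oddPart A = parityMatrix m n * ((oddPart A)ᵀ * G.g) := by
  rw [mem_osp_iff_apply]
  constructor
  · intro h
    refine ⟨?_, ?_⟩
    · ext a b
      rw [Matrix.neg_apply, mul_evenPart_apply, transpose_evenPart_mul_apply]
      have := h a b
      split_ifs with hab
      · rw [hab] at this
        rcases par_cases b with hb | hb <;> simp [hb] at this <;> linear_combination this
      · simp
    · ext a b
      rw [oddPart_eq, mul_sub, Matrix.transpose_sub, sub_mul, parityMatrix,
        Matrix.diagonal_mul, Matrix.sub_apply, Matrix.sub_apply, mul_evenPart_apply,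
        transpose_evenPart_mul_apply]
      have := h a b
      split_ifs with hab
      · simp
      · rcases par_cases a with ha | ha <;> rcases par_cases b with hb | hb <;>
          simp [ha, hb] at hab this ⊢ <;> linear_combination this
  · rintro ⟨h0, h1⟩ a b
    have h0 := congrFun (congrFun h0 a) b
    have h1 := congrFun (congrFun h1 a) b
    rw [Matrix.neg_apply, mul_evenPart_apply, transpose_evenPart_mul_apply] at h0
    rw [oddPart_eq, mul_sub, Matrix.transpose_sub, sub_mul, parityMatrix,
        Matrix.diagonal_mul, Matrix.sub_apply, Matrix.sub_apply, mul_evenPart_apply,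
        transpose_evenPart_mul_apply] at h1
    rcases par_cases a with ha | ha <;> rcases par_cases b with hb | hb <;>
      simp [ha, hb] at h0 h1 ⊢ <;> first | linear_combination h0 | linear_combination h1

theorem evenPart_evenPart (A : Matrix (Idx m n) (Idx m n) ℂ) :
    evenPart (evenPart A) = evenPart A := by
  ext a b
  by_cases h : par a = par b <;> simp [evenPart, h]

theorem evenPart_oddPart (A : Matrix (Idx m n) (Idx m n) ℂ) : evenPart (oddPart A) = 0 := by
  rw [oddPart_eq, map_sub, evenPart_evenPart, sub_self]

theorem oddPart_evenPart (A : Matrix (Idx m n) (Idx m n) ℂ) : oddPart (evenPart A) = 0 := by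
  rw [oddPart_eq, evenPart_evenPart, sub_self]

theorem oddPart_oddPart (A : Matrix (Idx m n) (Idx m n) ℂ) :
    oddPart (oddPart A) = oddPart A := by
  rw [oddPart_eq (oddPart A), evenPart_oddPart, sub_zero]

theorem evenPart_mem {A : Matrix (Idx m n) (Idx m n) ℂ} (hA : A ∈ osp G) :
    evenPart A ∈ osp G := by
  rw [mem_osp_iff] at hA ⊢
  rw [evenPart_evenPart, oddPart_evenPart]
  exact ⟨hA.1, by simp⟩

theorem oddPart_mem {A : Matrix (Idx m n) (Idx m n) ℂ} (hA : A ∈ osp G) :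
    oddPart A ∈ osp G := by
  rw [mem_osp_iff] at hA ⊢
  rw [evenPart_oddPart, oddPart_oddPart]
  exact ⟨by simp, hA.2⟩

theorem eq_parity_conj_iff (A : Matrix (Idx m n) (Idx m n) ℂ) :
    (evenPart A = A ↔ parityMatrix m n * A * parityMatrix m n = A) ∧
    (oddPart A = A ↔ parityMatrix m n * A * parityMatrix m n = -A) := by
  constructor <;>
  · rw [← Matrix.ext_iff, ← Matrix.ext_iff]
    refine forall_congr' fun a => forall_congr' fun b => ?_
    rw [parityMatrix, Matrix.mul_diagonal, Matrix.diagonal_mul]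
    rcases par_cases a with ha | ha <;> rcases par_cases b with hb | hb <;>
      simp [evenPart, oddPart, ha, hb, self_eq_neg, neg_eq_self] <;> exact eq_comm

theorem parityMatrix_mul_self : parityMatrix m n * parityMatrix m n = 1 := by
  rw [parityMatrix, Matrix.diagonal_mul_diagonal, ← Matrix.diagonal_one]
  congr 1
  funext a
  rw [← mul_pow]; simp

theorem mem_osp_of_even {A : Matrix (Idx m n) (Idx m n) ℂ}
    (hA : parityMatrix m n * A * parityMatrix m n = A) (h : G.g * A = -(Aᵀ * G.g)) :
    A ∈ osp G := by
  have h0 := (eq_parity_conj_iff A).1.2 hA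
  rw [mem_osp_iff, oddPart_eq, h0]
  exact ⟨h, by simp⟩

theorem mem_osp_of_odd {A : Matrix (Idx m n) (Idx m n) ℂ}
    (hA : parityMatrix m n * A * parityMatrix m n = -A)
    (h : G.g * A = parityMatrix m n * (Aᵀ * G.g)) : A ∈ osp G := by
  have h0 := (eq_parity_conj_iff A).2.2 hA
  rw [mem_osp_iff, ← h0, evenPart_oddPart, oddPart_oddPart, h0]
  exact ⟨by simp, h⟩

theorem superBracket_mem {A B : Matrix (Idx m n) (Idx m n) ℂ} (hA : A ∈ osp G)
    (hB : B ∈ osp G) : superBracket A B ∈ osp G := by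
  have cA0 := (eq_parity_conj_iff (evenPart A)).1.1 (evenPart_evenPart A)
  have cA1 := (eq_parity_conj_iff (oddPart A)).2.1 (oddPart_oddPart A)
  have cB0 := (eq_parity_conj_iff (evenPart B)).1.1 (evenPart_evenPart B)
  have cB1 := (eq_parity_conj_iff (oddPart B)).2.1 (oddPart_oddPart B)
  obtain ⟨hA0, hA1⟩ := (mem_osp_iff A).1 hA
  obtain ⟨hB0, hB1⟩ := (mem_osp_iff B).1 hB
  rw [superBracket]
  generalize evenPart A = A0 at *
  generalize oddPart A = A1 at *
  generalize evenPart B = B0 at *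
  generalize oddPart B = B1 at *
  have hJ := parityMatrix_mul_self (m := m) (n := n)
  have hJt : (parityMatrix m n)ᵀ = parityMatrix m n := Matrix.diagonal_transpose _
  have hev := @mem_osp_of_even m n G
  have hod := @mem_osp_of_odd m n G
  generalize parityMatrix m n = J at *
  have conj : ∀ X Y : Matrix (Idx m n) (Idx m n) ℂ,
      J * (X * Y) * J = (J * X * J) * (J * Y * J) := by
    intro X Y
    calc J * (X * Y) * J = J * X * 1 * Y * J := by simp only [mul_one, mul_assoc]
      _ = _ := by rw [← hJ]; simp only [mul_assoc]
  have tr : ∀ {X : Matrix (Idx m n) (Idx m n) ℂ}, J * X * J = -X → Xᵀ * J = -(J * Xᵀ) := by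
    intro X hX
    have h := congrArg (fun Y => J * Yᵀ) hX
    simp only [Matrix.transpose_mul, hJt, Matrix.transpose_neg, mul_neg] at h
    rw [← h, ← mul_assoc J J, hJ, one_mul]
  have tA1 := tr cA1
  have tB1 := tr cB1
  have mA0 : ∀ Y, G.g * (A0 * Y) = -(A0ᵀ * (G.g * Y)) := by
    intro Y; rw [← mul_assoc, hA0, neg_mul, mul_assoc]
  have mB0 : ∀ Y, G.g * (B0 * Y) = -(B0ᵀ * (G.g * Y)) := by
    intro Y; rw [← mul_assoc, hB0, neg_mul, mul_assoc]
  have mA1 : ∀ Y, G.g * (A1 * Y) = J * (A1ᵀ * (G.g * Y)) := by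
    intro Y; rw [← mul_assoc, hA1]; simp only [mul_assoc]
  have mB1 : ∀ Y, G.g * (B1 * Y) = J * (B1ᵀ * (G.g * Y)) := by
    intro Y; rw [← mul_assoc, hB1]; simp only [mul_assoc]
  have ev : ∀ {X : Matrix (Idx m n) (Idx m n) ℂ}, J * X * J = X → Xᵀ * J = J * Xᵀ := by
    intro X hX
    have h := congrArg (fun Y => J * Yᵀ) hX
    simp only [Matrix.transpose_mul, hJt] at h
    rw [← h, ← mul_assoc J J, hJ, one_mul]
  have tA0 : ∀ Y, A0ᵀ * (J * Y) = J * (A0ᵀ * Y) := by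
    intro Y; rw [← mul_assoc, ev cA0, mul_assoc]
  have tB0 : ∀ Y, B0ᵀ * (J * Y) = J * (B0ᵀ * Y) := by
    intro Y; rw [← mul_assoc, ev cB0, mul_assoc]
  have tA1' : ∀ Y, A1ᵀ * (J * Y) = -(J * (A1ᵀ * Y)) := by
    intro Y; rw [← mul_assoc, tA1, neg_mul, mul_assoc]
  have tB1' : ∀ Y, B1ᵀ * (J * Y) = -(J * (B1ᵀ * Y)) := by
    intro Y; rw [← mul_assoc, tB1, neg_mul, mul_assoc]
  have hJ' : ∀ Y, J * (J * Y) = Y := by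
    intro Y; rw [← mul_assoc, hJ, one_mul]
  refine add_mem (add_mem (add_mem ?_ ?_) ?_) ?_
  · refine hev ?_ ?_
    · rw [mul_sub, sub_mul, conj, conj, cA0, cB0]
    · simp only [mul_sub, mA0, mB0, hA0, hB0, Matrix.transpose_sub, Matrix.transpose_mul,
        sub_mul, mul_assoc, mul_neg]
      abel
  · refine hod ?_ ?_
    · rw [mul_sub, sub_mul, conj, conj, cA0, cB1]; simp only [mul_neg, neg_mul]; abel
    · simp only [mul_sub, mA0, mB1, hA0, hB1, Matrix.transpose_sub, Matrix.transpose_mul,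
        sub_mul, mul_assoc, mul_neg, tA0]
      abel
  · refine hod ?_ ?_
    · rw [mul_sub, sub_mul, conj, conj, cA1, cB0]; simp only [mul_neg, neg_mul]; abel
    · simp only [mul_sub, mA1, mB0, hA1, hB0, Matrix.transpose_sub, Matrix.transpose_mul,
        sub_mul, mul_assoc, mul_neg, tB0]
      abel
  · refine hev ?_ ?_
    · rw [mul_add, add_mul, conj, conj, cA1, cB1]; simp only [neg_mul_neg]
    · simp only [mul_add, mA1, mB1, hA1, hB1, Matrix.transpose_add, Matrix.transpose_mul,
        add_mul, mul_assoc, mul_neg, tA1', tB1', hJ']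
      abel

end closure

/-- The even part `X ↦ X_0` on `osp(m|2n)`. -/
def ospEven : osp G →ₗ[ℂ] osp G := evenPart.restrict fun _ h => evenPart_mem h

/-- The odd part `X ↦ X_1` on `osp(m|2n)`. -/
def ospOdd : osp G →ₗ[ℂ] osp G := oddPart.restrict fun _ h => oddPart_mem h

/-- The Lie superbracket of `osp(m|2n)`, `bracket G X Y = [X, Y]`. -/
def bracket : osp G →ₗ[ℂ] osp G →ₗ[ℂ] osp G :=
  LinearMap.mk₂ ℂ (fun X Y => ⟨superBracket X.1 Y.1, superBracket_mem X.2 Y.2⟩)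
    (by
      intro X X' Y; ext1
      simp only [superBracket, Submodule.coe_add, map_add, add_mul, mul_add]; abel)
    (by
      intro c X Y; ext1
      simp only [superBracket, Submodule.coe_smul, map_smul, smul_mul_assoc, mul_smul_comm,
        smul_add, smul_sub])
    (by
      intro X Y Y'; ext1
      simp only [superBracket, Submodule.coe_add, map_add, add_mul, mul_add]; abel)
    (by
      intro c X Y; ext1
      simp only [superBracket, Submodule.coe_smul, map_smul, smul_mul_assoc, mul_smul_comm,
        smul_add, smul_sub])

/-- The tensor `X_{ab} = ∑_c g_{ac} X^c{}_b`. -/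
def lowered (X : osp G) (a b : Idx m n) : ℂ := ∑ c, G.g a c * X.1 c b

/-- The tensor `X^{ab} = ∑_c g^{cb} X^a{}_c`. -/
def raised (X : osp G) (a b : Idx m n) : ℂ := ∑ c, G.g c b * X.1 a c

/-- The invariant form `⟨X, Y⟩ = ∑_{a,b} X_{ab} Y^{ba}`. -/
def form (X Y : osp G) : ℂ := ∑ a, ∑ b, lowered G X a b * raised G Y b a

/-- The action of `X` on `g ⊗ g`: the linear extension in `X` of
`X · (U ⊗ V) = [X, U] ⊗ V + (-1)^{|X||U|} U ⊗ [X, V]`. The map `ospEven G - ospOdd G` multiplies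
a homogeneous `U` by `(-1)^{|U|}`. -/
def tensorAct (X : osp G) : osp G ⊗[ℂ] osp G →ₗ[ℂ] osp G ⊗[ℂ] osp G :=
  TensorProduct.map (bracket G X) LinearMap.id
    + TensorProduct.map LinearMap.id (bracket G (ospEven G X))
    + TensorProduct.map (ospEven G - ospOdd G) (bracket G (ospOdd G X))

/-- `N` is a `g`-submodule of `g ⊗ g`. -/
def IsSubrep (N : Submodule ℂ (osp G ⊗[ℂ] osp G)) : Prop :=
  ∀ X : osp G, ∀ t ∈ N, tensorAct G X t ∈ N

/-- The pairing `∑_{a,b} g_{ab} x^a y^b` on `ℂ^{m|2n}`. -/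
def pairing (x y : Idx m n → ℂ) : ℂ := ∑ a, ∑ b, G.g a b * x a * y b

/-- A choice of a Witt basis of `ℂ^{m|2n}`: even isotropic vectors `e_i`, `f_i`, with
`1 ≤ i ≤ d = ⌊m/2⌋`, and odd vectors `p_j`, `q_j`, with `1 ≤ j ≤ n`, in duality
(for odd `m` one even direction orthogonal to all of these remains). It fixes a Cartan subalgebra
of `osp(m|2n)` together with an ordering `ε_1, …, ε_d, δ_1, …, δ_n` of the dual basis. -/
structure WittBasis where
  e : Fin (m / 2) → Idx m n → ℂ
  f : Fin (m / 2) → Idx m n → ℂ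
  p : Fin n → Idx m n → ℂ
  q : Fin n → Idx m n → ℂ
  e_even : ∀ i a, par a = 1 → e i a = 0
  f_even : ∀ i a, par a = 1 → f i a = 0
  p_odd : ∀ i a, par a = 0 → p i a = 0
  q_odd : ∀ i a, par a = 0 → q i a = 0
  e_e : ∀ i j, pairing G (e i) (e j) = 0
  f_f : ∀ i j, pairing G (f i) (f j) = 0
  e_f : ∀ i j, pairing G (e i) (f j) = if i = j then 1 else 0
  p_p : ∀ i j, pairing G (p i) (p j) = 0
  q_q : ∀ i j, pairing G (q i) (q j) = 0
  p_q : ∀ i j, pairing G (p i) (q j) = if i = j then 1 else 0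

namespace WittBasis

variable {G} (W : WittBasis G)

/-- The functional `ε_i`: the eigenvalue of an element of the Cartan subalgebra on `e_i`. -/
def epsilon (i : Fin (m / 2)) (H : osp G) : ℂ := pairing G (H.1 *ᵥ W.e i) (W.f i)

/-- The functional `δ_j`: the eigenvalue of an element of the Cartan subalgebra on `p_j`. -/
def delta (j : Fin n) (H : osp G) : ℂ := pairing G (H.1 *ᵥ W.p j) (W.q j)

/-- The Cartan subalgebra: the even elements of `osp(m|2n)` that are diagonal in the
Witt basis. -/
def cartan : Set (osp G) :=
  {H | oddPart H.1 = 0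
    ∧ (∀ i, H.1 *ᵥ W.e i = W.epsilon i H • W.e i)
    ∧ (∀ i, H.1 *ᵥ W.f i = -W.epsilon i H • W.f i)
    ∧ (∀ j, H.1 *ᵥ W.p j = W.delta j H • W.p j)
    ∧ (∀ j, H.1 *ᵥ W.q j = -W.delta j H • W.q j)}

/-- The simple roots of the root system in which the `ε`'s are greater than the `δ`'s:
`ε_1 - ε_2, …, ε_{d-1} - ε_d, ε_d - δ_1, δ_1 - δ_2, …, δ_{n-1} - δ_n`, and `2 δ_n` if `m` is even
or `δ_n` if `m` is odd. -/
def simpleRoots : Set (osp G → ℂ) :=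
  {α | ∃ i i' : Fin (m / 2), (i : ℕ) + 1 = i' ∧ α = W.epsilon i - W.epsilon i'}
  ∪ {α | ∃ (i : Fin (m / 2)) (j : Fin n), (i : ℕ) + 1 = m / 2 ∧ (j : ℕ) = 0
      ∧ α = W.epsilon i - W.delta j}
  ∪ {α | ∃ j j' : Fin n, (j : ℕ) + 1 = j' ∧ α = W.delta j - W.delta j'}
  ∪ {α | ∃ j : Fin n, (j : ℕ) + 1 = n ∧
      α = if Even m then (2 : ℂ) • W.delta j else W.delta j}

/-- `X` lies in the root space of `α`. -/
def IsRootVector (α : osp G → ℂ) (X : osp G) : Prop :=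
  ∀ H ∈ W.cartan, bracket G H X = α H • X

/-- `v` is a highest weight vector of the adjoint representation: a nonzero weight vector that is
annihilated by the root vectors of all simple roots. -/
def IsHighestWeightVector (v : osp G) : Prop :=
  v ≠ 0 ∧ (∃ χ : osp G → ℂ, ∀ H ∈ W.cartan, bracket G H v = χ H • v)
    ∧ ∀ α ∈ W.simpleRoots, ∀ X, W.IsRootVector α X → bracket G X v = 0

/-- The Cartan product `g ⊚₁ g ⊆ g ⊗ g`: the submodule generated by `v₊ ⊗ v₊`, with `v₊` the
(up to scalars unique) highest weight vector of `g`. -/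
def cartanProduct : Submodule ℂ (osp G ⊗[ℂ] osp G) :=
  sInf {N | IsSubrep G N ∧ ∀ v, W.IsHighestWeightVector v → v ⊗ₜ[ℂ] v ∈ N}

/-- `P` is a `g`-invariant projection from `g ⊗ g` onto the Cartan product, so that
`P (X ⊗ Y) = X ⊚₁ Y`. Equivalently, `ker P` is a complementary submodule of `g ⊚₁ g`. -/
structure IsCartanProjection (P : osp G ⊗[ℂ] osp G →ₗ[ℂ] osp G ⊗[ℂ] osp G) : Prop where
  invariant : ∀ X t, P (tensorAct G X t) = tensorAct G X (P t)
  range_eq : LinearMap.range P = W.cartanProduct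
  apply_of_mem : ∀ t ∈ W.cartanProduct, P t = t

end WittBasis

/-- The canonical embedding of `g ⊗ g` into the tensor algebra `⊗g`. -/
def toTensorAlgebra : osp G ⊗[ℂ] osp G →ₗ[ℂ] TensorAlgebra ℂ (osp G) :=
  TensorProduct.lift ((LinearMap.mul ℂ (TensorAlgebra ℂ (osp G))).compl₁₂
    (TensorAlgebra.ι ℂ) (TensorAlgebra.ι ℂ))

/-- The two-sided ideal of `⊗g` generated by
`X ⊗ Y - P (X ⊗ Y) - ½ [X, Y] - l ⟨X, Y⟩` for all `X, Y ∈ g`. -/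
def quadraticIdeal (P : osp G ⊗[ℂ] osp G →ₗ[ℂ] osp G ⊗[ℂ] osp G) (l : ℂ) :
    TwoSidedIdeal (TensorAlgebra ℂ (osp G)) :=
  TwoSidedIdeal.span {r | ∃ X Y : osp G,
    r = toTensorAlgebra G (X ⊗ₜ[ℂ] Y) - toTensorAlgebra G (P (X ⊗ₜ[ℂ] Y))
      - (1 / 2 : ℂ) • TensorAlgebra.ι ℂ (bracket G X Y)
      - algebraMap ℂ _ (l * form G X Y)}

end OSp

end

noncomputable section

namespace OSp

/-! ### Normal form of the metric in a Witt basis. -/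

section

variable {m n : ℕ}

/-! Write M = m - 2n and g for osp(m|2n). In a Witt basis an element X of g has graded antisymmetric
components X^{ab}, and g is spanned by the elements b_p ∧ b_q (`K p q`). The central object is the
space of tensors in g ⊗ g that satisfy the graded Bianchi identity and are traceless (`weyl`, below
𝒲). A star denotes the dual index.

Everything about 𝒲 rests on extremal elements. If b_o, b_t span an even isotropic plane, E = `K o t`
satisfies ad(E)² X ∈ ℂE, so acting four times with E sends T to 24 T^{o*t*o*t*} E ⊗ E. If one such
component vanishes on a whole submodule U of 𝒲, moving it around with g and using the Bianchi
identity and tracelessness kills all components; two traces occur, with factors M - 2 and M - 1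
(`Vanishing.eq_bot`). Hence every nonzero submodule of 𝒲 contains all such E ⊗ E (`K_tmul_K_mem`).
Opposite extremal vectors pair nontrivially under the invariant form on g ⊗ g, so 𝒲 is a complement
of its annihilator 𝒲^⊥ (`isCompl_weyl`) and has no proper nonzero parity-stable submodule
(`eq_weyl`). The highest weight vector is a multiple of `K o t` for the first two basis vectors, so
the Cartan product equals 𝒲 (`cartanProduct_eq`). The fourfold action also forces every invariant
projection onto 𝒲 to kill 𝒲^⊥ (`isCartanProjection_perp`), which makes it unique.

Let A be the quotient of the tensor algebra by the ideal and L : g → A the induced map. As the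
projection kills 𝒲^⊥, the expression L(X)L(Y) - ½L([X,Y]) - λ⟨X,Y⟩, extended linearly to g ⊗ g,
vanishes on 𝒲^⊥. That space contains supercommutators, cyclic sums (dual to Bianchi) and
contractions (dual to tracelessness). Multiplying the cyclic relation on the left by L(K a* b),
summing over b and using associativity gives ((M - 4)/2 + 2λ(M - 1)) L(K o t) = 0
(`L_eq_zero_of_sep`). Away from the exceptional λ, L(K o t) = 0, and brackets spread this to L = 0
(`L_eq_zero`). -/

/-- The index of the Witt basis vector dual to the one with index `a`. -/
def dual : Idx m n → Idx m n := Sum.map Fin.rev Fin.rev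

@[simp] theorem dual_dual (a : Idx m n) : dual (dual a) = a := by
  rcases a with a | a <;> simp [dual]

theorem dual_inj {a b : Idx m n} : dual a = dual b ↔ a = b :=
  ⟨fun h => by rw [← dual_dual a, h, dual_dual], fun h => by rw [h]⟩

theorem eq_dual_comm {a b : Idx m n} : a = dual b ↔ b = dual a :=
  ⟨fun h => by rw [h, dual_dual], fun h => by rw [h, dual_dual]⟩

@[simp] theorem par_dual (a : Idx m n) : par (dual a) = par a := by
  rcases a with a | a <;> simp [dual, par]

/-- The sign `(-1)^{[a][b]}`. -/
def sg (a b : Idx m n) : ℂ := (-1) ^ (par a * par b)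

theorem sg_comm (a b : Idx m n) : sg a b = sg b a := by rw [sg, sg, mul_comm]

@[simp] theorem sg_mul_self (a b : Idx m n) : sg a b * sg a b = 1 := by
  rw [sg, ← mul_pow]; simp

@[simp] theorem sg_dual_left (a b : Idx m n) : sg (dual a) b = sg a b := by simp [sg]
@[simp] theorem sg_dual_right (a b : Idx m n) : sg a (dual b) = sg a b := by simp [sg]
@[simp] theorem sg_inl_left (i : Fin m) (b : Idx m n) : sg (Sum.inl i) b = 1 := by simp [sg, par]
@[simp] theorem sg_inr_inr (i j : Fin (2 * n)) :
    sg (Sum.inr i : Idx m n) (Sum.inr j) = -1 := by simp [sg, par]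

theorem sg_ne_zero (a b : Idx m n) : sg a b ≠ 0 := by
  intro h; simpa [h] using sg_mul_self a b

/-- The value `(b_a, b_{dual a})` of the invariant form on the Witt basis. -/
def eta : Idx m n → ℂ := Sum.elim (fun _ => 1) (fun j => if (j : ℕ) < n then -1 else 1)

@[simp] theorem eta_inl (i : Fin m) : eta (Sum.inl i : Idx m n) = 1 := rfl

@[simp] theorem eta_mul_self (a : Idx m n) : eta a * eta a = 1 := by
  rcases a with a | a
  · simp [eta]
  · simp only [eta, Sum.elim_inr]; split_ifs <;> simp

/-- Graded symmetry of the metric: the two orders of a dual pair differ by (-1)^{[a]}. In the normal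
form `wittMatrix`, the entry at (a*, a) is `eta a`. -/
theorem eta_dual (a : Idx m n) : eta (dual a) = sg a a * eta a := by
  rcases a with a | a
  · simp [eta, dual]
  · have := a.2
    by_cases h : (a : ℕ) < n
    · have h' : ¬ (2 * n - (a + 1) < n) := by omega
      simp [eta, dual, h, h']
    · have h' : (2 * n - (a + 1) < n) := by omega
      simp [eta, dual, h, h']

theorem eta_ne_zero (a : Idx m n) : eta a ≠ 0 := by
  intro h; simpa [h] using eta_mul_self a

/-- The superdimension M; every M in the later traces comes from this sum. -/
theorem sum_sg_self : ∑ a : Idx m n, sg a a = (m : ℂ) - 2 * n := by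
  rw [Fintype.sum_sum_type]; simp; ring

theorem sum_dual {M : Type*} [AddCommMonoid M] (F : Idx m n → M) :
    ∑ a, F (dual a) = ∑ a, F a :=
  Equiv.sum_comp (Function.Involutive.toPerm dual dual_dual) F

/-- The matrix of the metric in a Witt basis. -/
def wittMatrix (m n : ℕ) : Matrix (Idx m n) (Idx m n) ℂ :=
  Matrix.of fun a b => if b = dual a then sg a a * eta a else 0

theorem wittMatrix_transpose_mul : (wittMatrix m n)ᵀ * wittMatrix m n = 1 := by
  ext a b
  rw [Matrix.mul_apply, Finset.sum_eq_single (dual a)]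
  · simp only [Matrix.transpose_apply, wittMatrix, Matrix.of_apply, dual_dual, if_true,
      Matrix.one_apply]
    by_cases h : b = a
    · subst h
      simp only [if_true, sg_dual_left, sg_dual_right, eta_dual]
      linear_combination (sg b b * sg b b * sg b b * sg b b) * eta_mul_self b +
        (sg b b * sg b b + 1) * sg_mul_self b b
    · simp [h, Ne.symm h]
  · intro c _ hc
    rw [Matrix.transpose_apply, wittMatrix, Matrix.of_apply, if_neg, zero_mul]
    rintro rfl; simp at hc
  · simp

variable {G : Metric m n}

theorem pairing_eq_zero_of_par {x y : Idx m n → ℂ} (hx : ∀ a, par a = 1 → x a = 0)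
    (hy : ∀ a, par a = 0 → y a = 0) : pairing G x y = 0 ∧ pairing G y x = 0 := by
  constructor <;>
  · refine Finset.sum_eq_zero fun a _ => Finset.sum_eq_zero fun b _ => ?_
    rcases par_cases a with ha | ha <;> rcases par_cases b with hb | hb <;>
    first
    | simp [hx _ ha]; done
    | simp [hx _ hb]; done
    | simp [hy _ ha]; done
    | simp [hy _ hb]; done
    | simp [G.even a b (by omega)]

theorem pairing_add_left (x x' y : Idx m n → ℂ) :
    pairing G (x + x') y = pairing G x y + pairing G x' y := by
  simp only [pairing, ← Finset.sum_add_distrib, Pi.add_apply]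
  refine Finset.sum_congr rfl fun a _ => Finset.sum_congr rfl fun b _ => by ring

theorem pairing_smul_left (r : ℂ) (x y : Idx m n → ℂ) :
    pairing G (r • x) y = r * pairing G x y := by
  simp only [pairing, Finset.mul_sum, Pi.smul_apply, smul_eq_mul]
  refine Finset.sum_congr rfl fun a _ => Finset.sum_congr rfl fun b _ => by ring

theorem pairing_comm_of_even {x : Idx m n → ℂ} (hx : ∀ a, par a = 1 → x a = 0)
    (y : Idx m n → ℂ) : pairing G x y = pairing G y x := by
  unfold pairing
  rw [Finset.sum_comm]
  refine Finset.sum_congr rfl fun b _ => Finset.sum_congr rfl fun a _ => ?_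
  rcases par_cases a with ha | ha
  · rw [G.supersymm b a, ha]; simp; ring
  · simp [hx a ha]

theorem pairing_comm_of_odd {x : Idx m n → ℂ} (hx : ∀ a, par a = 0 → x a = 0)
    {y : Idx m n → ℂ} (hy : ∀ a, par a = 0 → y a = 0) : pairing G x y = -pairing G y x := by
  unfold pairing
  rw [Finset.sum_comm]
  simp only [← Finset.sum_neg_distrib]
  refine Finset.sum_congr rfl fun b _ => Finset.sum_congr rfl fun a _ => ?_
  rcases par_cases a with ha | ha
  · simp [hx a ha]
  rcases par_cases b with hb | hb
  · simp [hy b hb]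
  · rw [G.supersymm b a, ha, hb]; simp; ring

theorem sum_pairing_left {ι : Type*} (s : Finset ι) (x : ι → Idx m n → ℂ) (y : Idx m n → ℂ) :
    pairing G (∑ i ∈ s, x i) y = ∑ i ∈ s, pairing G (x i) y := by
  classical
  induction s using Finset.induction_on with
  | empty => simp [pairing]
  | insert a s ha ih => rw [Finset.sum_insert ha, pairing_add_left, ih, Finset.sum_insert ha]

/-- The pairing is nondegenerate. -/
theorem eq_zero_of_pairing_single {x : Idx m n → ℂ}
    (h : ∀ b, pairing G x (Pi.single b 1) = 0) : x = 0 := by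
  have h1 : ∀ b, ∑ a, G.g a b * x a = 0 := by
    intro b
    rw [← h b]
    refine Finset.sum_congr rfl fun a _ => ?_
    rw [Finset.sum_eq_single b] <;> simp +contextual
  have h2 : Matrix.vecMul x G.g = 0 := by
    ext b; rw [Pi.zero_apply, ← h1 b]; simp [Matrix.vecMul, dotProduct, mul_comm]
  have h3 : (G.g)ᵀ * G.g = 1 := by
    ext a b; simp [Matrix.mul_apply, G.inv, Matrix.one_apply]
  have h4 : G.g * (G.g)ᵀ = 1 := mul_eq_one_comm.1 h3
  calc x = Matrix.vecMul x (G.g * (G.g)ᵀ) := by rw [h4, Matrix.vecMul_one]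
    _ = 0 := by rw [← Matrix.vecMul_vecMul, h2, Matrix.zero_vecMul]

/-- A Witt basis of an odd-dimensional even part can be completed by a unit vector. -/
theorem WittBasis.exists_unit_vector (W : WittBasis G) (hm : m % 2 = 1) :
    ∃ z : Idx m n → ℂ, (∀ a, par a = 1 → z a = 0) ∧ (∀ i, pairing G z (W.e i) = 0) ∧
      (∀ i, pairing G z (W.f i) = 0) ∧ pairing G z z = 1 := by
  let inc : (Fin m → ℂ) → (Idx m n → ℂ) := fun x => Sum.elim x 0
  have inc_even : ∀ x a, par a = 1 → inc x a = 0 := by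
    rintro x (a | a) h
    · simp [par] at h
    · simp [inc]
  have inc_add : ∀ x y, inc (x + y) = inc x + inc y := by
    intro x y; ext (a | a) <;> simp [inc]
  have inc_smul : ∀ (r : ℂ) x, inc (r • x) = r • inc x := by
    intro r x; ext (a | a) <;> simp [inc]
  have inc_surj : ∀ x : Idx m n → ℂ, (∀ a, par a = 1 → x a = 0) → ∃ y, inc y = x := by
    intro x hx
    refine ⟨fun i => x (Sum.inl i), ?_⟩
    ext (a | a)
    · simp [inc]
    · simp [inc, hx (Sum.inr a) (by simp [par])]
  let Φ : (Fin m → ℂ) →ₗ[ℂ] ((Fin (m / 2) → ℂ) × (Fin (m / 2) → ℂ)) :=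
    { toFun := fun x => (fun i => pairing G (inc x) (W.e i), fun i => pairing G (inc x) (W.f i))
      map_add' := by
        intro x y; ext i <;> simp [inc_add, pairing_add_left]
      map_smul' := by
        intro r x; ext i <;> simp [inc_smul, pairing_smul_left] }
  have hΦs : Function.Surjective Φ := by
    rintro ⟨u, v⟩
    obtain ⟨y, hy⟩ := inc_surj (∑ i, v i • W.e i + ∑ i, u i • W.f i) (by
      intro a ha
      simp [Finset.sum_apply, W.e_even _ a ha, W.f_even _ a ha])
    refine ⟨y, ?_⟩
    have fe : ∀ i j, pairing G (W.f i) (W.e j) = if i = j then 1 else 0 := by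
      intro i j
      rw [pairing_comm_of_even (W.f_even i), W.e_f]; simp [eq_comm]
    ext i
    · simp [Φ, hy, pairing_add_left, sum_pairing_left, pairing_smul_left, W.e_e, fe]
    · simp [Φ, hy, pairing_add_left, sum_pairing_left, pairing_smul_left, W.f_f, W.e_f]
  -- The 2⌊m/2⌋ orthogonality conditions are independent because `Φ` is surjective, and m - 2⌊m/2⌋ =
  -- 1 for odd m.
  have hdim : Module.finrank ℂ (LinearMap.ker Φ) = 1 := by
    have h1 := LinearMap.finrank_range_add_finrank_ker Φ
    rw [LinearMap.range_eq_top.2 hΦs, finrank_top] at h1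
    simp at h1
    omega
  obtain ⟨⟨z, hzk⟩, hz0, hz⟩ := finrank_eq_one_iff'.1 hdim
  have hze : ∀ i, pairing G (inc z) (W.e i) = 0 := fun i =>
    congrFun (congrArg Prod.fst (LinearMap.mem_ker.1 hzk)) i
  have hzf : ∀ i, pairing G (inc z) (W.f i) = 0 := fun i =>
    congrFun (congrArg Prod.snd (LinearMap.mem_ker.1 hzk)) i
  -- An isotropic generator z would be orthogonal to itself and to all e_i, f_i, hence to every even
  -- vector, against nondegeneracy.
  have hzz : pairing G (inc z) (inc z) ≠ 0 := by
    intro h0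
    apply hz0
    have key : ∀ u : Fin m → ℂ, pairing G (inc u) (inc z) = 0 := by
      intro u
      obtain ⟨y, hy⟩ := inc_surj (∑ i, (Φ u).2 i • W.e i + ∑ i, (Φ u).1 i • W.f i) (by
        intro a ha
        simp [Finset.sum_apply, W.e_even _ a ha, W.f_even _ a ha])
      have fe : ∀ i j, pairing G (W.f i) (W.e j) = if i = j then 1 else 0 := by
        intro i j
        rw [pairing_comm_of_even (W.f_even i), W.e_f]; simp [eq_comm]
      have hk : Φ (u - y) = 0 := by
        rw [map_sub, sub_eq_zero]
        ext i
        · change _ = pairing G (inc y) (W.e i)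
          simp [hy, pairing_add_left, sum_pairing_left, pairing_smul_left, W.e_e, fe]
        · change _ = pairing G (inc y) (W.f i)
          simp [hy, pairing_add_left, sum_pairing_left, pairing_smul_left, W.f_f, W.e_f]
      obtain ⟨c, hc⟩ := hz ⟨u - y, hk⟩
      have hc : c • z = u - y := congrArg Subtype.val hc
      have hu : inc u = c • inc z + inc y := by
        rw [← inc_smul, ← inc_add, hc, sub_add_cancel]
      rw [hu, pairing_add_left, pairing_smul_left, h0, hy]
      have ez : ∀ i, pairing G (W.e i) (inc z) = 0 := fun i => by
        rw [pairing_comm_of_even (W.e_even i), hze]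
      have fz : ∀ i, pairing G (W.f i) (inc z) = 0 := fun i => by
        rw [pairing_comm_of_even (W.f_even i), hzf]
      simp [pairing_add_left, sum_pairing_left, pairing_smul_left, ez, fz]
    have : inc z = 0 := by
      refine eq_zero_of_pairing_single (G := G) fun b => ?_
      rcases b with b | b
      · rw [pairing_comm_of_even (inc_even z)]
        convert key (Pi.single b 1)
        ext (a | a) <;> simp [inc, Pi.single_apply]
      · refine (pairing_eq_zero_of_par (inc_even z) ?_).1
        rintro (a | a) ha
        · simp
        · simp [par] at ha
    ext i
    exact congrFun this (Sum.inl i)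
  -- Scaling by a square root of 1/(z,z) makes z a unit vector.
  obtain ⟨r, hr⟩ := IsAlgClosed.exists_pow_nat_eq (pairing G (inc z) (inc z))⁻¹ two_pos
  have pr : ∀ x y : Idx m n → ℂ, (∀ a, par a = 1 → x a = 0) →
      pairing G (r • x) (r • x) = r ^ 2 * pairing G x x := by
    intro x y hx
    rw [pairing_smul_left, pairing_comm_of_even hx, pairing_smul_left]; ring
  refine ⟨r • inc z, fun a ha => by simp [inc_even z a ha], ?_, ?_, ?_⟩
  · intro i; rw [pairing_smul_left, hze, mul_zero]
  · intro i; rw [pairing_smul_left, hzf, mul_zero]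
  · rw [pr _ 0 (inc_even z), hr, inv_mul_cancel₀ hzz]

/-- A homogeneous basis of `ℂ^{m|2n}`, given by the columns of `B`, that contains the vectors of the
Witt basis `W` and on which the metric takes its normal form. -/
structure Frame (W : WittBasis G) where
  B : Matrix (Idx m n) (Idx m n) ℂ
  Bi : Matrix (Idx m n) (Idx m n) ℂ
  inv_mul : Bi * B = 1
  mul_inv : B * Bi = 1
  even : evenPart B = B
  metric : Bᵀ * G.g * B = wittMatrix m n
  col_e : ∀ i : Fin (m / 2), B.col (Sum.inl ⟨i, by omega⟩) = W.e i
  col_f : ∀ i : Fin (m / 2), B.col (dual (Sum.inl ⟨i, by omega⟩)) = W.f i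
  col_p : ∀ j : Fin n, B.col (Sum.inr ⟨j, by omega⟩) = W.p j
  col_q : ∀ j : Fin n, B.col (dual (Sum.inr ⟨j, by omega⟩)) = W.q j

theorem WittBasis.nonempty_frame (W : WittBasis G) : Nonempty (Frame W) := by
  obtain ⟨z, hz0, ze, zf, zz⟩ : ∃ z : Idx m n → ℂ, (∀ a, par a = 1 → z a = 0) ∧
      (∀ i, pairing G z (W.e i) = 0) ∧ (∀ i, pairing G z (W.f i) = 0) ∧
      (m % 2 = 1 → pairing G z z = 1) := by
    by_cases hm : m % 2 = 1
    · obtain ⟨z, h1, h2, h3, h4⟩ := W.exists_unit_vector hm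
      exact ⟨z, h1, h2, h3, fun _ => h4⟩
    · exact ⟨0, by simp, by simp [pairing], by simp [pairing], fun h => absurd h hm⟩
  let b : Idx m n → Idx m n → ℂ := Sum.elim
    (fun i => if h : (i : ℕ) < m / 2 then W.e ⟨i, h⟩
      else if h : m - (i + 1) < m / 2 then W.f ⟨m - (i + 1), h⟩ else z)
    (fun j => if h : (j : ℕ) < n then W.p ⟨j, h⟩ else W.q ⟨2 * n - (j + 1), by omega⟩)
  have b0 : ∀ i a, par a = 1 → b (Sum.inl i) a = 0 := by
    intro i a ha
    simp only [b, Sum.elim_inl]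
    split_ifs
    · exact W.e_even _ _ ha
    · exact W.f_even _ _ ha
    · exact hz0 _ ha
  have b1 : ∀ i a, par a = 0 → b (Sum.inr i) a = 0 := by
    intro i a ha
    simp only [b, Sum.elim_inr]
    split_ifs
    · exact W.p_odd _ _ ha
    · exact W.q_odd _ _ ha
  have ez := fun i => (pairing_comm_of_even (W.e_even i) z).trans (ze i)
  have fz := fun i => (pairing_comm_of_even (W.f_even i) z).trans (zf i)
  have fe := fun i j => pairing_comm_of_even (G := G) (W.f_even i) (W.e j)
  have qp := fun i j => pairing_comm_of_odd (G := G) (W.q_odd i) (W.p_odd j)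
  have hb : ∀ c d, pairing G (b c) (b d) = wittMatrix m n c d := by
    rintro (i | i) (j | j)
    · have hi := i.2
      have hj := j.2
      simp only [b, Sum.elim_inl, wittMatrix, Matrix.of_apply, dual, Sum.map_inl, Sum.inl.injEq,
        sg_inl_left, eta_inl, Fin.ext_iff, Fin.val_rev, mul_one]
      split_ifs <;> (try omega) <;>
        (try simp only [W.e_e, W.e_f, W.f_f, fe, ze, zf, ez, fz, Fin.mk.injEq]) <;>
        (try split_ifs) <;> (try omega) <;> first | rfl | exact zz (by omega)
    · rw [(pairing_eq_zero_of_par (b0 i) (b1 j)).1]; simp [wittMatrix, dual]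
    · rw [(pairing_eq_zero_of_par (b0 j) (b1 i)).2]; simp [wittMatrix, dual]
    · have hi := i.2
      have hj := j.2
      simp only [b, Sum.elim_inr, wittMatrix, Matrix.of_apply, dual, Sum.map_inr, Sum.inr.injEq,
        sg_inr_inr, eta, Fin.ext_iff, Fin.val_rev]
      split_ifs <;> (try omega) <;>
        simp only [W.p_p, W.p_q, W.q_q, qp, Fin.mk.injEq] <;>
        (try split_ifs) <;> (try omega) <;> norm_num
  let B : Matrix (Idx m n) (Idx m n) ℂ := Matrix.of fun c a => b a c
  have hB : Bᵀ * G.g * B = wittMatrix m n := by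
    ext c d
    rw [← hb, Matrix.mul_apply, pairing, Finset.sum_comm]
    refine Finset.sum_congr rfl fun y _ => ?_
    rw [Matrix.mul_apply, Finset.sum_mul]
    refine Finset.sum_congr rfl fun x _ => ?_
    simp only [B, Matrix.transpose_apply, Matrix.of_apply]; ring
  have hBi : (wittMatrix m n)ᵀ * (Bᵀ * G.g) * B = 1 := by
    rw [mul_assoc, hB, wittMatrix_transpose_mul]
  refine ⟨⟨B, _, hBi, mul_eq_one_comm.1 hBi, ?_, hB, ?_, ?_, ?_, ?_⟩⟩
  · ext (c | c) (a | a)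
    · simp [evenPart, par]
    · simp [evenPart, par, B, b1 a (Sum.inl c) (by simp [par])]
    · simp [evenPart, par, B, b0 a (Sum.inr c) (by simp [par])]
    · simp [evenPart, par]
  · intro i; ext c
    simp [B, b, Matrix.col]
  · intro i; ext c
    have hi := i.2
    have h1 : ¬ (m - (i + 1) < m / 2) := by omega
    have h2 : m - (m - (i + 1) + 1) = i := by omega
    simp [B, b, Matrix.col, dual, h1, h2]
  · intro i; ext c
    simp [B, b, Matrix.col]
  · intro i; ext c
    have hi := i.2
    have h1 : ¬ (2 * n - (i + 1) < n) := by omega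
    have h2 : 2 * n - (2 * n - (i + 1) + 1) = i := by omega
    simp [B, b, Matrix.col, dual, h1, h2]

end

/-! ### Components in the Witt basis: the elements b_p ∧ b_q, the bracket and the form. -/

section

variable {m n : ℕ}

theorem evenPart_apply (A : Matrix (Idx m n) (Idx m n) ℂ) (a b : Idx m n) :
    evenPart A a b = if par a = par b then A a b else 0 := rfl

theorem oddPart_apply (A : Matrix (Idx m n) (Idx m n) ℂ) (a b : Idx m n) :
    oddPart A a b = if par a = par b then 0 else A a b := rfl

theorem evenPart_eq_conj (A : Matrix (Idx m n) (Idx m n) ℂ) :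
    evenPart A = (1 / 2 : ℂ) • (A + parityMatrix m n * A * parityMatrix m n) := by
  ext a b
  rw [evenPart_apply, Matrix.smul_apply, Matrix.add_apply, parityMatrix, Matrix.mul_diagonal,
    Matrix.diagonal_mul]
  rcases par_cases a with ha | ha <;> rcases par_cases b with hb | hb <;> simp [ha, hb] <;> ring

theorem parityMatrix_mul_comm {A : Matrix (Idx m n) (Idx m n) ℂ} (hA : evenPart A = A) :
    parityMatrix m n * A = A * parityMatrix m n := by
  have h := ((eq_parity_conj_iff A).1.1 hA)
  calc parityMatrix m n * A = parityMatrix m n * A * (parityMatrix m n * parityMatrix m n) := by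
        rw [parityMatrix_mul_self, mul_one]
    _ = A * parityMatrix m n := by rw [← mul_assoc, h]

theorem evenPart_eq_self_of_comm {A : Matrix (Idx m n) (Idx m n) ℂ}
    (hA : parityMatrix m n * A = A * parityMatrix m n) : evenPart A = A := by
  rw [(eq_parity_conj_iff A).1, hA, mul_assoc, parityMatrix_mul_self, mul_one]

theorem evenPart_conj {C D : Matrix (Idx m n) (Idx m n) ℂ} (hC : evenPart C = C)
    (hD : evenPart D = D) (A : Matrix (Idx m n) (Idx m n) ℂ) :
    evenPart (D * A * C) = D * evenPart A * C := by
  rw [evenPart_eq_conj, evenPart_eq_conj A]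
  have : parityMatrix m n * (D * A * C) * parityMatrix m n
      = D * (parityMatrix m n * A * parityMatrix m n) * C := by
    calc parityMatrix m n * (D * A * C) * parityMatrix m n
        = (parityMatrix m n * D) * A * (C * parityMatrix m n) := by simp only [mul_assoc]
      _ = _ := by
        rw [parityMatrix_mul_comm hD, ← parityMatrix_mul_comm hC]; simp only [mul_assoc]
  rw [this, mul_smul_comm, smul_mul_assoc, mul_add, add_mul]

theorem oddPart_conj {C D : Matrix (Idx m n) (Idx m n) ℂ} (hC : evenPart C = C)
    (hD : evenPart D = D) (A : Matrix (Idx m n) (Idx m n) ℂ) :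
    oddPart (D * A * C) = D * oddPart A * C := by
  rw [oddPart_eq, oddPart_eq, evenPart_conj hC hD, mul_sub, sub_mul]

theorem superBracket_conj {C D : Matrix (Idx m n) (Idx m n) ℂ} (hC : evenPart C = C)
    (hD : evenPart D = D) (hCD : C * D = 1) (X Y : Matrix (Idx m n) (Idx m n) ℂ) :
    superBracket (D * X * C) (D * Y * C) = D * superBracket X Y * C := by
  have h : ∀ P Q : Matrix (Idx m n) (Idx m n) ℂ, (D * P * C) * (D * Q * C) = D * (P * Q) * C := by
    intro P Q
    calc (D * P * C) * (D * Q * C) = D * P * (C * D) * Q * C := by simp only [mul_assoc]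
      _ = _ := by rw [hCD]; simp only [mul_assoc, one_mul]
  simp only [superBracket, evenPart_conj hC hD, oddPart_conj hC hD, h, mul_add, mul_sub, add_mul,
    sub_mul]

/-- Used in both directions: with a frame to pass from `G` to `wittMetric`, with its inverse to
build elements of `osp G`. -/
theorem conj_mem_osp {G₁ G₂ : Metric m n} {C D : Matrix (Idx m n) (Idx m n) ℂ}
    (hC : evenPart C = C) (hD : evenPart D = D) (hCD : C * D = 1) (h : Cᵀ * G₁.g * C = G₂.g)
    {A : Matrix (Idx m n) (Idx m n) ℂ} (hA : A ∈ osp G₁) : D * A * C ∈ osp G₂ := by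
  rw [mem_osp_iff] at hA ⊢
  rw [evenPart_conj hC hD, oddPart_conj hC hD]
  have h1 : G₂.g * D = Cᵀ * G₁.g := by rw [← h, mul_assoc, hCD, mul_one]
  have h2 : Dᵀ * G₂.g = G₁.g * C := by
    have : Dᵀ * Cᵀ = 1 := by rw [← Matrix.transpose_mul, hCD, Matrix.transpose_one]
    rw [← h, mul_assoc, ← mul_assoc, this, one_mul]
  have hJ : parityMatrix m n * Cᵀ = Cᵀ * parityMatrix m n := by
    have := congrArg Matrix.transpose (parityMatrix_mul_comm hC)
    rw [Matrix.transpose_mul, Matrix.transpose_mul, parityMatrix, Matrix.diagonal_transpose] at this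
    exact this.symm
  constructor
  · calc G₂.g * (D * evenPart A * C) = G₂.g * D * evenPart A * C := by simp only [mul_assoc]
      _ = Cᵀ * (G₁.g * evenPart A) * C := by rw [h1]; simp only [mul_assoc]
      _ = _ := by
        rw [hA.1]
        simp only [Matrix.transpose_mul, mul_assoc, h2, mul_neg, neg_mul]
  · calc G₂.g * (D * oddPart A * C) = G₂.g * D * oddPart A * C := by simp only [mul_assoc]
      _ = Cᵀ * (G₁.g * oddPart A) * C := by rw [h1]; simp only [mul_assoc]
      _ = Cᵀ * parityMatrix m n * ((oddPart A)ᵀ * (G₁.g * C)) := by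
        rw [hA.2]; simp only [mul_assoc]
      _ = _ := by
        rw [← hJ, ← h2]; simp only [Matrix.transpose_mul, mul_assoc]

/-- The metric in a Witt basis. -/
def wittMetric (m n : ℕ) : Metric m n where
  g := wittMatrix m n
  even a b h := by
    rw [wittMatrix, Matrix.of_apply, if_neg]; rintro rfl; simp at h
  supersymm a b := by
    simp only [wittMatrix, Matrix.of_apply]
    by_cases h : b = dual a
    · subst h
      simp only [dual_dual, if_true, eta_dual, sg_dual_left, sg_dual_right, par_dual]
      change _ = sg a a * _
      ring
    · rw [if_neg h, if_neg (fun h' => h (eq_dual_comm.1 h')), mul_zero]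
  inv a b := by
    have := congrFun (congrFun (wittMatrix_transpose_mul (m := m) (n := n)) a) b
    rw [Matrix.mul_apply] at this
    rw [Matrix.one_apply] at this
    exact this

theorem wittMetric_g : (wittMetric m n).g = wittMatrix m n := rfl

theorem wittMatrix_apply (a b : Idx m n) :
    wittMatrix m n a b = if b = dual a then sg a a * eta a else 0 := rfl

variable {G : Metric m n} {W : WittBasis G}

namespace Frame

variable (F : Frame W)

theorem even_inv : evenPart F.Bi = F.Bi := by
  apply evenPart_eq_self_of_comm
  calc parityMatrix m n * F.Bi = F.Bi * F.B * parityMatrix m n * F.Bi := by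
        rw [F.inv_mul, one_mul]
    _ = F.Bi * (parityMatrix m n * F.B) * F.Bi := by
        rw [parityMatrix_mul_comm F.even]; simp only [mul_assoc]
    _ = F.Bi * parityMatrix m n := by simp only [mul_assoc, F.mul_inv, mul_one]

theorem metric_inv : F.Biᵀ * wittMatrix m n * F.Bi = G.g := by
  have : F.Biᵀ * F.Bᵀ = 1 := by rw [← Matrix.transpose_mul, F.mul_inv, Matrix.transpose_one]
  rw [← F.metric]
  calc _ = (F.Biᵀ * F.Bᵀ) * G.g * (F.B * F.Bi) := by simp only [mul_assoc]
    _ = _ := by rw [this, F.mul_inv, one_mul, mul_one]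

/-- The matrix of an element of `osp(m|2n)` in the Witt basis. -/
def hat : osp G →ₗ[ℂ] Matrix (Idx m n) (Idx m n) ℂ where
  toFun X := F.Bi * X.1 * F.B
  map_add' X Y := by simp [mul_add, add_mul]
  map_smul' r X := by simp

theorem hat_apply (X : osp G) : F.hat X = F.Bi * X.1 * F.B := rfl

theorem hat_mem (X : osp G) : F.hat X ∈ osp (wittMetric m n) :=
  conj_mem_osp F.even F.even_inv F.mul_inv F.metric X.2

theorem hat_bracket (X Y : osp G) : F.hat (bracket G X Y) = superBracket (F.hat X) (F.hat Y) :=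
  (superBracket_conj F.even F.even_inv F.mul_inv X.1 Y.1).symm

theorem hat_injective : Function.Injective F.hat := by
  intro X Y h
  ext1
  have h' := congrArg (fun Z => F.B * Z * F.Bi) h
  simp only [hat_apply] at h'
  have e : ∀ Z : Matrix (Idx m n) (Idx m n) ℂ, F.B * (F.Bi * Z * F.B) * F.Bi = Z := by
    intro Z
    calc _ = (F.B * F.Bi) * Z * (F.B * F.Bi) := by simp only [mul_assoc]
      _ = _ := by rw [F.mul_inv, one_mul, mul_one]
  rwa [e, e] at h'

/-- The contravariant components `X^{ab}` of `X` in the Witt basis. -/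
def co (a b : Idx m n) : osp G →ₗ[ℂ] ℂ :=
  eta b • (Matrix.entryLinearMap ℂ ℂ a (dual b)).comp F.hat

theorem co_apply (a b : Idx m n) (X : osp G) : F.co a b X = eta b * F.hat X a (dual b) := rfl

theorem hat_eq_co (X : osp G) (a b : Idx m n) :
    F.hat X a b = eta (dual b) * F.co a (dual b) X := by
  rw [co_apply, dual_dual, ← mul_assoc, eta_mul_self, one_mul]

theorem ext_co {X Y : osp G} (h : ∀ a b, F.co a b X = F.co a b Y) : X = Y := by
  apply F.hat_injective
  ext a b
  rw [hat_eq_co, hat_eq_co, h]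

/-- With the second index raised, the equation defining osp is graded antisymmetry. It is read at
(a*, b*) since the Witt metric pairs an index only with its dual. -/
theorem co_swap (a b : Idx m n) (X : osp G) : F.co b a X = -sg a b * F.co a b X := by
  have h := (mem_osp_iff_apply _).1 (F.hat_mem X) (dual a) (dual b)
  rw [Matrix.mul_apply, Finset.sum_eq_single a, Matrix.mul_apply, Finset.sum_eq_single b] at h
  · simp only [wittMetric, wittMatrix, Matrix.of_apply, dual_dual, if_true, eta_dual, sg_dual_left,
      sg_dual_right, par_dual, Matrix.transpose_apply] at h
    have h1 : (-1 : ℂ) ^ (par b * (par a + par b)) = sg a b * sg b b := by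
      rw [sg, sg, ← pow_add]; ring_nf
    rw [h1] at h
    rw [co_apply, co_apply]
    have h2 : eta a * F.hat X a (dual b) + sg a b * (eta b * F.hat X b (dual a)) = 0 := by
      linear_combination h - eta a * F.hat X a (dual b) * sg_mul_self a a
        - sg a b * (eta b * F.hat X b (dual a)) * sg_mul_self b b
    linear_combination (sg a b * eta a * eta b) * h2
      - sg a b * eta b * F.hat X a (dual b) * eta_mul_self a
      - eta a * F.hat X b (dual a) * (sg a b * sg a b * eta_mul_self b + sg_mul_self a b)
  · intro c _ hc
    rw [wittMetric_g, wittMatrix_apply, if_neg, mul_zero]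
    exact fun h' => hc (dual_inj.1 h').symm
  · simp
  · intro c _ hc
    rw [wittMetric_g, wittMatrix_apply, if_neg (by simpa using hc), zero_mul]
  · simp

theorem co_self_inl (i : Fin m) (X : osp G) : F.co (Sum.inl i) (Sum.inl i) X = 0 := by
  have := F.co_swap (Sum.inl i) (Sum.inl i) X
  rw [sg_inl_left] at this
  linear_combination (1 / 2 : ℂ) * this

end Frame

/-- The endomorphism `b_p ∧ b_q` of `ℂ^{m|2n}`, as a matrix in the Witt basis. -/
def wedgeMatrix (p q : Idx m n) : Matrix (Idx m n) (Idx m n) ℂ :=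
  Matrix.single p (dual q) (eta q) - Matrix.single q (dual p) (sg p q * eta p)

theorem wedgeMatrix_apply (p q a b : Idx m n) : wedgeMatrix p q a b =
    (if a = p ∧ b = dual q then eta q else 0)
      - (if a = q ∧ b = dual p then sg p q * eta p else 0) := by
  simp [wedgeMatrix, Matrix.single_apply, eq_comm]

theorem wedgeMatrix_mul_apply (p q : Idx m n) (Y : Matrix (Idx m n) (Idx m n) ℂ) (a b : Idx m n) :
    (wedgeMatrix p q * Y) a b = (if a = p then eta q * Y (dual q) b else 0)
      - (if a = q then sg p q * eta p * Y (dual p) b else 0) := by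
  rw [wedgeMatrix, sub_mul, Matrix.sub_apply]
  congr 1
  · split_ifs with h
    · subst h; simp
    · simp [h]
  · split_ifs with h
    · subst h; simp
    · simp [h]

theorem mul_wedgeMatrix_apply (p q : Idx m n) (Y : Matrix (Idx m n) (Idx m n) ℂ) (a b : Idx m n) :
    (Y * wedgeMatrix p q) a b = (if b = dual q then Y a p * eta q else 0)
      - (if b = dual p then Y a q * (sg p q * eta p) else 0) := by
  rw [wedgeMatrix, mul_sub, Matrix.sub_apply]
  congr 1
  · split_ifs with h
    · subst h; simp
    · simp [h]
  · split_ifs with h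
    · subst h; simp
    · simp [h]

theorem wedgeMatrix_mem (p q : Idx m n) : wedgeMatrix p q ∈ osp (wittMetric m n) := by
  rw [mem_osp_iff_apply]
  intro a b
  rw [Matrix.mul_apply, Finset.sum_eq_single (dual a), Matrix.mul_apply,
    Finset.sum_eq_single (dual b)]
  · have h1 : (-1 : ℂ) ^ (par b * (par a + par b)) = sg a b * sg b b := by
      rw [sg, sg, ← pow_add]; ring_nf
    simp only [wittMetric, wittMatrix, Matrix.of_apply, dual_dual, if_true, eta_dual, sg_dual_left,
      sg_dual_right, Matrix.transpose_apply, h1, wedgeMatrix_apply]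
    have e1 : (dual a = p ∧ b = dual q) ↔ (dual b = q ∧ a = dual p) := by
      constructor <;> rintro ⟨rfl, rfl⟩ <;> simp
    have e2 : (dual a = q ∧ b = dual p) ↔ (dual b = p ∧ a = dual q) := by
      constructor <;> rintro ⟨rfl, rfl⟩ <;> simp
    rw [if_congr e1 rfl rfl, if_congr e2 rfl rfl]
    have t1 : sg a a * eta a * (if dual b = q ∧ a = dual p then eta q else 0) = sg a b * sg b b
        * ((if dual b = q ∧ a = dual p then sg p q * eta p else 0) * (sg b b * (sg b b * eta b))) := by
      split_ifs with h2
      · obtain ⟨rfl, rfl⟩ := h2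
        simp only [sg_dual_left, sg_dual_right, eta_dual]
        rcases par_cases b with hb | hb <;> rcases par_cases p with hp | hp <;>
          simp [sg, hb, hp, mul_comm]
      · simp
    have t2 : sg a a * eta a * (if dual b = p ∧ a = dual q then sg p q * eta p else 0) =
        sg a b * sg b b
        * ((if dual b = p ∧ a = dual q then eta q else 0) * (sg b b * (sg b b * eta b))) := by
      split_ifs with h2
      · obtain ⟨rfl, rfl⟩ := h2
        simp only [sg_dual_left, sg_dual_right, eta_dual]
        rcases par_cases b with hb | hb <;> rcases par_cases q with hp | hp <;>
          simp [sg, hb, hp, mul_comm]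
      · simp
    linear_combination t1 - t2
  · intro c _ hc
    rw [wittMetric_g, wittMatrix_apply, if_neg, mul_zero]
    rw [eq_dual_comm]; exact hc
  · simp
  · intro c _ hc
    rw [wittMetric_g, wittMatrix_apply, if_neg hc, zero_mul]
  · simp


theorem evenPart_wedgeMatrix (p q : Idx m n) :
    evenPart (wedgeMatrix p q) = if par p = par q then wedgeMatrix p q else 0 := by
  ext a b
  rw [evenPart_apply, wedgeMatrix_apply]
  by_cases h1 : a = p ∧ b = dual q
  · obtain ⟨rfl, rfl⟩ := h1
    by_cases h : par a = par q <;> simp [h, wedgeMatrix_apply]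
  by_cases h2 : a = q ∧ b = dual p
  · obtain ⟨rfl, rfl⟩ := h2
    by_cases h : par p = par a
    · simp [h, wedgeMatrix_apply]
    · simp [h, Ne.symm h]
  · rw [if_neg h1, if_neg h2]
    split_ifs <;> simp [wedgeMatrix_apply, h1, h2]

/-- An entry (a, b) of a product with b_p ∧ b_q only sees the part of Y of parity [a]+[b]+[p]+[q].
The sign is therefore (-1) to the power ([p]+[q])([a]+[b]+[p]+[q]), whose diagonal part is `sg p p *
sg q q`. -/
theorem superBracket_wedgeMatrix (p q : Idx m n) (Y : Matrix (Idx m n) (Idx m n) ℂ)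
    (a b : Idx m n) : superBracket (wedgeMatrix p q) Y a b =
      (wedgeMatrix p q * Y) a b - sg p a * sg q a * sg p b * sg q b * (sg p p * sg q q)
        * (Y * wedgeMatrix p q) a b := by
  by_cases hpq : par p = par q
  · have e0 : evenPart (wedgeMatrix p q) = wedgeMatrix p q := by
      rw [evenPart_wedgeMatrix, if_pos hpq]
    have e1 : superBracket (wedgeMatrix p q) Y = wedgeMatrix p q * Y - Y * wedgeMatrix p q := by
      rw [superBracket, oddPart_eq (wedgeMatrix p q), e0, sub_self]
      conv_rhs => rw [← evenPart_add_oddPart Y]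
      simp only [mul_add, add_mul, mul_zero, zero_mul]; abel
    have e2 : sg p a * sg q a * sg p b * sg q b * (sg p p * sg q q) = 1 := by
      rcases par_cases q with hq | hq <;> rcases par_cases a with ha | ha <;>
        rcases par_cases b with hb | hb <;> simp [sg, hpq, hq, ha, hb]
    rw [e1, e2, Matrix.sub_apply, one_mul]
  · have e0 : evenPart (wedgeMatrix p q) = 0 := by
      rw [evenPart_wedgeMatrix, if_neg hpq]
    have e1 : superBracket (wedgeMatrix p q) Y
        = wedgeMatrix p q * Y - (evenPart Y - oddPart Y) * wedgeMatrix p q := by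
      rw [superBracket, oddPart_eq (wedgeMatrix p q), e0, sub_zero]
      conv_rhs => enter [1]; rw [← evenPart_add_oddPart Y]
      simp only [mul_add, sub_mul, mul_zero, zero_mul]; abel
    rw [e1, Matrix.sub_apply, mul_wedgeMatrix_apply, mul_wedgeMatrix_apply]
    congr 1
    have hne : dual q ≠ dual p := fun h => hpq (by rw [dual_inj.1 h])
    by_cases h1 : b = dual q <;> by_cases h2 : b = dual p <;>
      rcases par_cases p with hp | hp <;> rcases par_cases q with hq | hq <;>
      rcases par_cases a with ha | ha <;>
      first
      | (exfalso; omega)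
      | (exfalso; exact hne (h1.symm.trans h2))
      | simp [evenPart_apply, oddPart_apply, sg, h1, h2, hp, hq, ha, hne, hne.symm]

namespace Frame

variable (F : Frame W)

/-- The element `b_p ∧ b_q` of `osp(m|2n)`. -/
def K (p q : Idx m n) : osp G :=
  ⟨F.B * wedgeMatrix p q * F.Bi,
    conj_mem_osp (G₁ := wittMetric m n) F.even_inv F.even F.inv_mul F.metric_inv
      (wedgeMatrix_mem p q)⟩

theorem hat_K (p q : Idx m n) : F.hat (F.K p q) = wedgeMatrix p q := by
  rw [hat_apply, K]
  calc _ = (F.Bi * F.B) * wedgeMatrix p q * (F.Bi * F.B) := by simp only [mul_assoc]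
    _ = _ := by rw [F.inv_mul, one_mul, mul_one]

theorem co_K (p q a b : Idx m n) : F.co a b (F.K p q) =
    (if a = p ∧ b = q then 1 else 0) - (if a = q ∧ b = p then sg p q else 0) := by
  rw [co_apply, hat_K, wedgeMatrix_apply, mul_sub]
  simp only [dual_inj]
  congr 1
  · split_ifs with h
    · rw [h.2, eta_mul_self]
    · simp
  · split_ifs with h
    · rw [h.2, mul_left_comm, eta_mul_self, mul_one]
    · simp

/-- Each upper index transforms as a vector: up to factors, an index p becomes q* and an index q
becomes p*. The prefactor `sg p a * sg q a` is the cost of passing the first index. -/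
theorem co_bracket (p q a b : Idx m n) (X : osp G) : F.co a b (bracket G (F.K p q) X) =
    (if a = p then eta q * F.co (dual q) b X else 0)
      - (if a = q then sg p q * eta p * F.co (dual p) b X else 0)
      + sg p a * sg q a * ((if b = p then eta q * F.co a (dual q) X else 0)
        - (if b = q then sg p q * eta p * F.co a (dual p) X else 0)) := by
  have h : ∀ c, F.hat X a c = sg c c * eta c * F.co a (dual c) X := by
    intro c; rw [hat_eq_co, eta_dual]
  rw [F.co_apply a b, hat_bracket, hat_K, superBracket_wedgeMatrix, wedgeMatrix_mul_apply,
    mul_wedgeMatrix_apply, h p, h q, F.co_apply (dual q) b, F.co_apply (dual p) b, sg_dual_right,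
    sg_dual_right]
  simp only [dual_inj]
  have t1 : eta b * (sg p a * sg q a * sg p b * sg q b * (sg p p * sg q q) *
      (if b = q then sg p p * eta p * F.co a (dual p) X * eta q else 0)) =
      sg p a * sg q a * (if b = q then sg p q * eta p * F.co a (dual p) X else 0) := by
    split_ifs with hb
    · subst hb
      linear_combination (sg p a * sg b a * sg p b * eta p * F.co a (dual p) X) *
        (sg p p * sg p p * sg b b * sg b b * eta_mul_self b + sg p p * sg p p * sg_mul_self b b
          + sg_mul_self p p)
    · simp
  have t2 : eta b * (sg p a * sg q a * sg p b * sg q b * (sg p p * sg q q) *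
      (if b = p then sg q q * eta q * F.co a (dual q) X * (sg p q * eta p) else 0)) =
      sg p a * sg q a * (if b = p then eta q * F.co a (dual q) X else 0) := by
    split_ifs with hb
    · subst hb
      rw [sg_comm q b]
      linear_combination (sg b a * sg q a * eta q * F.co a (dual q) X) *
        (sg b b * sg b b * sg q q * sg q q * sg b q * sg b q * eta_mul_self b
          + sg b b * sg b b * sg q q * sg q q * sg_mul_self b q + sg b b * sg b b * sg_mul_self q q
          + sg_mul_self b b)
    · simp
  have t3 : eta b * (if a = p then eta q * F.hat X (dual q) (dual b) else 0) =
      if a = p then eta q * (eta b * F.hat X (dual q) (dual b)) else 0 := by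
    split_ifs <;> ring
  have t4 : eta b * (if a = q then sg p q * eta p * F.hat X (dual p) (dual b) else 0) =
      if a = q then sg p q * eta p * (eta b * F.hat X (dual p) (dual b)) else 0 := by
    split_ifs <;> ring
  linear_combination t3 - t4 - t1 + t2

theorem co_even (a b : Idx m n) (X : osp G) :
    F.co a b (ospEven G X) = if par a = par b then F.co a b X else 0 := by
  have : F.hat (ospEven G X) = evenPart (F.hat X) := (evenPart_conj F.even F.even_inv X.1).symm
  rw [co_apply, this, evenPart_apply, par_dual, co_apply]
  split_ifs <;> simp

theorem co_odd (a b : Idx m n) (X : osp G) :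
    F.co a b (ospOdd G X) = if par a = par b then 0 else F.co a b X := by
  have : F.hat (ospOdd G X) = oddPart (F.hat X) := (oddPart_conj F.even F.even_inv X.1).symm
  rw [co_apply, this, oddPart_apply, par_dual, co_apply]
  split_ifs <;> simp

theorem ospEven_K (p q : Idx m n) :
    ospEven G (F.K p q) = if par p = par q then F.K p q else 0 := by
  apply F.hat_injective
  have : F.hat (ospEven G (F.K p q)) = evenPart (F.hat (F.K p q)) :=
    (evenPart_conj F.even F.even_inv _).symm
  rw [this, hat_K, evenPart_wedgeMatrix]
  split_ifs <;> simp [hat_K]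

theorem ospOdd_K (p q : Idx m n) :
    ospOdd G (F.K p q) = if par p = par q then 0 else F.K p q := by
  have h : ospOdd G (F.K p q) = F.K p q - ospEven G (F.K p q) := Subtype.ext (oddPart_eq _)
  rw [h, ospEven_K]
  split_ifs <;> simp

theorem eq_sum_K (X : osp G) : X = (1 / 2 : ℂ) • ∑ a, ∑ b, F.co a b X • F.K a b := by
  apply F.ext_co
  intro c d
  simp only [map_smul, map_sum, co_K, smul_eq_mul, mul_sub, Finset.sum_sub_distrib]
  have h1 : ∑ a, ∑ b, F.co a b X * (if c = a ∧ d = b then (1 : ℂ) else 0) = F.co c d X := by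
    rw [Finset.sum_eq_single c, Finset.sum_eq_single d] <;> simp +contextual [eq_comm]
  have h2 : ∑ a, ∑ b, F.co a b X * (if c = b ∧ d = a then sg a b else 0) = - F.co c d X := by
    rw [Finset.sum_eq_single d, Finset.sum_eq_single c, if_pos ⟨rfl, rfl⟩, F.co_swap c d,
      sg_comm d c]
    · linear_combination (-F.co c d X) * sg_mul_self c d
    all_goals simp +contextual [eq_comm]
  rw [h1, h2]; ring

theorem K_swap (p q : Idx m n) : F.K q p = -sg p q • F.K p q := by
  apply F.ext_co
  intro a b
  rw [map_smul, co_K, co_K, smul_eq_mul, sg_comm q p]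
  split_ifs <;> first | ring1 | linear_combination -sg_mul_self p q

theorem span_K : Submodule.span ℂ (Set.range fun x : Idx m n × Idx m n => F.K x.1 x.2) = ⊤ := by
  rw [eq_top_iff]
  intro X _
  rw [F.eq_sum_K X]
  exact Submodule.smul_mem _ _ (Submodule.sum_mem _ fun a _ => Submodule.sum_mem _ fun b _ =>
    Submodule.smul_mem _ _ (Submodule.subset_span ⟨(a, b), rfl⟩))

/-- The part of the formula for [K p q, K c d] in which q is contracted; the part contracting p is
the same identity with p and q exchanged. -/
theorem bracket_K_aux (p q c d a b : Idx m n) :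
    (if a = p then (if dual q = c ∧ b = d then 1 else 0)
        - (if dual q = d ∧ b = c then sg c d else 0) else 0)
      + sg p a * sg q a * (if b = p then (if a = c ∧ dual q = d then 1 else 0)
        - (if a = d ∧ dual q = c then sg c d else 0) else 0) =
    (if c = dual q then (if a = p ∧ b = d then 1 else 0)
        - (if a = d ∧ b = p then sg p d else 0) else 0)
      + sg p c * sg q c * (if d = dual q then (if a = c ∧ b = p then 1 else 0)
        - (if a = p ∧ b = c then sg c p else 0) else (0 : ℂ)) := by
  have t1 : (if a = p then (if dual q = c ∧ b = d then 1 else 0) else 0)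
      = (if c = dual q then (if a = p ∧ b = d then 1 else 0) else (0 : ℂ)) := by
    simp only [← ite_and]
    exact if_congr (by rw [eq_comm (a := dual q)]; tauto) rfl rfl
  have t2 : (if a = p then (if dual q = d ∧ b = c then sg c d else 0) else 0)
      = sg p c * sg q c * (if d = dual q then (if a = p ∧ b = c then sg c p else 0) else 0) := by
    by_cases hd : d = dual q
    · subst hd
      simp only [true_and, if_true, ite_and, sg_dual_right]
      split_ifs
      · rw [sg_comm c q, sg_comm c p]
        linear_combination (-sg q c) * sg_mul_self p c
      all_goals simp
    · simp [hd, Ne.symm hd]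
  have t3 : sg p a * sg q a * (if b = p then (if a = c ∧ dual q = d then 1 else 0) else 0)
      = sg p c * sg q c * (if d = dual q then (if a = c ∧ b = p then 1 else 0) else (0 : ℂ)) := by
    by_cases hd : d = dual q
    · subst hd
      by_cases ha : a = c
      · subst ha; simp
      · simp [ha]
    · simp [hd, Ne.symm hd]
  have t4 : sg p a * sg q a * (if b = p then (if a = d ∧ dual q = c then sg c d else 0) else 0)
      = (if c = dual q then (if a = d ∧ b = p then sg p d else 0) else 0) := by
    by_cases hc : c = dual q
    · subst hc
      by_cases ha : a = d
      · subst ha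
        by_cases hb : b = p
        · simp only [hb, and_self, if_true, sg_dual_left]
          linear_combination (sg p a) * sg_mul_self q a
        · simp [hb]
      · simp [ha]
    · simp [hc, Ne.symm hc]
  have sp : ∀ (P : Prop) [Decidable P] (x y : ℂ), (if P then x - y else 0)
      = (if P then x else 0) - (if P then y else 0) := by
    intro P _ x y; split_ifs <;> simp
  simp only [sp]
  linear_combination t1 - t2 + t3 - t4

theorem bracket_K (p q c d : Idx m n) : bracket G (F.K p q) (F.K c d) =
    (if c = dual q then eta q • F.K p d else 0)
      - (if c = dual p then (sg p q * eta p) • F.K q d else 0)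
      + (sg p c * sg q c) • ((if d = dual q then eta q • F.K c p else 0)
        - (if d = dual p then (sg p q * eta p) • F.K c q else 0)) := by
  apply F.ext_co
  intro a b
  have hk : ∀ (P : Prop) [Decidable P] (r : ℂ) (x y : Idx m n),
      F.co a b (if P then r • F.K x y else 0) = r * (if P then ((if a = x ∧ b = y then 1 else 0)
        - (if a = y ∧ b = x then sg x y else 0)) else 0) := by
    intro P _ r x y
    by_cases h : P
    · rw [if_pos h, if_pos h, map_smul, co_K, smul_eq_mul]
    · rw [if_neg h, if_neg h, map_zero, mul_zero]
  have hm : ∀ (P : Prop) [Decidable P] (r x : ℂ), (if P then r * x else 0)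
      = r * (if P then x else 0) := by
    intro P _ r x
    split_ifs <;> simp
  rw [co_bracket, map_add, map_sub, map_smul, map_sub]
  simp only [hk, hm, smul_eq_mul, co_K]
  linear_combination (eta q) * bracket_K_aux p q c d a b
    - (sg p q * eta p) * bracket_K_aux q p c d a b

end Frame

/-- With J the parity matrix, gᵀ = Jg, so gᵀg = 1 becomes g² = J: the two metrics used to lower and
raise indices merge into the sign of the supertrace. -/
theorem form_eq_trace (X Y : osp G) : form G X Y = (parityMatrix m n * X.1 * Y.1).trace := by
  have h3 : (G.g)ᵀ * G.g = 1 := by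
    ext a b; simp [Matrix.mul_apply, G.inv, Matrix.one_apply]
  have h4 : (G.g)ᵀ = parityMatrix m n * G.g := by
    ext a b
    rw [parityMatrix, Matrix.diagonal_mul, Matrix.transpose_apply]
    by_cases h : par a = par b
    · rw [G.supersymm a b, h]
      rcases par_cases b with hb | hb <;> simp [hb]
    · rw [G.even a b h, G.even b a (Ne.symm h), mul_zero]
  have h5 : G.g * G.g = parityMatrix m n := by
    rw [h4] at h3
    calc G.g * G.g = parityMatrix m n * (parityMatrix m n * G.g * G.g) := by
          simp only [← mul_assoc, parityMatrix_mul_self, one_mul]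
      _ = _ := by rw [h3, mul_one]
  have h6 : form G X Y = ((G.g * X.1) * (Y.1 * G.g)).trace := by
    simp only [form, lowered, raised, Matrix.trace, Matrix.diag_apply, Matrix.mul_apply,
      mul_comm (G.g _ _) (Y.1 _ _)]
  rw [h6, ← h5, ← mul_assoc, Matrix.trace_mul_comm]
  simp only [mul_assoc]

/-- The invariant form as a bilinear map. -/
def formL (G : Metric m n) : osp G →ₗ[ℂ] osp G →ₗ[ℂ] ℂ :=
  LinearMap.mk₂ ℂ (form G)
    (by intro X X' Y; simp [form_eq_trace, mul_add, add_mul])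
    (by intro r X Y; simp [form_eq_trace])
    (by intro X Y Y'; simp [form_eq_trace, mul_add])
    (by intro r X Y; simp [form_eq_trace])

theorem formL_apply (X Y : osp G) : formL G X Y = form G X Y := rfl

namespace Frame

variable (F : Frame W)

theorem form_eq_sum (X Y : osp G) :
    form G X Y = ∑ a, ∑ b, eta a * eta b * F.co a b X * F.co (dual b) (dual a) Y := by
  have h1 : form G X Y = (parityMatrix m n * (F.hat X * F.hat Y)).trace := by
    have : F.hat X * F.hat Y = F.Bi * (X.1 * Y.1) * F.B := by
      calc _ = F.Bi * X.1 * (F.B * F.Bi) * Y.1 * F.B := by simp only [hat_apply, mul_assoc]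
        _ = _ := by rw [F.mul_inv]; simp only [mul_assoc, one_mul]
    calc form G X Y = (parityMatrix m n * (F.B * F.Bi) * (X.1 * Y.1)).trace := by
          rw [form_eq_trace, F.mul_inv, mul_one, mul_assoc]
      _ = (F.B * (parityMatrix m n * F.Bi * (X.1 * Y.1))).trace := by
          rw [← mul_assoc (parityMatrix m n), parityMatrix_mul_comm F.even]; simp only [mul_assoc]
      _ = _ := by rw [Matrix.trace_mul_comm, this]; simp only [mul_assoc]
  rw [h1, Matrix.trace]
  refine Finset.sum_congr rfl fun a _ => ?_
  rw [Matrix.diag_apply, parityMatrix, Matrix.diagonal_mul, Matrix.mul_apply, Finset.mul_sum,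
    ← sum_dual]
  refine Finset.sum_congr rfl fun b _ => ?_
  have hJ : (-1 : ℂ) ^ par a = sg a a := by
    rcases par_cases a with ha | ha <;> simp [sg, ha]
  rw [hat_eq_co, hat_eq_co, dual_dual, hJ, eta_dual a]
  linear_combination (eta b * F.co a b X * eta a * F.co (dual b) (dual a) Y) * sg_mul_self a a

theorem form_K (p q : Idx m n) (X : osp G) :
    form G (F.K p q) X = 2 * eta p * eta q * F.co (dual q) (dual p) X := by
  rw [F.form_eq_sum]
  simp only [co_K, mul_sub, sub_mul, Finset.sum_sub_distrib]
  rw [Finset.sum_eq_single p, Finset.sum_eq_single q, Finset.sum_eq_single q,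
    Finset.sum_eq_single p]
  · have := F.co_swap (dual p) (dual q) X
    simp only [and_self, if_true, mul_one] at this ⊢
    rw [this, sg_dual_left, sg_dual_right]
    linear_combination (0 : ℂ) * sg_mul_self p q
  all_goals simp +contextual [eq_comm]

theorem form_bracket_K (p q c d : Idx m n) (X : osp G) :
    formL G (bracket G (F.K p q) (F.K c d)) X =
      -(sg p c * sg q c * (sg p d * sg q d)) * formL G (F.K c d) (bracket G (F.K p q) X) := by
  have hk : ∀ (P : Prop) [Decidable P] (r : ℂ) (x y : Idx m n),
      formL G (if P then r • F.K x y else 0) X = r * (if P then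
        2 * eta x * eta y * F.co (dual y) (dual x) X else 0) := by
    intro P _ r x y
    split_ifs <;> simp [formL_apply, form_K]
  have hm : ∀ (P : Prop) [Decidable P] (r x : ℂ), (if P then r * x else 0)
      = r * (if P then x else 0) := by
    intro P _ r x
    split_ifs <;> simp
  -- These are the terms contracted through q; those contracted through p follow from the same
  -- identity with p and q exchanged.
  have key : ∀ p q : Idx m n,
      eta q * (if c = dual q then 2 * eta p * eta d * F.co (dual d) (dual p) X else 0)
      + (sg p c * sg q c) * (eta q *
        (if d = dual q then 2 * eta c * eta p * F.co (dual p) (dual c) X else 0)) =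
      -(sg p c * sg q c * (sg p d * sg q d)) * (2 * eta c * eta d) *
      (-(sg p q * eta p) * (if dual d = q then F.co (dual p) (dual c) X else 0)
        - sg p d * sg q d * ((sg p q * eta p) *
         (if dual c = q then F.co (dual d) (dual p) X else 0))) := by
    intro p q
    have t1 : eta q * (if c = dual q then 2 * eta p * eta d * F.co (dual d) (dual p) X else 0) =
        (sg p c * sg q c * (sg p d * sg q d)) * (2 * eta c * eta d) * (sg p d * sg q d *
          ((sg p q * eta p) * (if dual c = q then F.co (dual d) (dual p) X else 0))) := by
      by_cases h : c = dual q
      · subst h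
        simp only [dual_dual, if_true, sg_dual_right, eta_dual]
        linear_combination (-2 * eta q * eta p * eta d * F.co (dual d) (dual p) X) *
          (sg_mul_self p q + sg p q * sg p q * sg_mul_self q q
          + sg p q * sg p q * sg q q * sg q q * sg_mul_self p d
          + sg p q * sg p q * sg q q * sg q q * sg p d * sg p d * sg_mul_self q d)
      · rw [if_neg h, if_neg (fun h' => h (by rw [← h', dual_dual]))]; simp
    have t2 : (sg p c * sg q c) * (eta q *
        (if d = dual q then 2 * eta c * eta p * F.co (dual p) (dual c) X else 0)) =
        (sg p c * sg q c * (sg p d * sg q d)) * (2 * eta c * eta d) *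
        ((sg p q * eta p) * (if dual d = q then F.co (dual p) (dual c) X else 0)) := by
      by_cases h : d = dual q
      · subst h
        simp only [dual_dual, if_true, sg_dual_right, eta_dual]
        linear_combination (-2 * sg p c * sg q c * eta q * eta p * eta c *
          F.co (dual p) (dual c) X) * (sg_mul_self p q + sg p q * sg p q * sg_mul_self q q)
      · rw [if_neg h, if_neg (fun h' => h (by rw [← h', dual_dual]))]; simp
    linear_combination t1 + t2
  rw [bracket_K, formL_apply (F.K c d), form_K, co_bracket]
  simp only [map_add, map_sub, map_smul, LinearMap.add_apply, LinearMap.sub_apply,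
    LinearMap.smul_apply, smul_eq_mul, hk, hm _ (eta _), hm _ (sg _ _ * _), sg_dual_right]
  have e : sg p q * sg q p = 1 := by rw [sg_comm q p, sg_mul_self]
  linear_combination key p q - sg p q * key q p - 2 * eta q * sg p c * sg q c * sg p d * sg q d *
    eta c * eta d * ((if dual d = p then F.co (dual q) (dual c) X else 0)
      + sg p d * sg q d * (if dual c = p then F.co (dual d) (dual q) X else 0)) * e

end Frame

end

/-! ### The action on g ⊗ g and the submodule of Weyl tensors. -/

section

variable {m n : ℕ} {G : Metric m n} {W : WittBasis G}

theorem tensorAct_add (X Y : osp G) : tensorAct G (X + Y) = tensorAct G X + tensorAct G Y := by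
  simp only [tensorAct, map_add, TensorProduct.map_add_left, TensorProduct.map_add_right]; abel

theorem tensorAct_smul (r : ℂ) (X : osp G) : tensorAct G (r • X) = r • tensorAct G X := by
  simp only [tensorAct, map_smul, TensorProduct.map_smul_left, TensorProduct.map_smul_right,
    smul_add]

theorem tensorAct_tmul (X U V : osp G) : tensorAct G X (U ⊗ₜ[ℂ] V) =
    bracket G X U ⊗ₜ V + U ⊗ₜ bracket G (ospEven G X) V
      + (ospEven G U - ospOdd G U) ⊗ₜ bracket G (ospOdd G X) V := rfl

/-- The parity automorphism `X ↦ (-1)^{|X|} X`. -/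
def theta (G : Metric m n) : osp G →ₗ[ℂ] osp G := ospEven G - ospOdd G

/-- The parity automorphism of `g ⊗ g`. -/
def tensorTheta (G : Metric m n) : osp G ⊗[ℂ] osp G →ₗ[ℂ] osp G ⊗[ℂ] osp G :=
  TensorProduct.map (theta G) (theta G)

namespace Frame

variable (F : Frame W)

theorem isSubrep_of_K {N : Submodule ℂ (osp G ⊗[ℂ] osp G)}
    (h : ∀ p q, ∀ t ∈ N, tensorAct G (F.K p q) t ∈ N) : IsSubrep G N := by
  intro X t ht
  have hX : X ∈ Submodule.span ℂ (Set.range fun x : Idx m n × Idx m n => F.K x.1 x.2) := by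
    rw [F.span_K]; trivial
  induction hX using Submodule.span_induction with
  | mem x hx => obtain ⟨y, rfl⟩ := hx; exact h _ _ t ht
  | zero =>
    have : tensorAct G (0 : osp G) = 0 := by simpa using tensorAct_smul (0 : ℂ) (0 : osp G)
    rw [this]; exact N.zero_mem
  | add x y _ _ hx hy => rw [tensorAct_add]; exact N.add_mem hx hy
  | smul r x _ hx => rw [tensorAct_smul]; exact N.smul_mem r hx

/-- The components `T^{abcd}` of `T ∈ g ⊗ g` in the Witt basis. -/
def cc (a b c d : Idx m n) : osp G ⊗[ℂ] osp G →ₗ[ℂ] ℂ :=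
  LinearMap.mul' ℂ ℂ ∘ₗ TensorProduct.map (F.co a b) (F.co c d)

@[simp] theorem cc_tmul (a b c d : Idx m n) (X Y : osp G) :
    F.cc a b c d (X ⊗ₜ Y) = F.co a b X * F.co c d Y := rfl

theorem eq_sum_cc (T : osp G ⊗[ℂ] osp G) :
    T = (1 / 4 : ℂ) • ∑ a, ∑ b, ∑ c, ∑ d, F.cc a b c d T • F.K a b ⊗ₜ[ℂ] F.K c d := by
  induction T using TensorProduct.induction_on with
  | zero => simp
  | tmul X Y =>
    conv_lhs => rw [F.eq_sum_K X, F.eq_sum_K Y]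
    rw [TensorProduct.smul_tmul_smul]
    simp only [TensorProduct.sum_tmul]
    simp only [TensorProduct.tmul_sum, TensorProduct.smul_tmul_smul, cc_tmul]
    congr 1
    norm_num
  | add T T' h h' =>
    conv_lhs => rw [h, h']
    simp only [map_add, add_smul, Finset.sum_add_distrib, smul_add]

theorem eq_zero_of_cc {T : osp G ⊗[ℂ] osp G} (h : ∀ a b c d, F.cc a b c d T = 0) : T = 0 := by
  rw [F.eq_sum_cc T]; simp [h]

theorem cc_swap_left (a b c d : Idx m n) (T : osp G ⊗[ℂ] osp G) :
    F.cc b a c d T = -sg a b * F.cc a b c d T := by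
  induction T using TensorProduct.induction_on with
  | zero => simp
  | tmul X Y => rw [cc_tmul, cc_tmul, co_swap]; ring
  | add T T' h h' => rw [map_add, map_add, h, h']; ring

theorem cc_swap_right (a b c d : Idx m n) (T : osp G ⊗[ℂ] osp G) :
    F.cc a b d c T = -sg c d * F.cc a b c d T := by
  induction T using TensorProduct.induction_on with
  | zero => simp
  | tmul X Y => rw [cc_tmul, cc_tmul, F.co_swap c d]; ring
  | add T T' h h' => rw [map_add, map_add, h, h']; ring

theorem co_theta (a b : Idx m n) (X : osp G) :
    F.co a b (theta G X) = sg a a * sg b b * F.co a b X := by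
  rw [theta, LinearMap.sub_apply, map_sub, co_even, co_odd]
  rcases par_cases a with ha | ha <;> rcases par_cases b with hb | hb <;> simp [sg, ha, hb]

theorem cc_theta (a b c d : Idx m n) (T : osp G ⊗[ℂ] osp G) :
    F.cc a b c d (tensorTheta G T) = sg a a * sg b b * (sg c c * sg d d) * F.cc a b c d T := by
  induction T using TensorProduct.induction_on with
  | zero => simp
  | tmul X Y => rw [tensorTheta, TensorProduct.map_tmul, cc_tmul, cc_tmul, co_theta, co_theta]; ring
  | add T T' h h' => rw [map_add, map_add, map_add, h, h']; ring

theorem cc_act_tmul (p q a b c d : Idx m n) (X Y : osp G) :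
    F.cc a b c d (tensorAct G (F.K p q) (X ⊗ₜ Y)) =
      F.co a b (bracket G (F.K p q) X) * F.co c d Y
      + sg p a * sg q a * (sg p b * sg q b) * (F.co a b X * F.co c d (bracket G (F.K p q) Y)) := by
  rw [tensorAct_tmul, ospEven_K, ospOdd_K]
  have h := F.co_theta a b X
  rw [theta, LinearMap.sub_apply] at h
  by_cases hpq : par p = par q
  · have e2 : sg p a * sg q a * (sg p b * sg q b) = 1 := by
      rcases par_cases q with hq | hq <;> rcases par_cases a with ha | ha <;>
        rcases par_cases b with hb | hb <;> simp [sg, hpq, hq, ha, hb]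
    rw [if_pos hpq, if_pos hpq, e2]
    simp
  · have e2 : sg p a * sg q a * (sg p b * sg q b) = sg a a * sg b b := by
      rcases par_cases p with hp | hp <;> rcases par_cases q with hq | hq <;>
        rcases par_cases a with ha | ha <;> rcases par_cases b with hb | hb <;>
        simp [sg, hp, hq, ha, hb] at hpq ⊢
    rw [if_neg hpq, if_neg hpq, e2, map_add, map_add, cc_tmul, cc_tmul, cc_tmul, h]
    simp; ring

/-- The components of `(b_p ∧ b_q) · T`. -/
theorem cc_act (p q a b c d : Idx m n) (T : osp G ⊗[ℂ] osp G) :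
    F.cc a b c d (tensorAct G (F.K p q) T) =
      ((if a = p then eta q * F.cc (dual q) b c d T else 0)
        - (if a = q then sg p q * eta p * F.cc (dual p) b c d T else 0))
      + sg p a * sg q a * ((if b = p then eta q * F.cc a (dual q) c d T else 0)
        - (if b = q then sg p q * eta p * F.cc a (dual p) c d T else 0))
      + sg p a * sg q a * (sg p b * sg q b) *
        ((if c = p then eta q * F.cc a b (dual q) d T else 0)
        - (if c = q then sg p q * eta p * F.cc a b (dual p) d T else 0))
      + sg p a * sg q a * (sg p b * sg q b) * (sg p c * sg q c) *
        ((if d = p then eta q * F.cc a b c (dual q) T else 0)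
        - (if d = q then sg p q * eta p * F.cc a b c (dual p) T else 0)) := by
  induction T using TensorProduct.induction_on with
  | zero => simp
  | tmul X Y =>
    have hm : ∀ (P : Prop) [Decidable P] (r x : ℂ), (if P then r * x else 0)
        = r * x * (if P then 1 else 0) := by
      intro P _ r x
      split_ifs <;> simp
    rw [cc_act_tmul, co_bracket, co_bracket]
    simp only [cc_tmul, hm]
    ring
  | add T T' h h' =>
    have hm : ∀ (P : Prop) [Decidable P] (r x : ℂ), (if P then r * x else 0)
        = r * x * (if P then 1 else 0) := by
      intro P _ r x
      split_ifs <;> simp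
    rw [map_add, map_add, h, h']
    simp only [map_add, hm]
    ring

/-- The tensors in `g ⊗ g` with the symmetries of the Weyl curvature: they satisfy the
Bianchi identity and are traceless. -/
def weyl : Submodule ℂ (osp G ⊗[ℂ] osp G) where
  carrier := {T | (∀ a b c d, F.cc a b c d T + sg a b * sg a c * F.cc b c a d T
      + sg a c * sg b c * F.cc c a b d T = 0) ∧ ∀ a d, ∑ b, eta b * F.cc a b (dual b) d T = 0}
  zero_mem' := by simp
  add_mem' := by
    rintro T T' ⟨h1, h2⟩ ⟨h1', h2'⟩
    refine ⟨fun a b c d => ?_, fun a d => ?_⟩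
    · simp only [map_add]; linear_combination h1 a b c d + h1' a b c d
    · simp only [map_add, mul_add, Finset.sum_add_distrib, h2, h2', add_zero]
  smul_mem' := by
    rintro r T ⟨h1, h2⟩
    refine ⟨fun a b c d => ?_, fun a d => ?_⟩
    · simp only [map_smul, smul_eq_mul]; linear_combination r * h1 a b c d
    · simp only [map_smul, smul_eq_mul, mul_left_comm _ r, ← Finset.mul_sum, h2, mul_zero]

variable {F}

theorem weyl_bianchi {T : osp G ⊗[ℂ] osp G} (hT : T ∈ F.weyl) (a b c d : Idx m n) :
    F.cc a b c d T + sg a b * sg a c * F.cc b c a d T + sg a c * sg b c * F.cc c a b d T = 0 :=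
  hT.1 a b c d

theorem weyl_trace {T : osp G ⊗[ℂ] osp G} (hT : T ∈ F.weyl) (a d : Idx m n) :
    ∑ b, eta b * F.cc a b (dual b) d T = 0 :=
  hT.2 a d

variable (F)

/-- `IsSubrep` does not require a grading, while `perp_isSubrep` needs parity stability; this
supplies it for Weyl tensors. -/
theorem weyl_theta {T : osp G ⊗[ℂ] osp G} (hT : T ∈ F.weyl) : tensorTheta G T ∈ F.weyl := by
  refine ⟨fun a b c d => ?_, fun a d => ?_⟩
  · simp only [cc_theta]
    linear_combination (sg a a * sg b b * sg c c * sg d d) * weyl_bianchi hT a b c d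
  · have : ∀ b, eta b * F.cc a b (dual b) d (tensorTheta G T)
        = sg a a * sg d d * (eta b * F.cc a b (dual b) d T) := by
      intro b
      rw [cc_theta, sg_dual_left, sg_dual_right]
      linear_combination (sg a a * sg d d * eta b * F.cc a b (dual b) d T) * sg_mul_self b b
    simp only [this, ← Finset.mul_sum, weyl_trace hT, mul_zero]

/-- Tensors with the symmetries of the Weyl curvature are symmetric under exchange of the two
factors. -/
theorem weyl_pair {T : osp G ⊗[ℂ] osp G} (hT : T ∈ F.weyl) (a b c d : Idx m n) :
    F.cc c d a b T = sg a c * sg a d * (sg b c * sg b d) * F.cc a b c d T := by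
  -- As for the Riemann tensor: the Bianchi identities for the four rotations of (a,b,c,d), with
  -- antisymmetry in each pair, force pair symmetry. The signs are checked parity by parity.
  have h1 := weyl_bianchi hT a b c d
  have h2 := weyl_bianchi hT b c d a
  have h3 := weyl_bianchi hT c d a b
  have h4 := weyl_bianchi hT d a b c
  rw [F.cc_swap_left a c b d] at h1
  rw [F.cc_swap_right b c a d, F.cc_swap_left b d c a, F.cc_swap_right b d a c,
    F.cc_swap_right c d a b] at h2
  rw [F.cc_swap_left a d c b, F.cc_swap_right a d b c, F.cc_swap_right a c b d] at h3
  rw [F.cc_swap_left a d b c, F.cc_swap_right a b c d] at h4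
  rcases par_cases a with ha | ha <;> rcases par_cases b with hb | hb <;>
    rcases par_cases c with hc | hc <;> rcases par_cases d with hd | hd <;>
    simp [sg, ha, hb, hc, hd] at h1 h2 h3 h4 ⊢ <;> grind

theorem weyl_isSubrep : IsSubrep G F.weyl := by
  refine F.isSubrep_of_K fun p q T hT => ⟨fun a b c d => ?_, fun a d => ?_⟩
  · have hm : ∀ (P : Prop) [Decidable P] (x : ℂ), (if P then x else 0)
        = x * (if P then 1 else 0) := by
      intro P _ x
      split_ifs <;> simp
    -- `ka`, `kb`, `kc` collect the terms in which a, b or c is replaced; each is a Bianchi identity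
    -- for the new index. The index d is not permuted, so its terms need no such preparation.
    have ka : ∀ p q : Idx m n, (if a = p then 1 else 0) * (F.cc (dual q) b c d T
        + sg a b * sg a c * (sg p b * sg q b * (sg p c * sg q c)) * F.cc b c (dual q) d T
        + sg a c * sg b c * (sg p c * sg q c) * F.cc c (dual q) b d T) = 0 := by
      intro p q
      split_ifs with h
      · subst h
        have := weyl_bianchi hT (dual q) b c d
        simp only [sg_dual_left] at this
        linear_combination this + sg q b * sg q c * F.cc b c (dual q) d T *
          (sg a c * sg a c * sg_mul_self a b + sg_mul_self a c)
          + sg b c * sg q c * F.cc c (dual q) b d T * sg_mul_self a c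
      · simp
    have kb : ∀ p q : Idx m n, (if b = p then 1 else 0) * (sg p a * sg q a * F.cc a (dual q) c d T
        + sg a b * sg a c * F.cc (dual q) c a d T
        + sg a c * sg b c * (sg p c * sg q c * (sg p a * sg q a)) * F.cc c a (dual q) d T) = 0 := by
      intro p q
      split_ifs with h
      · subst h
        have := weyl_bianchi hT a (dual q) c d
        simp only [sg_dual_left, sg_dual_right] at this
        rw [sg_comm a q] at this
        rw [sg_comm a b]
        linear_combination (sg b a * sg q a) * this
          - sg b a * sg a c * F.cc (dual q) c a d T * sg_mul_self q a
          + sg a c * sg q c * sg b a * sg q a * F.cc c a (dual q) d T * sg_mul_self b c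
      · simp
    have kc : ∀ p q : Idx m n, (if c = p then 1 else 0) *
        (sg p a * sg q a * (sg p b * sg q b) * F.cc a b (dual q) d T
        + sg a b * sg a c * (sg p b * sg q b) * F.cc b (dual q) a d T
        + sg a c * sg b c * F.cc (dual q) a b d T) = 0 := by
      intro p q
      split_ifs with h
      · subst h
        have := weyl_bianchi hT a b (dual q) d
        simp only [sg_dual_right] at this
        rw [sg_comm a q, sg_comm b q] at this
        rw [sg_comm a c, sg_comm b c]
        linear_combination (sg c a * sg q a * (sg c b * sg q b)) * this
          - (sg a b * sg c a * sg c b * sg q b * F.cc b (dual q) a d T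
            + sg c a * sg c b * sg q b * sg q b * F.cc (dual q) a b d T) * sg_mul_self q a
          - sg c a * sg c b * F.cc (dual q) a b d T * sg_mul_self q b
      · simp
    simp only [cc_act, hm _ (_ * _)]
    linear_combination eta q * (ka p q + kb p q + kc p q) - sg p q * eta p * (ka q p + kb q p + kc q p)
      + sg p a * sg q a * (sg p b * sg q b) * (sg p c * sg q c) *
        (eta q * (if d = p then 1 else 0) * weyl_bianchi hT a b c (dual q)
          - sg p q * eta p * (if d = q then 1 else 0) * weyl_bianchi hT a b c (dual p))
  -- The terms acting on the contracted pair sit at b = p, q, p*, q* and cancel in pairs after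
  -- summation, because the metric is invariant; the remaining terms are again traces of T.
  · have e : ∀ b, eta b * F.cc a b (dual b) d (tensorAct G (F.K p q) T) =
        (if a = p then eta q else 0) * (eta b * F.cc (dual q) b (dual b) d T)
        - (if a = q then sg p q * eta p else 0) * (eta b * F.cc (dual p) b (dual b) d T)
        + sg p a * sg q a * ((if b = p then eta p * eta q * F.cc a (dual q) (dual p) d T else 0)
          - (if b = q then sg p q * eta p * eta q * F.cc a (dual p) (dual q) d T else 0)
          + (if b = dual p then sg p q * eta p * eta q * F.cc a (dual p) (dual q) d T else 0)
          - (if b = dual q then eta p * eta q * F.cc a (dual q) (dual p) d T else 0))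
        + sg p a * sg q a * ((if d = p then eta q else 0) * (eta b * F.cc a b (dual b) (dual q) T)
        - (if d = q then sg p q * eta p else 0) * (eta b * F.cc a b (dual b) (dual p) T)) := by
      intro b
      have hm : ∀ (P : Prop) [Decidable P] (r x : ℂ), (if P then r * x else 0)
          = r * x * (if P then 1 else 0) := by
        intro P _ r x
        split_ifs <;> simp
      have hm' : ∀ (P : Prop) [Decidable P] (x : ℂ), (if P then x else 0)
          = x * (if P then 1 else 0) := by
        intro P _ x
        split_ifs <;> simp
      have t1 : eta b * (if b = p then eta q * F.cc a (dual q) (dual b) d T else 0) =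
          if b = p then eta p * eta q * F.cc a (dual q) (dual p) d T else 0 := by
        by_cases h : b = p
        · subst h; simp; ring
        · simp [h]
      have t2 : eta b * (if b = q then sg p q * eta p * F.cc a (dual p) (dual b) d T else 0) =
          if b = q then sg p q * eta p * eta q * F.cc a (dual p) (dual q) d T else 0 := by
        by_cases h : b = q
        · subst h; simp; ring
        · simp [h]
      have t3 : eta b * (sg p b * sg q b *
          (if dual b = p then eta q * F.cc a b (dual q) d T else 0)) =
          if b = dual p then sg p q * eta p * eta q * F.cc a (dual p) (dual q) d T else 0 := by
        by_cases h : b = dual p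
        · subst h
          simp only [dual_dual, if_true, eta_dual, sg_dual_right, sg_comm q p]
          linear_combination (sg p q * eta p * eta q * F.cc a (dual p) (dual q) d T) *
            sg_mul_self p p
        · rw [if_neg h, if_neg (fun h' => h (by rw [← h', dual_dual]))]; simp
      have t4 : eta b * (sg p b * sg q b *
          (if dual b = q then sg p q * eta p * F.cc a b (dual p) d T else 0)) =
          if b = dual q then eta p * eta q * F.cc a (dual q) (dual p) d T else 0 := by
        by_cases h : b = dual q
        · subst h
          simp only [dual_dual, if_true, eta_dual, sg_dual_right]
          linear_combination (eta p * eta q * F.cc a (dual q) (dual p) d T) *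
            (sg p q * sg p q * sg_mul_self q q + sg_mul_self p q)
        · rw [if_neg h, if_neg (fun h' => h (by rw [← h', dual_dual]))]; simp
      have hk : sg p b * sg q b * (sg p b * sg q b) = 1 := by
        linear_combination (sg q b * sg q b) * sg_mul_self p b + sg_mul_self q b
      rw [cc_act, ← t1, ← t2, ← t3, ← t4, sg_dual_right, sg_dual_right]
      rw [hm (a = p), hm (a = q), hm (d = p), hm (d = q), hm' (a = p) (eta q),
        hm' (a = q) (sg p q * eta p), hm' (d = p) (eta q), hm' (d = q) (sg p q * eta p)]
      linear_combination (eta b * sg p a * sg q a * (eta q * F.cc a b (dual b) (dual q) T *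
        (if d = p then 1 else 0) - sg p q * eta p * F.cc a b (dual b) (dual p) T *
        (if d = q then 1 else 0))) * hk
    simp only [e, Finset.sum_add_distrib, Finset.sum_sub_distrib, ← Finset.mul_sum,
      weyl_trace hT, Finset.sum_ite_eq', Finset.mem_univ, if_true]
    ring

end Frame

end

/-! ### Submodules of Weyl tensors on which one extremal component vanishes. -/

section

variable {m n : ℕ} {G : Metric m n} {W : WittBasis G}

/-- `o`, `t`, `r` are even indices such that `o`, `t` and their duals are four distinct indices,
none of which is `r`. -/
structure Sep (o t r : Idx m n) : Prop where
  par_o : par o = 0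
  par_t : par t = 0
  par_r : par r = 0
  o_o : o ≠ dual o
  t_t : t ≠ dual t
  o_t : o ≠ t
  o_dt : o ≠ dual t
  r_o : r ≠ o
  r_do : r ≠ dual o
  r_t : r ≠ t
  r_dt : r ≠ dual t
  exists_odd : ∃ u : Idx m n, par u = 1

theorem sg_of_even {a : Idx m n} (h : par a = 0) (b : Idx m n) : sg a b = 1 := by simp [sg, h]
theorem sg_of_even' {a : Idx m n} (h : par a = 0) (b : Idx m n) : sg b a = 1 := by simp [sg, h]
theorem eta_of_even {a : Idx m n} (h : par a = 0) : eta a = 1 := by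
  rcases a with a | a
  · rfl
  · simp [par] at h

/-- A submodule of Weyl tensors whose `o t o t` components vanish. -/
structure Vanishing (F : Frame W) (o t r : Idx m n) (U : Submodule ℂ (osp G ⊗[ℂ] osp G)) :
    Prop where
  dim_ne_one : (m : ℂ) - 2 * n ≠ 1
  dim_ne_two : (m : ℂ) - 2 * n ≠ 2
  sep : Sep o t r
  subrep : IsSubrep G U
  le : U ≤ F.weyl
  zero : ∀ T ∈ U, F.cc o t o t T = 0

namespace Vanishing

variable {F : Frame W} {o t r : Idx m n} {U : Submodule ℂ (osp G ⊗[ℂ] osp G)}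

/-- The propagation principle: a component that vanishes on all of U also vanishes on K p q · T.
With q = x*, the action turns one index p into x and one index x* into p*; below, p and x are chosen
so that few terms survive. -/
theorem act {a b c d : Idx m n} (hU : Vanishing F o t r U) (h : ∀ T ∈ U, F.cc a b c d T = 0)
    (p q : Idx m n) {T} (hT : T ∈ U) :
      ((if a = p then eta q * F.cc (dual q) b c d T else 0)
        - (if a = q then sg p q * eta p * F.cc (dual p) b c d T else 0))
      + sg p a * sg q a * ((if b = p then eta q * F.cc a (dual q) c d T else 0)
        - (if b = q then sg p q * eta p * F.cc a (dual p) c d T else 0))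
      + sg p a * sg q a * (sg p b * sg q b) *
        ((if c = p then eta q * F.cc a b (dual q) d T else 0)
        - (if c = q then sg p q * eta p * F.cc a b (dual p) d T else 0))
      + sg p a * sg q a * (sg p b * sg q b) * (sg p c * sg q c) *
        ((if d = p then eta q * F.cc a b c (dual q) T else 0)
        - (if d = q then sg p q * eta p * F.cc a b c (dual p) T else 0)) = 0 := by
  rw [← F.cc_act]; exact h _ (hU.subrep _ _ hT)

/-- Replacing t by x in T^{otot} gives T^{oxot} + T^{otox}, and the two terms agree by pair
symmetry. -/
theorem otox (hU : Vanishing F o t r U) {x : Idx m n} (h1 : x ≠ dual o) (h2 : x ≠ dual t) {T}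
    (hT : T ∈ U) : F.cc o x o t T = 0 ∧ F.cc o t o x T = 0 := by
  obtain ⟨ho, ht, hr, hoo, htt, hot, hodt, -, -, -, -, -⟩ := hU.sep
  have h := hU.act hU.zero t (dual x) hT
  have hp := F.weyl_pair (hU.le hT) o x o t
  rw [Ne, eq_dual_comm] at h1 h2
  simp only [sg_of_even ho, sg_of_even ht, sg_of_even' ho, sg_of_even' ht, hot, h1, h2, if_true,
    if_false, dual_dual, one_mul, mul_zero, add_zero, zero_add, sub_zero] at h hp
  have : 2 * eta (dual x) * F.cc o x o t T = 0 := by rw [hp] at h; linear_combination h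
  have h3 : F.cc o x o t T = 0 := by simpa [eta_ne_zero] using this
  exact ⟨h3, by rw [hp, h3]⟩

/-- Replacing t by y in T^{oxot} = 0: the only other contribution turns x = y* into t*. Thus
T^{oxoy} is a multiple of the metric, with factor T^{o t* o t}. -/
theorem oxoy_aux (hU : Vanishing F o t r U) {x y : Idx m n} (h1 : x ≠ dual o) (h2 : x ≠ dual t)
    (h1' : y ≠ dual o) (h2' : y ≠ dual t) (hx : x ≠ t) {T} (hT : T ∈ U) :
    eta (dual y) * (sg x y * F.cc o x o y T) =
      if x = dual y then F.cc o (dual t) o t T else 0 := by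
  obtain ⟨ho, ht, hr, hoo, htt, hot, hodt, -, -, -, -, -⟩ := hU.sep
  have h := hU.act (fun T hT => (hU.otox h1 h2 hT).1) t (dual y) hT
  rw [Ne, eq_dual_comm] at h1' h2'
  simp only [sg_of_even ht, sg_of_even' ho, hot, h1', h2', hx, if_true, if_false, dual_dual,
    mul_one, sg_dual_left, zero_add, sub_zero, eta_of_even ht, one_mul, sub_self] at h
  rw [sg_comm x y]
  split_ifs at h ⊢ with hxy <;> linear_combination h

/-- The trace of T^{o b b* o} over b receives -k from each even and +k from each odd b, except 0 at
b = o, o*. Tracelessness reads k(M - 2) = 0. -/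
theorem otodt (hU : Vanishing F o t r U) {T} (hT : T ∈ U) : F.cc o (dual t) o t T = 0 := by
  obtain ⟨ho, ht, hr, hoo, htt, hot, hodt, -, -, -, -, -⟩ := hU.sep
  set k := F.cc o (dual t) o t T with hk
  have hk' : F.cc o t o (dual t) T = k := by
    rw [F.weyl_pair (hU.le hT) o (dual t) o t]
    simp only [sg_of_even ho, sg_of_even' ho, sg_dual_left, sg_of_even ht, one_mul, hk]
  have h0 : F.cc o o o (dual o) T = 0 := by
    have := F.cc_swap_left o o o (dual o) T
    rw [sg_of_even ho] at this
    linear_combination (1 / 2 : ℂ) * this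
  have h0' : F.cc o (dual o) o o T = 0 := by
    have := F.cc_swap_right o (dual o) o o T
    rw [sg_of_even ho] at this
    linear_combination (1 / 2 : ℂ) * this
  have e : ∀ b, eta b * F.cc o b (dual b) o T =
      -k * (sg b b - (if b = o then 1 else 0) - (if b = dual o then 1 else 0)) := by
    intro b
    rw [F.cc_swap_right o b o (dual b), sg_of_even ho]
    by_cases h1 : b = o
    · subst h1; simp [h0, sg_of_even ho, hoo]
    by_cases h2 : b = dual o
    · subst h2; simp [h0', sg_of_even ho, hoo.symm]
    by_cases h3 : b = t
    · subst h3; simp [hk', h1, h2, sg_of_even ht, eta_of_even ht]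
    by_cases h4 : b = dual t
    · subst h4; simp [← hk, h1, h2, sg_of_even ht, eta_of_even (show par (dual t) = 0 by simpa)]
    · have h1' : dual b ≠ dual o := fun h => h1 (dual_inj.1 h)
      have h3' : dual b ≠ dual t := fun h => h3 (dual_inj.1 h)
      have := hU.oxoy_aux h2 h4 h1' h3' h3 hT
      rw [dual_dual, if_pos rfl, sg_dual_right] at this
      rw [if_neg h1, if_neg h2]
      linear_combination (-sg b b) * this + (eta b * F.cc o b o (dual b) T) * sg_mul_self b b
  have tr := Frame.weyl_trace (hU.le hT) o o
  simp only [e, ← Finset.mul_sum, Finset.sum_sub_distrib, Finset.sum_ite_eq', Finset.mem_univ,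
    if_true, sum_sg_self] at tr
  have : k * ((m : ℂ) - 2 * n - 2) = 0 := by linear_combination -tr
  simpa [sub_eq_zero, hU.dim_ne_two] using this

theorem oxoy (hU : Vanishing F o t r U) {x y : Idx m n} (hx : x ≠ dual o) (hy : y ≠ dual o) {T}
    (hT : T ∈ U) : F.cc o x o y T = 0 := by
  obtain ⟨ho, ht, hr, hoo, htt, hot, hodt, hro, hrdo, hrt, hrdt, -⟩ := hU.sep
  have pair : ∀ x y, ∀ T ∈ U, F.cc o x o y T = 0 → F.cc o y o x T = 0 := by
    intro x y T hT h
    rw [F.weyl_pair (hU.le hT) o x o y, h, mul_zero]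
  have generic : ∀ x y, x ≠ dual o → y ≠ dual o → x ≠ t → x ≠ dual t → y ≠ dual t →
      ∀ T ∈ U, F.cc o x o y T = 0 := by
    intro x y hx hy hxt hxd hyd T hT
    have h := hU.oxoy_aux hx hxd hy hyd hxt hT
    rw [hU.otodt hT] at h
    simpa [eta_ne_zero, sg_ne_zero] using h
  have hdt : ∀ y, y ≠ dual o → y ≠ dual t → ∀ T ∈ U, F.cc o y o (dual t) T = 0 := by
    intro y hy hyd T hT
    by_cases hyt : y = t
    · subst hyt; exact pair _ _ T hT (hU.otodt hT)
    have h := hU.act (fun T hT => pair _ _ T hT (hU.otodt hT)) t (dual y) hT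
    rw [Ne, eq_dual_comm] at hy hyd
    have hyt' : ¬ dual t = dual y := fun h => hyt (dual_inj.1 h).symm
    simpa [sg_of_even ho, sg_of_even ht, sg_of_even' ho, sg_of_even' ht, hot, hy, hyd, htt.symm,
      hyt', eta_ne_zero] using h
  by_cases hxd : x = dual t
  · by_cases hyd : y = dual t
    · subst hxd hyd
      -- Neither earlier move reaches x = y = t*; here K r t turns the r of T^{o r o t*} into t*.
      have h := hU.act (hdt r hrdo hrdt) r t hT
      simpa [sg_of_even ho, sg_of_even ht, sg_of_even' ho, sg_of_even' ht, hro.symm, hot, hrt,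
        hrdt.symm, htt.symm, eta_of_even ht] using h
    · subst hxd; exact pair _ _ T hT (hdt y hy hyd T hT)
  · by_cases hyd : y = dual t
    · subst hyd; exact hdt x hx hxd T hT
    · by_cases hxt : x = t
      · subst hxt; exact (hU.otox hy hyd hT).2
      · exact generic x y hx hy hxt hxd hyd T hT

/-- The relation obtained from `T^{oxoy} = 0` by replacing one index `o` by `z`. -/
theorem degree_one (hU : Vanishing F o t r U) {x y z : Idx m n} (hx : x ≠ dual o) (hy : y ≠ dual o)
    (hx' : x ≠ o) (hy' : y ≠ o) (hz : z ≠ dual o) {T} (hT : T ∈ U) :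
    eta (dual z) * (sg z y * sg x y * F.cc o y z x T + sg z x * F.cc o x z y T) =
      (if x = dual z then F.cc o (dual o) o y T else 0)
      + sg z x * (if y = dual z then F.cc o (dual o) o x T else 0) := by
  obtain ⟨ho, ht, hr, hoo, htt, hot, hodt, hro, hrdo, hrt, hrdt, -⟩ := hU.sep
  have h := hU.act (fun T hT => hU.oxoy hx hy hT) o (dual z) hT
  have p1 := F.weyl_pair (hU.le hT) o y z x
  have p2 := F.weyl_pair (hU.le hT) o (dual o) o x
  rw [Ne, eq_dual_comm] at hz
  simp only [sg_of_even ho, sg_of_even' ho, hx', hy', hz, if_true, if_false, dual_dual, one_mul,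
    mul_one, sg_dual_left, sub_zero, zero_sub, eta_of_even ho, p1, p2] at h
  rw [sg_comm y z, sg_comm y x] at h
  linear_combination h

/-- For an auxiliary even index e away from o, o*, y, y* (t works unless y is t or t*, and then r
does), three instances of `degree_one` involve T^{oye*e}, T^{oee*y} and their relatives.
Antisymmetry in the last two slots cancels these and leaves 2T^{oo*oy} = 0. -/
theorem cc_oo (hU : Vanishing F o t r U) (y : Idx m n) {T} (hT : T ∈ U) (hy : y ≠ o)
    (hy' : y ≠ dual o) : F.cc o (dual o) o y T = 0 := by
  obtain ⟨ho, ht, hr, hoo, htt, hot, hodt, hro, hrdo, hrt, hrdt, -⟩ := hU.sep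
  obtain ⟨e, he, heo, hedo, hey, hedy⟩ : ∃ e : Idx m n, par e = 0 ∧ e ≠ o ∧ e ≠ dual o ∧
      e ≠ y ∧ e ≠ dual y := by
    by_cases h1 : y = t ∨ y = dual t
    · refine ⟨r, hr, hro, hrdo, ?_, ?_⟩ <;> rcases h1 with rfl | rfl <;> simpa
    · push Not at h1
      refine ⟨t, ht, hot.symm, ?_, h1.1.symm, ?_⟩
      · rw [Ne, eq_dual_comm]; exact hodt
      · rw [Ne, eq_dual_comm]; exact h1.2
  have hd : dual e ≠ o := fun h => hedo (by rw [← h, dual_dual])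
  have hdd : dual e ≠ dual o := fun h => heo (dual_inj.1 h)
  have hye : y ≠ dual e := by rw [Ne, eq_dual_comm]; exact hedy
  have ha := hU.degree_one hedo hy' heo hy hdd hT
  have hb := hU.degree_one hdd hy' hd hy hedo hT
  have hc := hU.degree_one (x := dual e) (y := e) (z := y) hdd hedo hd heo hy' hT
  have hyd : ¬ dual e = dual y := fun h => hey (dual_inj.1 h)
  have s1 := F.cc_swap_right o y e (dual e) T
  have s2 := F.cc_swap_right o e (dual e) y T
  have s3 := F.cc_swap_right o (dual e) e y T
  have e1 : eta e = 1 := eta_of_even he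
  have e2 : eta (dual e) = 1 := eta_of_even (by simpa)
  simp only [sg_of_even he, sg_of_even' he, sg_dual_left, sg_dual_right, dual_dual, if_true,
    hey.symm, hye, hyd, hedy, e1, e2, if_false, one_mul, add_zero, neg_mul, mul_zero] at ha hb hc s1 s2 s3
  have hc' := (mul_eq_zero.1 hc).resolve_left (eta_ne_zero _)
  linear_combination (1 / 2 : ℂ) * (s1 + s2 + s3 - ha - hb - hc')

/-- Once the right side of `degree_one` is gone, T^{oxyz} is graded antisymmetric in its last three
indices; the Bianchi identity then says 3T^{oxyz} = 0. -/
theorem oxyz (hU : Vanishing F o t r U) {x y z : Idx m n} (hx : x ≠ dual o) (hy : y ≠ dual o)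
    (hz : z ≠ dual o) (hx' : x ≠ o) (hy' : y ≠ o) (hz' : z ≠ o) {T} (hT : T ∈ U) :
    F.cc o x y z T = 0 := by
  obtain ⟨ho, ht, hr, hoo, htt, hot, hodt, hro, hrdo, hrt, hrdt, -⟩ := hU.sep
  have rel : ∀ x y z, x ≠ dual o → y ≠ dual o → z ≠ dual o → x ≠ o → y ≠ o →
      sg z y * sg x y * F.cc o y z x T + sg z x * F.cc o x z y T = 0 := by
    intro x y z hx hy hz hx' hy'
    have h := hU.degree_one hx hy hx' hy' hz hT
    rw [hU.cc_oo x hT hx' hx, hU.cc_oo y hT hy' hy] at h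
    simpa [eta_ne_zero] using h
  have r1 := rel x z y hx hz hy hx' hz'
  have r2 := rel x y z hx hy hz hx' hy'
  have r3 := rel y z x hy hz hx hy' hz'
  have b := Frame.weyl_bianchi (hU.le hT) o x y z
  rw [F.weyl_pair (hU.le hT) o z x y, F.cc_swap_left o y x z] at b
  have s1 := F.cc_swap_right o z x y T
  have s2 := F.cc_swap_right o y x z T
  have s3 := F.cc_swap_right o x y z T
  rcases par_cases x with ha | ha <;> rcases par_cases y with hb | hb <;>
    rcases par_cases z with hc | hc <;>
    simp [sg, ho, ha, hb, hc] at r1 r2 r3 s1 s2 s3 b ⊢ <;> grind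

/-- The relation obtained from `T^{ood z} = 0`, where `o d` stands for the dual of `o`, by
replacing the second `o` by `w`. -/
theorem degree_zero (hU : Vanishing F o t r U) {w z : Idx m n} (hw : w ≠ dual o) (hz : z ≠ dual o)
    (hw' : w ≠ o) (hz' : z ≠ o) {T} (hT : T ∈ U) :
    F.cc o w (dual o) z T - 2 * (sg w z * F.cc o z (dual o) w T) =
      if z = dual w then eta (dual w) * F.cc o (dual o) o (dual o) T else 0 := by
  obtain ⟨ho, ht, hr, hoo, htt, hot, hodt, hro, hrdo, hrt, hrdt, -⟩ := hU.sep
  have h := hU.act (fun T hT => hU.cc_oo z hT hz' hz) o (dual w) hT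
  have b := Frame.weyl_bianchi (hU.le hT) o (dual o) w z
  have s1 := F.cc_swap_left (dual o) w o z T
  have s2 := F.cc_swap_left o w (dual o) z T
  have s3 := F.weyl_pair (hU.le hT) o z (dual o) w
  rw [Ne, eq_dual_comm] at hw
  have hw'' : ¬ dual o = dual w := fun h => hw' (dual_inj.1 h).symm
  simp only [sg_of_even ho, sg_of_even' ho, sg_dual_left, sg_dual_right, hw, hw'', hz', hoo.symm,
    if_true, if_false, dual_dual, one_mul, mul_one, sub_zero, zero_sub, eta_of_even ho,
    mul_zero, add_zero, neg_mul] at h b s1 s2 s3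
  have e := eta_mul_self (dual w)
  rw [sg_comm z w] at s3
  split_ifs at h ⊢ with hzw
  · linear_combination (eta (dual w)) * h - (F.cc w (dual o) o z T + F.cc o (dual o) w z T) * e
      - s1 - b + s2 + 2 * s3
  · linear_combination (eta (dual w)) * h - (F.cc w (dual o) o z T + F.cc o (dual o) w z T) * e
      - s1 - b + s2 + 2 * s3

/-- The relation `degree_zero` and its mirror under x ↔ y form a linear system of determinant 1 - 4
= -3, whence the thirds. -/
theorem oxdy_eq (hU : Vanishing F o t r U) {x y : Idx m n} (hx : x ≠ dual o) (hy : y ≠ dual o)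
    (hx' : x ≠ o) (hy' : y ≠ o) {T} (hT : T ∈ U) : F.cc o x (dual o) y T =
      if y = dual x then -(eta y * F.cc o (dual o) o (dual o) T) else 0 := by
  have h1 := hU.degree_zero hx hy hx' hy' hT
  have h2 := hU.degree_zero hy hx hy' hx' hT
  rw [sg_comm y x] at h2
  by_cases h : y = dual x
  · subst h
    simp only [dual_dual, if_true, sg_dual_right, eta_dual] at h1 h2 ⊢
    linear_combination (-1 / 3 : ℂ) * h1 - (2 / 3 : ℂ) * sg x x * h2
      - (4 / 3 : ℂ) * F.cc o x (dual o) (dual x) T * sg_mul_self x x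
  · have h' : ¬ x = dual y := fun h' => h (eq_dual_comm.1 h')
    rw [if_neg h] at h1 ⊢
    rw [if_neg h'] at h2
    linear_combination (-1 / 3 : ℂ) * h1 - (2 / 3 : ℂ) * sg x y * h2
      - (4 / 3 : ℂ) * F.cc o x (dual o) y T * sg_mul_self x y

/-- By `oxdy_eq` all terms of the trace of T^{o b b* o*} are multiples of k = T^{oo*oo*}; only b = o
drops out, so tracelessness reads k(M - 1) = 0. -/
theorem ododo (hU : Vanishing F o t r U) {T} (hT : T ∈ U) :
    F.cc o (dual o) o (dual o) T = 0 := by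
  obtain ⟨ho, ht, hr, hoo, htt, hot, hodt, -, -, -, -, -⟩ := hU.sep
  set k := F.cc o (dual o) o (dual o) T with hk
  have h0 : F.cc o o (dual o) (dual o) T = 0 := by
    have := F.cc_swap_left o o (dual o) (dual o) T
    rw [sg_of_even ho] at this
    linear_combination (1 / 2 : ℂ) * this
  have e : ∀ b, eta b * F.cc o b (dual b) (dual o) T =
      k * (sg b b - (if b = o then 1 else 0)) := by
    intro b
    by_cases h1 : b = o
    · subst h1; simp [h0, sg_of_even ho]
    by_cases h2 : b = dual o
    · subst h2; simp [← hk, h1, sg_of_even ho, eta_of_even (show par (dual o) = 0 by simpa)]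
    · have h1' : dual b ≠ dual o := fun h => h1 (dual_inj.1 h)
      have h2' : dual b ≠ o := fun h => h2 (by rw [← h, dual_dual])
      have := hU.oxdy_eq h2 h1' h1 h2' hT
      rw [if_pos rfl, eta_dual] at this
      rw [F.cc_swap_right o b (dual o) (dual b), if_neg h1, this, sg_dual_left, sg_of_even ho]
      linear_combination (sg b b * k) * eta_mul_self b
  have tr := Frame.weyl_trace (hU.le hT) o (dual o)
  simp only [e, ← Finset.mul_sum, Finset.sum_sub_distrib, Finset.sum_ite_eq', Finset.mem_univ,
    if_true, sum_sg_self] at tr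
  simpa [sub_eq_zero, hU.dim_ne_one] using tr

theorem oxdy (hU : Vanishing F o t r U) {x y : Idx m n} (hx : x ≠ dual o) (hy : y ≠ dual o)
    (hx' : x ≠ o) (hy' : y ≠ o) {T} (hT : T ∈ U) : F.cc o x (dual o) y T = 0 := by
  rw [hU.oxdy_eq hx hy hx' hy' hT, hU.ododo hT]; simp

theorem odxy (hU : Vanishing F o t r U) {x y : Idx m n} (hx : x ≠ dual o) (hy : y ≠ dual o)
    (hx' : x ≠ o) (hy' : y ≠ o) {T} (hT : T ∈ U) : F.cc o (dual o) x y T = 0 := by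
  have b := Frame.weyl_bianchi (hU.le hT) o (dual o) x y
  rw [F.cc_swap_left o x (dual o) y, F.weyl_pair (hU.le hT) o y (dual o) x, hU.oxdy hx hy hx' hy' hT,
    hU.oxdy hy hx hy' hx' hT] at b
  simpa using b

/-- Replacing o by w in T^{oxyz} = 0; the other terms contain both o and o* and vanish by `odxy` and
`oxdy`. -/
theorem wxyz (hU : Vanishing F o t r U) {w x y z : Idx m n} (hw : w ≠ dual o) (hx : x ≠ dual o)
    (hy : y ≠ dual o) (hz : z ≠ dual o) (hx' : x ≠ o) (hy' : y ≠ o) (hz' : z ≠ o)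
    {T} (hT : T ∈ U) : F.cc w x y z T = 0 := by
  have ho := hU.sep.par_o
  have h := hU.act (fun T hT => hU.oxyz hx hy hz hx' hy' hz' hT) o (dual w) hT
  have h1 := F.cc_swap_right o x (dual o) y T
  rw [hU.oxdy hx hy hx' hy' hT] at h1
  rw [Ne, eq_dual_comm] at hw
  simpa [hx', hy', hz', hw, hU.odxy hy hz hy' hz' hT, hU.oxdy hx hz hx' hz' hT, h1,
    eta_ne_zero] using h

/-- Among the four distinct indices u, r, t, t*, with u odd, at least one differs from the three
given ones. This is where an odd index is needed. -/
theorem _root_.OSp.Sep.exists_ne (h : Sep o t r) (x y z : Idx m n) :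
    ∃ w, w ≠ o ∧ w ≠ dual o ∧ x ≠ w ∧ y ≠ w ∧ z ≠ w := by
  obtain ⟨ho, ht, hr, hoo, htt, hot, hodt, hro, hrdo, hrt, hrdt, u, hu⟩ := h
  have hne : ∀ {a : Idx m n}, par a = 0 → u ≠ a := by
    rintro a ha rfl; omega
  have hc : ({x, y, z} : Finset (Idx m n)).card < ({u, r, t, dual t} : Finset (Idx m n)).card := by
    have h1 : ({u, r, t, dual t} : Finset (Idx m n)).card = 4 := by
      rw [Finset.card_insert_of_notMem, Finset.card_insert_of_notMem, Finset.card_pair htt]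
      · simp [hrt, hrdt]
      · simp [hne hr, hne ht, hne (show par (dual t) = 0 by simpa)]
    rw [h1]
    exact lt_of_le_of_lt Finset.card_le_three (by norm_num)
  obtain ⟨w, hw, hw'⟩ := Finset.exists_mem_notMem_of_card_lt_card hc
  simp only [Finset.mem_insert, Finset.mem_singleton, not_or] at hw hw'
  refine ⟨w, ?_, ?_, Ne.symm hw'.1, Ne.symm hw'.2.1, Ne.symm hw'.2.2⟩
  · rcases hw with rfl | rfl | rfl | rfl
    · exact hne ho
    · exact hro
    · exact hot.symm
    · exact hodt.symm
  · rcases hw with rfl | rfl | rfl | rfl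
    · exact hne (by simpa)
    · exact hrdo
    · rw [Ne, eq_dual_comm]; exact hodt
    · exact fun h => hot (dual_inj.1 h).symm

/-- K w o turns w into o*; with w distinct from x, y, z, its action on T^{wxyz} has no other term.
-/
theorem dxyz (hU : Vanishing F o t r U) {x y z : Idx m n} (hx : x ≠ dual o)
    (hy : y ≠ dual o) (hz : z ≠ dual o) (hx' : x ≠ o) (hy' : y ≠ o) (hz' : z ≠ o)
    {T} (hT : T ∈ U) : F.cc (dual o) x y z T = 0 := by
  obtain ⟨w, hw', hw, hwx, hwy, hwz⟩ := hU.sep.exists_ne x y z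
  have h := hU.act (fun T hT => hU.wxyz hw hx hy hz hx' hy' hz' hT) w o hT
  simpa [hx', hy', hz', hw', hwx, hwy, hwz, eta_ne_zero] using h

/-- Acting with K o x on T^{o x o* y} turns x into o*, the wanted component, and o into x*, where
`dxyz` applies after exchanging the pairs. -/
theorem oddy (hU : Vanishing F o t r U) {y : Idx m n} (hy : y ≠ dual o) (hy' : y ≠ o)
    {T} (hT : T ∈ U) : F.cc o (dual o) (dual o) y T = 0 := by
  obtain ⟨ho, ht, hr, hoo, htt, hot, hodt, hro, hrdo, hrt, hrdt, -⟩ := hU.sep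
  obtain ⟨x, hxo, hxdo, hyx, -, -⟩ := hU.sep.exists_ne y y y
  have h := hU.act (fun T hT => hU.oxdy hxdo hy hxo hy' hT) o x hT
  have hd : dual x ≠ o := fun h => hxdo (by rw [← h, dual_dual])
  have hdd : dual x ≠ dual o := fun h => hxo (dual_inj.1 h)
  rw [F.weyl_pair (hU.le hT) (dual o) y (dual x) x, hU.dxyz hy hdd hxdo hy' hd hxo hT] at h
  simpa [hxo, hxo.symm, hxdo.symm, hyx, hy', hoo.symm, eta_ne_zero, sg_ne_zero] using h

theorem dxdy (hU : Vanishing F o t r U) {x y : Idx m n} (hx : x ≠ dual o) (hy : y ≠ dual o)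
    (hx' : x ≠ o) (hy' : y ≠ o) {T} (hT : T ∈ U) : F.cc (dual o) x (dual o) y T = 0 := by
  obtain ⟨w, hw', hw, hwx, hwy, -⟩ := hU.sep.exists_ne x y y
  have h0 : ∀ T ∈ U, F.cc w x (dual o) y T = 0 := by
    intro T hT
    rw [F.weyl_pair (hU.le hT) (dual o) y w x, hU.dxyz hy hw hx hy' hw' hx' hT, mul_zero]
  have h := hU.act h0 w o hT
  simpa [hx', hy', hw', hw.symm, hwx, hwy, hU.sep.o_o.symm, eta_ne_zero] using h

/-- Sorting indices into o, o* and the rest, every component agrees up to sign with one treated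
above, or has a repeated o or o* in a pair and vanishes by antisymmetry. -/
theorem eq_bot (hU : Vanishing F o t r U) : U = ⊥ := by
  have ho := hU.sep.par_o
  rw [eq_bot_iff]
  intro T hT
  have sl : ∀ {a b c d}, F.cc a b c d T = 0 → F.cc b a c d T = 0 := by
    intro a b c d h; rw [F.cc_swap_left, h, mul_zero]
  have sr : ∀ {a b c d}, F.cc a b c d T = 0 → F.cc a b d c T = 0 := by
    intro a b c d h; rw [F.cc_swap_right, h, mul_zero]
  have sp : ∀ {a b c d}, F.cc a b c d T = 0 → F.cc c d a b T = 0 := by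
    intro a b c d h; rw [F.weyl_pair (hU.le hT), h, mul_zero]
  have z1 : ∀ c d, F.cc o o c d T = 0 := by
    intro c d
    have := F.cc_swap_left o o c d T
    rw [sg_of_even ho] at this
    linear_combination (1 / 2 : ℂ) * this
  have z2 : ∀ c d, F.cc (dual o) (dual o) c d T = 0 := by
    intro c d
    have := F.cc_swap_left (dual o) (dual o) c d T
    rw [sg_dual_left, sg_of_even ho] at this
    linear_combination (1 / 2 : ℂ) * this
  have cases3 : ∀ x, x = o ∨ x = dual o ∨ (x ≠ dual o ∧ x ≠ o) := by
    intro x; tauto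
  have qo : ∀ x, x ≠ dual o → x ≠ o → ∀ c d, F.cc o x c d T = 0 := by
    intro x hx hx' c d
    rcases cases3 c with rfl | rfl | ⟨hc, hc'⟩ <;> rcases cases3 d with rfl | rfl | ⟨hd, hd'⟩
    · exact sp (z1 _ _)
    · exact sp (hU.cc_oo x hT hx' hx)
    · exact hU.oxoy hx hd hT
    · exact sp (sl (hU.cc_oo x hT hx' hx))
    · exact sp (z2 _ _)
    · exact hU.oxdy hx hd hx' hd' hT
    · exact sr (hU.oxoy hx hc hT)
    · exact sr (hU.oxdy hx hc hx' hc' hT)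
    · exact hU.oxyz hx hc hd hx' hc' hd' hT
  have qd : ∀ x, x ≠ dual o → x ≠ o → ∀ c d, F.cc (dual o) x c d T = 0 := by
    intro x hx hx' c d
    rcases cases3 c with rfl | rfl | ⟨hc, hc'⟩ <;> rcases cases3 d with rfl | rfl | ⟨hd, hd'⟩
    · exact sp (z1 _ _)
    · exact sp (hU.oddy hx hx' hT)
    · exact sp (qo _ hd hd' _ _)
    · exact sp (sl (hU.oddy hx hx' hT))
    · exact sp (z2 _ _)
    · exact hU.dxdy hx hd hx' hd' hT
    · exact sp (sl (qo _ hc hc' _ _))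
    · exact sr (hU.dxdy hx hc hx' hc' hT)
    · exact hU.dxyz hx hc hd hx' hc' hd' hT
  have qod : ∀ c d, F.cc o (dual o) c d T = 0 := by
    intro c d
    rcases cases3 c with rfl | rfl | ⟨hc, hc'⟩ <;> rcases cases3 d with rfl | rfl | ⟨hd, hd'⟩
    · exact sp (z1 _ _)
    · exact hU.ododo hT
    · exact sp (qo _ hd hd' _ _)
    · exact sr (hU.ododo hT)
    · exact sp (z2 _ _)
    · exact sp (qd _ hd hd' _ _)
    · exact sp (sl (qo _ hc hc' _ _))
    · exact sp (sl (qd _ hc hc' _ _))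
    · exact hU.odxy hc hd hc' hd' hT
  have qx : ∀ x y, x ≠ dual o → x ≠ o → y ≠ dual o → y ≠ o → ∀ c d, F.cc x y c d T = 0 := by
    intro x y hx hx' hy hy' c d
    rcases cases3 c with rfl | rfl | ⟨hc, hc'⟩ <;> rcases cases3 d with rfl | rfl | ⟨hd, hd'⟩
    · exact sp (z1 _ _)
    · exact sp (qod _ _)
    · exact sp (qo _ hd hd' _ _)
    · exact sp (sl (qod _ _))
    · exact sp (z2 _ _)
    · exact sp (qd _ hd hd' _ _)
    · exact sp (sl (qo _ hc hc' _ _))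
    · exact sp (sl (qd _ hc hc' _ _))
    · exact hU.wxyz hx hy hc hd hy' hc' hd' hT
  refine F.eq_zero_of_cc fun a b c d => ?_
  rcases cases3 a with rfl | rfl | ⟨ha, ha'⟩ <;> rcases cases3 b with rfl | rfl | ⟨hb, hb'⟩
  · exact z1 _ _
  · exact qod _ _
  · exact qo _ hb hb' _ _
  · exact sl (qod _ _)
  · exact z2 _ _
  · exact qd _ hb hb' _ _
  · exact sl (qo _ ha ha' _ _)
  · exact sl (qd _ ha ha' _ _)
  · exact qx _ _ ha ha' hb hb' _ _

end Vanishing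

end

/-! ### The invariant form on g ⊗ g, extremal elements and minimality of the Weyl tensors. -/

section

variable {m n : ℕ} {G : Metric m n} {W : WittBasis G}

theorem IsSubrep.inf {N N' : Submodule ℂ (osp G ⊗[ℂ] osp G)} (h : IsSubrep G N)
    (h' : IsSubrep G N') : IsSubrep G (N ⊓ N') :=
  fun X t ht => ⟨h X t ht.1, h' X t ht.2⟩

namespace Frame

variable (F : Frame W)

/-- The sign automorphism `U ↦ (-1)^{|K p q||U|} U`. -/
def twist (G : Metric m n) (p q : Idx m n) : osp G →ₗ[ℂ] osp G :=
  if par p = par q then LinearMap.id else theta G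

theorem co_twist (p q a b : Idx m n) (X : osp G) :
    F.co a b (twist G p q X) = sg p a * sg q a * (sg p b * sg q b) * F.co a b X := by
  rw [twist]
  split_ifs with hpq
  · have e2 : sg p a * sg q a * (sg p b * sg q b) = 1 := by
      rcases par_cases q with hq | hq <;> rcases par_cases a with ha | ha <;>
        rcases par_cases b with hb | hb <;> simp [sg, hpq, hq, ha, hb]
    rw [e2, one_mul]; rfl
  · have e2 : sg p a * sg q a * (sg p b * sg q b) = sg a a * sg b b := by
      rcases par_cases p with hp | hp <;> rcases par_cases q with hq | hq <;>
        rcases par_cases a with ha | ha <;> rcases par_cases b with hb | hb <;>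
        simp [sg, hp, hq, ha, hb] at hpq ⊢
    rw [e2, co_theta]

theorem twist_K (p q a b : Idx m n) :
    twist G p q (F.K a b) = (sg p a * sg q a * (sg p b * sg q b)) • F.K a b := by
  apply F.ext_co
  intro c d
  rw [co_twist, map_smul, co_K, smul_eq_mul]
  by_cases h1 : c = a ∧ d = b
  · obtain ⟨rfl, rfl⟩ := h1; rfl
  · by_cases h2 : c = b ∧ d = a
    · obtain ⟨rfl, rfl⟩ := h2; ring
    · simp [h1, h2]

theorem tensorAct_K_tmul (p q : Idx m n) (X Y : osp G) : tensorAct G (F.K p q) (X ⊗ₜ Y) =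
    bracket G (F.K p q) X ⊗ₜ Y + twist G p q X ⊗ₜ bracket G (F.K p q) Y := by
  rw [tensorAct_tmul, ospEven_K, ospOdd_K, twist]
  split_ifs <;> simp [theta]

theorem formL_bracket (F : Frame W) (p q : Idx m n) (X Y : osp G) :
    formL G (bracket G (F.K p q) Y) X = -formL G (twist G p q Y) (bracket G (F.K p q) X) := by
  have hY : Y ∈ Submodule.span ℂ (Set.range fun x : Idx m n × Idx m n => F.K x.1 x.2) := by
    rw [F.span_K]; trivial
  induction hY using Submodule.span_induction with
  | mem x hx =>
    obtain ⟨⟨c, d⟩, rfl⟩ := hx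
    rw [form_bracket_K, twist_K, map_smul, LinearMap.smul_apply, smul_eq_mul]; ring
  | zero => simp
  | add x y _ _ hx hy => simp only [map_add, LinearMap.add_apply, hx, hy]; ring
  | smul r x _ hx => simp only [map_smul, LinearMap.smul_apply, hx, smul_eq_mul]; ring

theorem formL_twist (F : Frame W) (p q : Idx m n) (X Y : osp G) :
    formL G (twist G p q X) (twist G p q Y) = formL G X Y := by
  rw [formL_apply, formL_apply, F.form_eq_sum, F.form_eq_sum]
  refine Finset.sum_congr rfl fun a _ => Finset.sum_congr rfl fun b _ => ?_
  rw [co_twist, co_twist, sg_dual_right, sg_dual_right, sg_dual_right, sg_dual_right]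
  have h : (sg p a * sg q a * (sg p b * sg q b)) * (sg p a * sg q a * (sg p b * sg q b)) = 1 := by
    rw [mul_mul_mul_comm, mul_mul_mul_comm (sg p a), mul_mul_mul_comm (sg p b)]; simp
  linear_combination (eta a * eta b * F.co a b X * F.co (dual b) (dual a) Y) * h

end Frame

/-- The invariant bilinear form on `g ⊗ g` that pairs the inner and the outer factors. -/
def tensorForm (G : Metric m n) : osp G ⊗[ℂ] osp G →ₗ[ℂ] osp G ⊗[ℂ] osp G →ₗ[ℂ] ℂ :=
  TensorProduct.lift (LinearMap.mk₂ ℂ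
    (fun X Y => LinearMap.mul' ℂ ℂ ∘ₗ TensorProduct.map (formL G Y) (formL G X))
    (by intro X X' Y; rw [map_add, TensorProduct.map_add_right, LinearMap.comp_add])
    (by intro r X Y; rw [map_smul, TensorProduct.map_smul_right, LinearMap.comp_smul])
    (by intro X Y Y'; rw [map_add, TensorProduct.map_add_left, LinearMap.comp_add])
    (by intro r X Y; rw [map_smul, TensorProduct.map_smul_left, LinearMap.comp_smul]))

theorem tensorForm_tmul (X Y X' Y' : osp G) :
    tensorForm G (X ⊗ₜ Y) (X' ⊗ₜ Y') = formL G Y X' * formL G X Y' := rfl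

/-- The annihilator of `N` with respect to the invariant form on `g ⊗ g`. -/
def perp (N : Submodule ℂ (osp G ⊗[ℂ] osp G)) : Submodule ℂ (osp G ⊗[ℂ] osp G) :=
  LinearMap.ker ((tensorForm G).compl₂ N.subtype)

theorem mem_perp {N : Submodule ℂ (osp G ⊗[ℂ] osp G)} {t : osp G ⊗[ℂ] osp G} :
    t ∈ perp N ↔ ∀ T ∈ N, tensorForm G t T = 0 := by
  rw [perp, LinearMap.mem_ker, LinearMap.ext_iff]
  exact ⟨fun h T hT => h ⟨T, hT⟩, fun h T => h T.1 T.2⟩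

/-- The annihilator is the kernel of a map V → N*, so it has codimension at most dim N. Disjointness
is then enough; neither symmetry nor nondegeneracy of B is used. -/
theorem _root_.LinearMap.isCompl_ker_compl₂ {V : Type*} [AddCommGroup V] [Module ℂ V]
    [FiniteDimensional ℂ V] (B : V →ₗ[ℂ] V →ₗ[ℂ] ℂ) (N : Submodule ℂ V)
    (h : Disjoint N (LinearMap.ker (B.compl₂ N.subtype))) :
    IsCompl N (LinearMap.ker (B.compl₂ N.subtype)) := by
  let f : V →ₗ[ℂ] Module.Dual ℂ N := B.compl₂ N.subtype
  have h1 := f.finrank_range_add_finrank_ker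
  have h2 : Module.finrank ℂ (LinearMap.range f) ≤ Module.finrank ℂ N := by
    rw [← Subspace.dual_finrank_eq (K := ℂ) (V := N)]
    exact Submodule.finrank_le _
  refine ⟨h, codisjoint_iff.2 (Submodule.eq_top_of_disjoint _ _ ?_ h)⟩
  change _ ≤ _ + Module.finrank ℂ (LinearMap.ker f)
  omega

theorem isCompl_perp {N : Submodule ℂ (osp G ⊗[ℂ] osp G)} (h : Disjoint N (perp N)) :
    IsCompl N (perp N) :=
  LinearMap.isCompl_ker_compl₂ (V := osp G ⊗[ℂ] osp G) (tensorForm G) N h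

namespace Frame

variable (F : Frame W)

theorem tensorForm_K (a b c d : Idx m n) (T : osp G ⊗[ℂ] osp G) :
    tensorForm G (F.K a b ⊗ₜ F.K c d) T =
      4 * eta a * eta b * eta c * eta d * F.cc (dual d) (dual c) (dual b) (dual a) T := by
  induction T using TensorProduct.induction_on with
  | zero => simp
  | tmul X Y =>
    rw [tensorForm_tmul, formL_apply, formL_apply, form_K, form_K, cc_tmul]; ring
  | add T T' h h' => rw [map_add, map_add, h, h']; ring

/-- Invariance of the form on `g ⊗ g`. -/
theorem tensorForm_act (p q : Idx m n) (t T : osp G ⊗[ℂ] osp G) :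
    tensorForm G (tensorAct G (F.K p q) t) T =
      -tensorForm G (TensorProduct.map (twist G p q) (twist G p q) t)
        (tensorAct G (F.K p q) T) := by
  induction t using TensorProduct.induction_on with
  | zero => simp
  | tmul X Y =>
    induction T using TensorProduct.induction_on with
    | zero => simp
    | tmul X' Y' =>
      simp only [tensorAct_K_tmul, TensorProduct.map_tmul, map_add, LinearMap.add_apply,
        tensorForm_tmul, formL_bracket, F.formL_twist]
      ring
    | add T T' h h' => rw [map_add, map_add, map_add, h, h']; ring
  | add t t' h h' => simp only [map_add, LinearMap.add_apply, h, h']; ring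

theorem tensorForm_twist (F : Frame W) (p q : Idx m n) (t T : osp G ⊗[ℂ] osp G) :
    tensorForm G (TensorProduct.map (twist G p q) (twist G p q) t)
      (TensorProduct.map (twist G p q) (twist G p q) T) = tensorForm G t T := by
  induction t using TensorProduct.induction_on with
  | zero => simp
  | tmul X Y =>
    induction T using TensorProduct.induction_on with
    | zero => simp
    | tmul X' Y' =>
      simp only [TensorProduct.map_tmul, tensorForm_tmul, F.formL_twist]
    | add T T' h h' => rw [map_add, map_add, map_add, h, h']
  | add t t' h h' => simp only [map_add, LinearMap.add_apply, h, h']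

theorem map_twist_twist (F : Frame W) (p q : Idx m n) (t : osp G ⊗[ℂ] osp G) :
    TensorProduct.map (twist G p q) (twist G p q)
      (TensorProduct.map (twist G p q) (twist G p q) t) = t := by
  have h : ∀ X : osp G, twist G p q (twist G p q X) = X := by
    intro X
    apply F.ext_co
    intro a b
    rw [co_twist, co_twist]
    have h : (sg p a * sg q a * (sg p b * sg q b)) * (sg p a * sg q a * (sg p b * sg q b)) = 1 := by
      rw [mul_mul_mul_comm, mul_mul_mul_comm (sg p a), mul_mul_mul_comm (sg p b)]; simp
    rw [← mul_assoc, h, one_mul]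
  induction t using TensorProduct.induction_on with
  | zero => simp
  | tmul X Y => simp only [TensorProduct.map_tmul, h]
  | add t t' h h' => rw [map_add, map_add, h, h']

/-- For odd K p q, invariance of the form involves the parity automorphism, so the annihilator is a
submodule only for parity-stable N. -/
theorem perp_isSubrep (F : Frame W) {N : Submodule ℂ (osp G ⊗[ℂ] osp G)} (hN : IsSubrep G N)
    (hθ : ∀ t ∈ N, tensorTheta G t ∈ N) : IsSubrep G (perp N) := by
  refine F.isSubrep_of_K fun p q t ht => mem_perp.2 fun T hT => ?_
  rw [F.tensorForm_act, ← F.tensorForm_twist p q, F.map_twist_twist, neg_eq_zero]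
  refine mem_perp.1 ht _ ?_
  have h := hN (F.K p q) T hT
  rw [twist]
  split_ifs
  · simpa using h
  · exact hθ _ h

end Frame

theorem theta_val (X : osp G) :
    (theta G X).1 = parityMatrix m n * X.1 * parityMatrix m n := by
  have h1 : (theta G X).1 = evenPart X.1 - oddPart X.1 := rfl
  rw [h1, oddPart_eq, evenPart_eq_conj]
  module

theorem evenPart_parityMatrix : evenPart (parityMatrix m n) = parityMatrix m n :=
  evenPart_eq_self_of_comm rfl

/-- The parity automorphism preserves the bracket. -/
theorem theta_bracket (X Y : osp G) :
    theta G (bracket G X Y) = bracket G (theta G X) (theta G Y) := by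
  ext1
  rw [theta_val]
  change _ = superBracket (theta G X).1 (theta G Y).1
  rw [theta_val, theta_val, superBracket_conj evenPart_parityMatrix evenPart_parityMatrix
    parityMatrix_mul_self]
  rfl

theorem theta_theta (X : osp G) : theta G (theta G X) = X := by
  ext1
  rw [theta_val, theta_val]
  calc _ = (parityMatrix m n * parityMatrix m n) * X.1 *
        (parityMatrix m n * parityMatrix m n) := by simp only [mul_assoc]
    _ = _ := by rw [parityMatrix_mul_self, one_mul, mul_one]

theorem tensorTheta_tensorTheta (t : osp G ⊗[ℂ] osp G) : tensorTheta G (tensorTheta G t) = t := by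
  induction t using TensorProduct.induction_on with
  | zero => simp
  | tmul X Y => simp only [tensorTheta, TensorProduct.map_tmul, theta_theta]
  | add t t' h h' => rw [map_add, map_add, h, h']

theorem ospEven_theta (X : osp G) : ospEven G (theta G X) = theta G (ospEven G X) := by
  ext1
  change evenPart (evenPart X.1 - oddPart X.1) = evenPart (evenPart X.1) - oddPart (evenPart X.1)
  rw [map_sub, evenPart_oddPart, oddPart_evenPart]

theorem ospOdd_theta (X : osp G) : ospOdd G (theta G X) = theta G (ospOdd G X) := by
  ext1
  change oddPart (evenPart X.1 - oddPart X.1) = evenPart (oddPart X.1) - oddPart (oddPart X.1)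
  rw [map_sub, evenPart_oddPart, oddPart_evenPart]

/-- The parity automorphism intertwines the actions of `X` and of `theta X`. -/
theorem tensorTheta_act (X : osp G) (t : osp G ⊗[ℂ] osp G) :
    tensorTheta G (tensorAct G X t) = tensorAct G (theta G X) (tensorTheta G t) := by
  induction t using TensorProduct.induction_on with
  | zero => simp
  | tmul U V =>
    have h : ∀ X U V : osp G, tensorAct G X (U ⊗ₜ V) = bracket G X U ⊗ₜ V
        + U ⊗ₜ bracket G (ospEven G X) V + theta G U ⊗ₜ bracket G (ospOdd G X) V := fun _ _ _ => rfl
    simp only [tensorTheta, TensorProduct.map_tmul, h, map_add, theta_bracket,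
      ospEven_theta, ospOdd_theta]
  | add t t' h h' => simp only [map_add, h, h']

/-- As the parity automorphism is an involution, N ∩ θ⁻¹N is the largest parity-stable subspace of
N; this makes it a submodule. -/
theorem IsSubrep.comap_theta {N : Submodule ℂ (osp G ⊗[ℂ] osp G)} (h : IsSubrep G N) :
    IsSubrep G (N.comap (tensorTheta G)) := by
  intro X t ht
  rw [Submodule.mem_comap, tensorTheta_act]
  exact h _ _ ht

namespace Frame

variable (F : Frame W)

section Extremal

variable {o t r : Idx m n}

/-- Since b_o, b_t span an isotropic plane, `K o t` is extremal: ad² has its image on the line of `K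
o t` and reads off the coordinate along the opposite element. -/
theorem bracket_K_K (h : Sep o t r) (X : osp G) :
    bracket G (F.K o t) (bracket G (F.K o t) X) =
      (2 * F.co (dual o) (dual t) X) • F.K o t := by
  obtain ⟨ho, ht, hr, hoo, htt, hot, hodt, hro, hrdo, hrt, hrdt, -⟩ := h
  have h1 : t ≠ dual o := fun h => hodt (eq_dual_comm.1 h)
  apply F.ext_co
  intro a b
  simp only [map_smul, co_bracket, co_K, sg_of_even ho, sg_of_even ht, eta_of_even ho,
    eta_of_even ht, one_mul, smul_eq_mul, hoo.symm, htt.symm, hodt.symm, h1.symm, if_false]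
  have s1 := F.co_swap (dual o) (dual t) X
  have s2 := F.co_swap (dual o) (dual o) X
  have s3 := F.co_swap (dual t) (dual t) X
  simp only [sg_dual_left, sg_of_even ho, sg_of_even ht] at s1 s2 s3
  by_cases a1 : a = o
  · subst a1
    by_cases b1 : b = a
    · subst b1; simp [hot]; linear_combination (1 / 2 : ℂ) * s3
    · by_cases b2 : b = t
      · subst b2; simp [hot, hot.symm]; linear_combination -2 * s1
      · simp [b1, b2]
  · by_cases a2 : a = t
    · subst a2
      by_cases b1 : b = o
      · subst b1; simp [hot, hot.symm]; ring
      · by_cases b2 : b = a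
        · subst b2; simp [hot.symm]; linear_combination (1 / 2 : ℂ) * s2
        · simp [b1, b2, hot.symm]
    · simp [a1, a2]

theorem bracket_K_self (h : Sep o t r) : bracket G (F.K o t) (F.K o t) = 0 := by
  obtain ⟨ho, ht, hr, hoo, htt, hot, hodt, hro, hrdo, hrt, hrdt, -⟩ := h
  have h1 : t ≠ dual o := fun h => hodt (eq_dual_comm.1 h)
  rw [bracket_K]
  simp [hoo, htt, hodt, h1]

/-- E = `K o t` is even, acts as a derivation, and ad(E)³ = 0. Only the middle binomial term 6 ad² ⊗
ad² survives, and each ad² brings a factor 2. -/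
theorem tensorAct_pow_four (h : Sep o t r) (T : osp G ⊗[ℂ] osp G) :
    tensorAct G (F.K o t) (tensorAct G (F.K o t) (tensorAct G (F.K o t) (tensorAct G (F.K o t) T)))
      = (24 * F.cc (dual o) (dual t) (dual o) (dual t) T) • F.K o t ⊗ₜ F.K o t := by
  have hp : par o = par t := h.par_o.trans h.par_t.symm
  have hact : ∀ X Y : osp G, tensorAct G (F.K o t) (X ⊗ₜ Y) =
      bracket G (F.K o t) X ⊗ₜ Y + X ⊗ₜ bracket G (F.K o t) Y := by
    intro X Y
    rw [tensorAct_K_tmul, twist, if_pos hp]; rfl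
  have h0 := F.bracket_K_self h
  induction T using TensorProduct.induction_on with
  | zero => simp
  | tmul X Y =>
    simp only [hact, map_add, F.bracket_K_K h, map_smul, h0, ← TensorProduct.smul_tmul',
      TensorProduct.tmul_smul, TensorProduct.zero_tmul, TensorProduct.tmul_zero, cc_tmul, map_zero]
    module
  | add T T' h h' => simp only [map_add, h, h', mul_add, add_smul]

/-- The cyclic sum wedges b_o ∧ b_t with a vector of the same plane, so it vanishes; traces vanish
because the plane is isotropic. -/
theorem K_tmul_K_mem_weyl (h : Sep o t r) : F.K o t ⊗ₜ F.K o t ∈ F.weyl := by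
  obtain ⟨ho, ht, hr, hoo, htt, hot, hodt, hro, hrdo, hrt, hrdt, -⟩ := h
  have h1 : t ≠ dual o := fun h => hodt (eq_dual_comm.1 h)
  refine ⟨fun a b c d => ?_, fun a d => Finset.sum_eq_zero fun b _ => ?_⟩
  · have hk : ∀ a b, F.co a b (F.K o t) = (if a = o then 1 else 0) * (if b = t then 1 else 0)
        - (if b = o then 1 else 0) * (if a = t then 1 else 0) := by
      intro a b
      rw [co_K, sg_of_even ho, ite_and, ite_and]
      split_ifs <;> simp
    have hp : ∀ {a u : Idx m n}, par u = 0 → par a = 1 → a ≠ u := by rintro a _ hu ha rfl; omega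
    simp only [cc_tmul, hk]
    rcases par_cases a with ha | ha
    · rcases par_cases b with hb | hb
      · rw [sg_of_even ha, sg_of_even ha, sg_of_even hb]; ring
      · simp [hp ho hb, hp ht hb]
    · simp [hp ho ha, hp ht ha]
  · by_cases b1 : b = o
    · subst b1; simp [co_K, hoo.symm, h1.symm]
    · by_cases b2 : b = t
      · subst b2; simp [co_K, htt.symm, hodt.symm]
      · simp [co_K, b1, b2]

theorem _root_.OSp.Sep.dual (h : Sep o t r) : Sep (dual o) (dual t) r := by
  obtain ⟨ho, ht, hr, hoo, htt, hot, hodt, hro, hrdo, hrt, hrdt, hu⟩ := h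
  refine ⟨by simpa, by simpa, hr, by simpa using hoo.symm, by simpa using htt.symm,
    fun h => hot (dual_inj.1 h), ?_, hrdo, by simpa, hrdt, by simpa, hu⟩
  rw [dual_dual]
  exact fun h => hodt (eq_dual_comm.1 h.symm)

theorem tensorForm_K_dual (h : Sep o t r) : tensorForm G (F.K o t ⊗ₜ F.K o t)
    (F.K (OSp.dual o) (OSp.dual t) ⊗ₜ F.K (OSp.dual o) (OSp.dual t)) ≠ 0 := by
  obtain ⟨ho, ht, hr, hoo, htt, hot, hodt, hro, hrdo, hrt, hrdt, hu⟩ := h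
  rw [F.tensorForm_K, cc_tmul, co_K, sg_of_even (by simpa)]
  simp [hot, hot.symm, eta_ne_zero, dual_inj]

/-- If E ⊗ E is not in U, the fourfold action of E forces T^{o*t*o*t*} = 0 for all T in U, and
`Vanishing.eq_bot` for the opposite pair gives U = 0. -/
theorem K_tmul_K_mem (hM1 : (m : ℂ) - 2 * n ≠ 1) (hM2 : (m : ℂ) - 2 * n ≠ 2)
    (h : Sep o t r) {U : Submodule ℂ (osp G ⊗[ℂ] osp G)} (hU : IsSubrep G U)
    (hle : U ≤ F.weyl) (h0 : U ≠ ⊥) : F.K o t ⊗ₜ F.K o t ∈ U := by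
  by_contra hK
  refine h0 (Vanishing.eq_bot (F := F) ⟨hM1, hM2, h.dual, hU, hle, fun T hT => ?_⟩)
  by_contra hT0
  have h4 := hU (F.K o t) _ (hU (F.K o t) _ (hU (F.K o t) _ (hU (F.K o t) _ hT)))
  rw [F.tensorAct_pow_four h, Submodule.smul_mem_iff _ (mul_ne_zero (by norm_num) hT0)] at h4
  exact hK h4

/-- A nonzero intersection would contain E ⊗ E, while N contains the opposite vector; these two pair
to a nonzero number. -/
theorem inf_perp_eq_bot (hM1 : (m : ℂ) - 2 * n ≠ 1) (hM2 : (m : ℂ) - 2 * n ≠ 2)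
    (h : Sep o t r) {N U : Submodule ℂ (osp G ⊗[ℂ] osp G)} (hN : IsSubrep G N)
    (hle : N ≤ F.weyl) (h0 : N ≠ ⊥) (hθ : ∀ t ∈ N, tensorTheta G t ∈ N) (hU : IsSubrep G U)
    (hUle : U ≤ F.weyl) : U ⊓ perp N = ⊥ := by
  by_contra hne
  have h1 := F.K_tmul_K_mem hM1 hM2 h (hU.inf (F.perp_isSubrep hN hθ))
    (inf_le_left.trans hUle) hne
  exact F.tensorForm_K_dual h
    (mem_perp.1 h1.2 _ (F.K_tmul_K_mem hM1 hM2 h.dual hN hle h0))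

/-- The component along `perp N` of a Weyl tensor is again Weyl, hence lies in a zero intersection.
-/
theorem eq_weyl (hM1 : (m : ℂ) - 2 * n ≠ 1) (hM2 : (m : ℂ) - 2 * n ≠ 2)
    (h : Sep o t r) {N : Submodule ℂ (osp G ⊗[ℂ] osp G)} (hN : IsSubrep G N)
    (hle : N ≤ F.weyl) (h0 : N ≠ ⊥) (hθ : ∀ t ∈ N, tensorTheta G t ∈ N) : N = F.weyl := by
  have h1 := isCompl_perp (disjoint_iff.2 (F.inf_perp_eq_bot hM1 hM2 h hN hle h0 hθ hN hle))
  have h2 := F.inf_perp_eq_bot hM1 hM2 h hN hle h0 hθ F.weyl_isSubrep le_rfl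
  refine le_antisymm hle fun T hT => ?_
  have hT' : T ∈ N ⊔ perp N := by rw [h1.sup_eq_top]; trivial
  obtain ⟨x, hx, y, hy, rfl⟩ := Submodule.mem_sup.1 hT'
  have hy' : y = (x + y) + (-1 : ℂ) • x := by module
  have : y ∈ F.weyl ⊓ perp N :=
    ⟨hy' ▸ F.weyl.add_mem hT (F.weyl.smul_mem _ (hle hx)), hy⟩
  rw [h2, Submodule.mem_bot] at this
  simpa [this] using hx

theorem K_tmul_K_ne_zero (h : Sep o t r) : F.K o t ⊗ₜ[ℂ] F.K o t ≠ 0 := by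
  intro h0
  apply F.tensorForm_K_dual h
  rw [h0, map_zero]; rfl

theorem isCompl_weyl (hM1 : (m : ℂ) - 2 * n ≠ 1) (hM2 : (m : ℂ) - 2 * n ≠ 2)
    (h : Sep o t r) : IsCompl F.weyl (perp F.weyl) :=
  isCompl_perp (disjoint_iff.2 (F.inf_perp_eq_bot hM1 hM2 h F.weyl_isSubrep le_rfl
    (fun h0 => F.K_tmul_K_ne_zero h (by simpa [h0] using F.K_tmul_K_mem_weyl h))
    (fun _ => F.weyl_theta) F.weyl_isSubrep le_rfl))

end Extremal

end Frame

end

/-! ### Highest weight vectors and identification of the Cartan product. -/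

section

variable {m n : ℕ} {G : Metric m n} {W : WittBasis G}

/-- The position of an index in the order `e_1, …, e_d, p_1, …, p_n, (e_0), q_n, …, q_1, f_d, …, f_1`
of the Witt basis. -/
def pos : Idx m n → ℕ
  | Sum.inl a => if (a : ℕ) < m / 2 then a else if m - 1 - a < m / 2 then a + 2 * n else m / 2 + n
  | Sum.inr b => if (b : ℕ) < n then m / 2 + b else m / 2 + m % 2 + b

theorem pos_injective : Function.Injective (pos : Idx m n → ℕ) := by
  rintro (⟨a, ha⟩ | ⟨a, ha⟩) (⟨b, hb⟩ | ⟨b, hb⟩) h <;> simp only [pos] at h <;>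
    split_ifs at h <;> first | (exfalso; omega) | (congr 1; ext; dsimp only; omega)

theorem pos_lt (a : Idx m n) : pos a < m + 2 * n := by
  rcases a with ⟨a, ha⟩ | ⟨a, ha⟩ <;> simp only [pos] <;> split_ifs <;> omega

theorem pos_dual (a : Idx m n) : pos (dual a) = m + 2 * n - 1 - pos a := by
  rcases a with ⟨a, ha⟩ | ⟨a, ha⟩ <;>
    simp only [pos, dual, Sum.map_inl, Sum.map_inr, Fin.val_rev] <;> split_ifs <;> omega

theorem exists_pos_eq {i : ℕ} (hi : i < m + 2 * n) : ∃ a : Idx m n, pos a = i := by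
  let f : Idx m n → Fin (m + 2 * n) := fun a => ⟨pos a, pos_lt a⟩
  have hf : Function.Bijective f := by
    rw [Fintype.bijective_iff_injective_and_card]
    exact ⟨fun a b h => pos_injective (Fin.mk.inj h), by simp⟩
  obtain ⟨a, ha⟩ := hf.2 ⟨i, hi⟩
  exact ⟨a, Fin.mk.inj ha⟩

theorem idx_cases (a : Idx m n) : (∃ i : Fin (m / 2), a = Sum.inl ⟨i, by omega⟩)
    ∨ (∃ i : Fin (m / 2), a = dual (Sum.inl ⟨i, by omega⟩))
    ∨ (∃ j : Fin n, a = Sum.inr ⟨j, by omega⟩) ∨ (∃ j : Fin n, a = dual (Sum.inr ⟨j, by omega⟩))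
    ∨ (dual a = a ∧ par a = 0) := by
  rcases a with ⟨a, ha⟩ | ⟨a, ha⟩
  · by_cases h1 : a < m / 2
    · exact Or.inl ⟨⟨a, h1⟩, rfl⟩
    · by_cases h2 : m - 1 - a < m / 2
      · refine Or.inr (Or.inl ⟨⟨m - 1 - a, h2⟩, ?_⟩)
        simp only [dual, Sum.map_inl, Sum.inl.injEq, Fin.ext_iff, Fin.val_rev]; omega
      · refine Or.inr (Or.inr (Or.inr (Or.inr ⟨?_, rfl⟩)))
        simp only [dual, Sum.map_inl, Sum.inl.injEq, Fin.ext_iff, Fin.val_rev]; omega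
  · by_cases h1 : a < n
    · exact Or.inr (Or.inr (Or.inl ⟨⟨a, h1⟩, rfl⟩))
    · refine Or.inr (Or.inr (Or.inr (Or.inl ⟨⟨2 * n - 1 - a, by omega⟩, ?_⟩)))
      simp only [dual, Sum.map_inr, Sum.inr.injEq, Fin.ext_iff, Fin.val_rev]; omega

namespace Frame

variable (F : Frame W)

theorem mul_hat (X : osp G) : F.B * F.hat X = X.1 * F.B := by
  rw [hat_apply, ← mul_assoc, ← mul_assoc, F.mul_inv, one_mul]

theorem pairing_col (X : osp G) (x z : Idx m n) :
    pairing G (X.1 *ᵥ F.B.col x) (F.B.col (dual z)) = sg z z * eta z * F.hat X z x := by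
  have h1 : pairing G (X.1 *ᵥ F.B.col x) (F.B.col (dual z))
      = ((X.1 * F.B)ᵀ * G.g * F.B) x (dual z) := by
    simp only [pairing, Matrix.mul_apply, Matrix.transpose_apply, Finset.sum_mul]
    rw [Finset.sum_comm]
    refine Finset.sum_congr rfl fun b _ => Finset.sum_congr rfl fun a _ => ?_
    simp only [Matrix.mulVec, dotProduct, Matrix.col_apply, Finset.mul_sum, Finset.sum_mul]
    refine Finset.sum_congr rfl fun c _ => by ring
  have h2 : (X.1 * F.B)ᵀ * G.g * F.B = (F.hat X)ᵀ * wittMatrix m n := by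
    rw [← mul_hat, Matrix.transpose_mul, ← F.metric]; simp only [mul_assoc]
  rw [h1, h2, Matrix.mul_apply, Finset.sum_eq_single z]
  · rw [wittMatrix_apply, if_pos rfl, Matrix.transpose_apply]; ring
  · intro y _ hy
    rw [wittMatrix_apply, if_neg fun h => hy (dual_inj.1 h).symm, mul_zero]
  · simp

theorem epsilon_eq (i : Fin (m / 2)) (X : osp G) :
    W.epsilon i X = F.hat X (Sum.inl ⟨i, by omega⟩) (Sum.inl ⟨i, by omega⟩) := by
  rw [WittBasis.epsilon, ← F.col_e, ← F.col_f, pairing_col]; simp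

theorem delta_eq (j : Fin n) (X : osp G) :
    W.delta j X = F.hat X (Sum.inr ⟨j, by omega⟩) (Sum.inr ⟨j, by omega⟩) := by
  rw [WittBasis.delta, ← F.col_p, ← F.col_q, pairing_col]; simp [eta]

theorem hat_apply_of_mulVec {X : osp G} {y : Idx m n} {c : ℂ}
    (h : X.1 *ᵥ F.B.col y = c • F.B.col y) (x : Idx m n) :
    F.hat X x y = c * (1 : Matrix (Idx m n) (Idx m n) ℂ) x y := by
  have h1 : F.hat X x y = (F.Bi *ᵥ (X.1 *ᵥ F.B.col y)) x := by
    rw [Matrix.mulVec_mulVec]; rfl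
  rw [h1, h, Matrix.mulVec_smul, ← F.inv_mul]; rfl

theorem hat_eq_zero_of_cartan {H : osp G} (hH : H ∈ W.cartan) {x y : Idx m n} (hxy : x ≠ y) :
    F.hat H x y = 0 := by
  obtain ⟨-, he, hf, hp, hq⟩ := hH
  have key : ∀ x y, x ≠ y → dual y ≠ y → F.hat H x y = 0 := by
    intro x y hxy hy
    obtain ⟨c, hc⟩ : ∃ c : ℂ, H.1 *ᵥ F.B.col y = c • F.B.col y := by
      rcases idx_cases y with ⟨i, rfl⟩ | ⟨i, rfl⟩ | ⟨i, rfl⟩ | ⟨i, rfl⟩ | h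
      · exact ⟨_, by rw [F.col_e]; exact he i⟩
      · exact ⟨_, by rw [F.col_f]; exact hf i⟩
      · exact ⟨_, by rw [F.col_p]; exact hp i⟩
      · exact ⟨_, by rw [F.col_q]; exact hq i⟩
      · exact absurd h.1 hy
    rw [F.hat_apply_of_mulVec hc, Matrix.one_apply_ne hxy, mul_zero]
  -- For odd m the definition of the Cartan subalgebra says nothing about the middle column;
  -- antisymmetry transports its entries to the column x*, where the eigenvector condition applies.
  by_cases hy : dual y = y
  · have hx : dual x ≠ x := by
      intro hx
      have h1 := pos_dual x
      have h2 := pos_dual y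
      have h3 := pos_lt x
      have h4 := pos_lt y
      rw [hx] at h1
      rw [hy] at h2
      exact hxy (pos_injective (by omega))
    rw [hat_eq_co, co_swap, F.co_apply]
    rw [key (dual y) (dual x) (fun h => hxy (dual_inj.1 h).symm) (by simpa using hx.symm)]
    ring
  · exact key x y hxy hy

theorem hat_dual_self (X : osp G) (x : Idx m n) : F.hat X (dual x) (dual x) = -F.hat X x x := by
  rw [hat_eq_co, hat_eq_co, dual_dual, F.co_swap, sg_dual_right, eta_dual]
  ring

/-- The action of a diagonal even element. -/
theorem co_bracket_of_cartan {H : osp G} (hH : H ∈ W.cartan) (X : osp G) (a b : Idx m n) :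
    F.co a b (bracket G H X) = (F.hat H a a + F.hat H b b) * F.co a b X := by
  have hd : F.hat H = Matrix.diagonal fun x => F.hat H x x := by
    ext x y
    rw [Matrix.diagonal_apply]
    split_ifs with h
    · rw [h]
    · exact F.hat_eq_zero_of_cartan hH h
  have he : evenPart (F.hat H) = F.hat H := by
    rw [hd]; ext x y
    rw [evenPart_apply, Matrix.diagonal_apply]
    split_ifs with h1 h2 h2 <;> first | rfl | (subst h2; exact absurd rfl h1)
  have ho : oddPart (F.hat H) = 0 := by rw [oddPart_eq, he, sub_self]
  have hb : superBracket (F.hat H) (F.hat X) = F.hat H * F.hat X - F.hat X * F.hat H := by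
    rw [superBracket, he, ho, oddPart_eq (F.hat X)]; noncomm_ring
  rw [co_apply, hat_bracket, hb, co_apply, Matrix.sub_apply]
  have h2 := F.hat_dual_self H b
  rw [hd] at h2 ⊢
  simp only [Matrix.diagonal_mul, Matrix.mul_diagonal, Matrix.diagonal_apply_eq] at h2 ⊢
  rw [h2]; ring

/-- The weight of b_{j*} is minus that of b_j, so b_k ∧ b_{j*} has weight w_k - w_j. -/
theorem isRootVector_K {α : osp G → ℂ} {k j : Idx m n}
    (h : ∀ H ∈ W.cartan, α H = F.hat H k k - F.hat H j j) :
    W.IsRootVector α (F.K k (dual j)) := by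
  intro H hH
  apply F.ext_co
  intro a b
  rw [co_bracket_of_cartan F hH, map_smul, h H hH, smul_eq_mul, co_K]
  by_cases h1 : a = k ∧ b = dual j
  · obtain ⟨rfl, rfl⟩ := h1
    rw [hat_dual_self]; ring
  · by_cases h2 : a = dual j ∧ b = k
    · obtain ⟨rfl, rfl⟩ := h2
      rw [hat_dual_self]; ring
    · simp [h1, h2]

theorem hat_K_dual (a x y : Idx m n) : F.hat (F.K a (dual a)) x y =
    if x = y then eta (dual a) * ((if x = a then 1 else 0) - (if x = dual a then 1 else 0))
      else 0 := by
  rw [hat_K, wedgeMatrix_apply, dual_dual, sg_dual_right, ← eta_dual]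
  by_cases h : x = y
  · subst h
    simp only [and_self, if_true, mul_sub, mul_ite, mul_one, mul_zero]
  · rw [if_neg h, if_neg, if_neg, sub_zero]
    · rintro ⟨rfl, rfl⟩; exact h rfl
    · rintro ⟨rfl, rfl⟩; exact h rfl

/-- `K a (dual a)` belongs to the Cartan subalgebra. -/
theorem K_dual_mem_cartan (a : Idx m n) : F.K a (dual a) ∈ W.cartan := by
  have hcol : ∀ y : Idx m n, (F.K a (dual a)).1 *ᵥ F.B.col y
      = F.hat (F.K a (dual a)) y y • F.B.col y := by
    intro y
    ext x
    have h := congrFun (congrFun (F.mul_hat (F.K a (dual a))) x) y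
    rw [Matrix.mul_apply, Finset.sum_eq_single y] at h
    · exact h.symm.trans (mul_comm _ _)
    · intro z _ hz
      rw [hat_K_dual, if_neg hz, mul_zero]
    · simp
  refine ⟨?_, fun i => ?_, fun i => ?_, fun i => ?_, fun i => ?_⟩
  · have := F.ospOdd_K a (dual a)
    rw [if_pos (par_dual a).symm] at this
    exact congrArg Subtype.val this
  · rw [F.epsilon_eq, ← F.col_e, hcol]
  · rw [F.epsilon_eq, ← F.col_f, hcol, hat_dual_self]
  · rw [F.delta_eq, ← F.col_p, hcol]
  · rw [F.delta_eq, ← F.col_q, hcol, hat_dual_self]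

/-- `pos` lists the basis by decreasing weight: the simple roots are the differences of consecutive
weights in the first half of the list. -/
theorem exists_simpleRoot_aux {k j : Idx m n} (h : pos j = pos k + 1) (hk : pos k < m / 2 + n)
    (hn : 0 < n) : ∃ α ∈ W.simpleRoots, ∀ H ∈ W.cartan, α H = F.hat H k k - F.hat H j j := by
  have hj : ∀ j', pos j' = pos k + 1 → j = j' := fun j' h' => pos_injective (h.trans h'.symm)
  rcases idx_cases k with ⟨⟨i, hi⟩, rfl⟩ | ⟨⟨i, hi⟩, rfl⟩ | ⟨⟨i, hi⟩, rfl⟩ | ⟨⟨i, hi⟩, rfl⟩ | hk0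
  · have hp : pos (Sum.inl ⟨i, by omega⟩ : Idx m n) = i := by simp [pos, hi]
    rw [hp] at hj
    by_cases hi1 : i + 1 < m / 2
    · have e := hj (Sum.inl ⟨i + 1, by omega⟩) (by simp [pos, hi1])
      rw [e]
      refine ⟨W.epsilon ⟨i, hi⟩ - W.epsilon ⟨i + 1, hi1⟩,
        Or.inl (Or.inl (Or.inl ⟨_, _, rfl, rfl⟩)), fun H _ => ?_⟩
      rw [Pi.sub_apply, F.epsilon_eq, F.epsilon_eq]
    · have e := hj (Sum.inr ⟨0, by omega⟩) (by simp [pos, hn]; omega)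
      rw [e]
      refine ⟨W.epsilon ⟨i, hi⟩ - W.delta ⟨0, hn⟩,
        Or.inl (Or.inl (Or.inr ⟨_, _, by dsimp only; omega, rfl, rfl⟩)), fun H _ => ?_⟩
      rw [Pi.sub_apply, F.epsilon_eq, F.delta_eq]
  · exfalso
    rw [pos_dual] at hk
    simp only [pos, hi, if_true] at hk; omega
  · have hp : pos (Sum.inr ⟨i, by omega⟩ : Idx m n) = m / 2 + i := by simp [pos, hi]
    rw [hp] at hj
    by_cases hi1 : i + 1 < n
    · have e := hj (Sum.inr ⟨i + 1, by omega⟩) (by simp [pos, hi1]; omega)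
      rw [e]
      refine ⟨W.delta ⟨i, hi⟩ - W.delta ⟨i + 1, hi1⟩,
        Or.inl (Or.inr ⟨_, _, rfl, rfl⟩), fun H _ => ?_⟩
      rw [Pi.sub_apply, F.delta_eq, F.delta_eq]
    · refine ⟨_, Or.inr ⟨⟨i, hi⟩, by dsimp only; omega, rfl⟩, fun H hH => ?_⟩
      -- After the last p comes its dual when m is even, with difference 2δ_n, or the middle unit
      -- vector of weight zero when m is odd, with difference δ_n.
      by_cases hm : Even m
      · have hm' := Nat.even_iff.1 hm
        have e := hj (dual (Sum.inr ⟨i, by omega⟩)) (by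
          rw [pos_dual]; simp only [pos, hi, if_true]; omega)
        rw [e, if_pos hm, Pi.smul_apply, F.delta_eq, hat_dual_self, smul_eq_mul]; ring
      · have hm' := Nat.not_even_iff.1 hm
        have e := hj (Sum.inl ⟨m / 2, by omega⟩) (by simp only [pos]; split_ifs <;> omega)
        have h0 := F.hat_dual_self H (Sum.inl ⟨m / 2, by omega⟩)
        have hd : dual (Sum.inl ⟨m / 2, by omega⟩ : Idx m n) = Sum.inl ⟨m / 2, by omega⟩ := by
          simp only [dual, Sum.map_inl, Sum.inl.injEq, Fin.ext_iff, Fin.val_rev]; omega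
        rw [hd] at h0
        rw [e, if_neg hm, F.delta_eq]
        linear_combination (1 / 2 : ℂ) * h0
  · exfalso
    rw [pos_dual] at hk
    simp only [pos, hi, if_true] at hk; omega
  · exfalso
    have h1 := pos_dual k
    have h2 := pos_lt k
    rw [hk0.1] at h1
    omega

/-- In the second half of the list, duality reverses positions and negates weights, so the same
differences recur. -/
theorem exists_simpleRoot {k j : Idx m n} (h : pos j = pos k + 1) (hn : 0 < n) :
    ∃ α ∈ W.simpleRoots, ∀ H ∈ W.cartan, α H = F.hat H k k - F.hat H j j := by
  by_cases hk : pos k < m / 2 + n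
  · exact F.exists_simpleRoot_aux h hk hn
  · have hj := pos_lt j
    obtain ⟨α, hα, hH⟩ := F.exists_simpleRoot_aux (k := dual j) (j := dual k)
      (by rw [pos_dual, pos_dual]; omega) (by rw [pos_dual]; omega) hn
    refine ⟨α, hα, fun H hc => ?_⟩
    rw [hH H hc, hat_dual_self, hat_dual_self]; ring

theorem exists_pos_of_simpleRoot {α : osp G → ℂ} (h : α ∈ W.simpleRoots) :
    ∃ k j : Idx m n, pos j = pos k + 1 ∧ pos k < m / 2 + n ∧
      ∀ H, α H = F.hat H k k - F.hat H j j := by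
  rcases h with ((⟨i, i', hi, rfl⟩ | ⟨i, i', hi, hi', rfl⟩) | ⟨i, i', hi, rfl⟩) | ⟨i, hi, rfl⟩
  · refine ⟨Sum.inl ⟨i, by omega⟩, Sum.inl ⟨i', by omega⟩, by simp [pos, hi],
      by simp [pos]; omega, fun H => ?_⟩
    rw [Pi.sub_apply, F.epsilon_eq, F.epsilon_eq]
  · have := i'.2
    refine ⟨Sum.inl ⟨i, by omega⟩, Sum.inr ⟨i', by omega⟩, by simp [pos]; omega,
      by simp [pos]; omega, fun H => ?_⟩
    rw [Pi.sub_apply, F.epsilon_eq, F.delta_eq]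
  · refine ⟨Sum.inr ⟨i, by omega⟩, Sum.inr ⟨i', by omega⟩, by simp [pos]; omega,
      by simp [pos], fun H => ?_⟩
    rw [Pi.sub_apply, F.delta_eq, F.delta_eq]
  · have hp : pos (Sum.inr ⟨i, by omega⟩ : Idx m n) = m / 2 + i := by simp [pos]
    by_cases hm : Even m
    · have hm' := Nat.even_iff.1 hm
      refine ⟨Sum.inr ⟨i, by omega⟩, dual (Sum.inr ⟨i, by omega⟩), by rw [pos_dual, hp]; omega,
        by rw [hp]; omega, fun H => ?_⟩
      rw [if_pos hm, Pi.smul_apply, F.delta_eq, hat_dual_self, smul_eq_mul]; ring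
    · have hm' := Nat.not_even_iff.1 hm
      refine ⟨Sum.inr ⟨i, by omega⟩, Sum.inl ⟨m / 2, by omega⟩,
        by rw [hp]; simp only [pos]; split_ifs <;> omega, by rw [hp]; omega, fun H => ?_⟩
      have h0 := F.hat_dual_self H (Sum.inl ⟨m / 2, by omega⟩)
      have hd : dual (Sum.inl ⟨m / 2, by omega⟩ : Idx m n) = Sum.inl ⟨m / 2, by omega⟩ := by
        simp only [dual, Sum.map_inl, Sum.inl.injEq, Fin.ext_iff, Fin.val_rev]; omega
      rw [hd] at h0
      rw [if_neg hm, F.delta_eq]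
      linear_combination (1 / 2 : ℂ) * h0

/-- The weight of the basis vector with index `x` for a suitable multiple of `K c (dual c)`. -/
def weight (c x : Idx m n) : ℤ :=
  (if pos x = pos c then 1 else 0) - (if pos x = m + 2 * n - 1 - pos c then 1 else 0)

theorem hat_K_dual_self (c x : Idx m n) :
    F.hat (F.K c (dual c)) x x = eta (dual c) * weight c x := by
  rw [hat_K_dual, if_pos rfl, weight, ← pos_dual]
  simp only [pos_injective.eq_iff]
  push_cast
  rfl

/-- Testing against the Cartan elements K c c* turns a weight comparison into integer equations, one
for each c. -/
theorem weight_eq {α : osp G → ℂ} {k j : Idx m n}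
    (h : ∀ H, α H = F.hat H k k - F.hat H j j) {X : osp G} (hX : W.IsRootVector α X)
    {a b : Idx m n} (hab : F.co a b X ≠ 0) (c : Idx m n) :
    weight c a + weight c b = weight c k - weight c j := by
  have h1 := congrArg (F.co a b) (hX _ (F.K_dual_mem_cartan c))
  rw [F.co_bracket_of_cartan (F.K_dual_mem_cartan c), map_smul, smul_eq_mul, h] at h1
  have h2 := mul_right_cancel₀ hab h1
  simp only [hat_K_dual_self, ← mul_add, ← mul_sub] at h2
  exact_mod_cast mul_left_cancel₀ (eta_ne_zero _) h2

theorem bracket_comm_of_even {X Y : osp G} (hY : ospOdd G Y = 0) :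
    bracket G X Y = -bracket G Y X := by
  have hY' : oddPart Y.1 = 0 := congrArg Subtype.val hY
  ext1
  change superBracket X.1 Y.1 = -superBracket Y.1 X.1
  simp only [superBracket, hY']
  noncomm_ring

theorem isHighestWeightVector_K (hm : 4 < m) (hn : 0 < n) {o t : Idx m n} (ho : pos o = 0)
    (ht : pos t = 1) (po : par o = 0) (pt : par t = 0) :
    W.IsHighestWeightVector (F.K o t) := by
  have hot : o ≠ t := by rintro rfl; omega
  refine ⟨fun h => ?_, ⟨fun H => F.hat H o o + F.hat H t t, fun H hH => ?_⟩, fun α hα X hX => ?_⟩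
  · have := congrArg (F.co o t) h
    simp [co_K, hot, hot.symm] at this
  · apply F.ext_co
    intro a b
    rw [co_bracket_of_cartan F hH, map_smul, smul_eq_mul, co_K]
    by_cases h1 : a = o ∧ b = t
    · obtain ⟨rfl, rfl⟩ := h1; rfl
    · by_cases h2 : a = t ∧ b = o
      · obtain ⟨rfl, rfl⟩ := h2; ring
      · simp [h1, h2]
  · obtain ⟨k, j, hj, hk, hαH⟩ := F.exists_pos_of_simpleRoot hα
    have hw := fun a b h c => F.weight_eq hαH hX (a := a) (b := b) h c
    -- X is an arbitrary vector of its root space, so it is controlled through its nonzero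
    -- components, which must have weight α. This one would have weight zero.
    have kk : ∀ x, F.co (dual x) x X = 0 := by
      intro x
      by_contra hne
      have h1 := hw _ _ hne k
      have h2 := pos_lt x
      simp only [weight, pos_dual] at h1
      split_ifs at h1 <;> omega
    have h1 : ∀ b, F.co (dual o) b X = 0 := by
      intro b
      by_contra hne
      have h1 := hw _ _ hne o
      have h2 : b ≠ o := by rintro rfl; exact hne (kk _)
      have h3 : pos b ≠ pos o := fun h => h2 (pos_injective h)
      simp only [weight, pos_dual] at h1
      split_ifs at h1 <;> omega
    -- For b = o the weight is ε_1 - ε_2, a simple root, so that component may survive; its two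
    -- contributions to the bracket cancel.
    have h2 : ∀ b, b ≠ o → F.co (dual t) b X = 0 := by
      intro b hb
      by_contra hne
      have h1 := hw _ _ hne o
      have h1' := hw _ _ hne t
      have h2 : b ≠ t := by rintro rfl; exact hne (kk _)
      have h3 : pos b ≠ pos o := fun h => hb (pos_injective h)
      have h4 : pos b ≠ pos t := fun h => h2 (pos_injective h)
      simp only [weight, pos_dual] at h1 h1'
      have h5 : pos k ≠ pos o := by
        intro h5
        rw [if_neg (by omega), if_neg (by omega), if_neg h3, if_pos h5, if_neg (by omega),
          if_neg (by omega), if_neg (by omega)] at h1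
        split_ifs at h1 <;> omega
      split_ifs at h1' <;> omega
    rw [bracket_comm_of_even (by rw [ospOdd_K, if_pos (po.trans pt.symm)]), neg_eq_zero]
    have hto : t ≠ dual o := by
      intro h; have := congrArg pos h; rw [pos_dual] at this; omega
    apply F.ext_co
    intro a b
    rw [co_bracket, sg_of_even po, sg_of_even po, sg_of_even pt, map_zero, F.co_swap (dual t) a,
      F.co_swap (dual o) a, h1, h1]
    by_cases a1 : a = o
    · subst a1
      by_cases b1 : b = a
      · subst b1
        simp [hot, sg_of_even' po]
      · simp [h2 b b1, b1]
    · simp [a1, h2 a a1]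

/-- Neighbours that are dual to each other sit at the centre of the list, where n > 0 places odd
vectors. -/
theorem par_of_dual_eq {k j : Idx m n} (h : pos j = pos k + 1) (hj : j = dual k) (hn : 0 < n) :
    par k = 1 := by
  have h1 := pos_dual k
  have h2 := pos_lt k
  rw [← hj] at h1
  rcases k with ⟨a, ha⟩ | a
  · simp only [pos] at h1 h h2
    split_ifs at h1 h h2 <;> omega
  · rfl

/-- The (k, b) component of the bracket is a nonzero multiple of v^{jb}. If j = k*, two
contributions coincide; since k is odd they add up instead of cancelling. -/
theorem co_eq_zero_of_bracket {k j : Idx m n} {v : osp G} (hn : 0 < n)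
    (h : bracket G (F.K k (dual j)) v = 0) (hkj : pos j = pos k + 1) {b : Idx m n}
    (hb : b ≠ k ∨ j = dual k) (hb' : b ≠ dual j ∨ j = dual k) : F.co j b v = 0 := by
  have hne : k ≠ j := by rintro rfl; omega
  have h1 := congrArg (F.co k b) h
  rw [co_bracket, if_pos rfl, map_zero, dual_dual] at h1
  by_cases hk : j = dual k
  · have hp := par_of_dual_eq hkj hk hn
    subst hk
    rw [dual_dual] at h1
    rw [if_pos rfl] at h1
    have h2 : sg k k = -1 := by simp [sg, hp]
    by_cases hbk : b = k
    · subst hbk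
      rw [if_pos rfl, if_pos rfl, F.co_swap (dual b) b, sg_dual_left, h2] at h1
      have h3 : (4 * eta b) * F.co (dual b) b v = 0 := by linear_combination h1
      simpa [eta_ne_zero] using h3
    · rw [if_neg hbk, if_neg hbk, h2] at h1
      have h3 : (2 * eta k) * F.co (dual k) b v = 0 := by linear_combination h1
      simpa [eta_ne_zero] using h3
  · have hk' : k ≠ dual j := fun h => hk (eq_dual_comm.1 h)
    rw [if_neg hk', if_neg (hb.resolve_right hk), if_neg (hb'.resolve_right hk)] at h1
    simpa [eta_ne_zero] using h1

theorem co_dual_eq_zero_of_bracket {k j : Idx m n} {v : osp G}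
    (h : bracket G (F.K k (dual j)) v = 0) (hk : j ≠ dual k)
    (h0 : F.co j (dual j) v = 0) : F.co k (dual k) v = 0 := by
  have hk' : k ≠ dual j := fun h => hk (eq_dual_comm.1 h)
  have h1 := congrArg (F.co k (dual j)) h
  rw [co_bracket, if_pos rfl, if_neg hk', if_neg hk'.symm, if_pos rfl, dual_dual, h0, map_zero] at h1
  simpa [eta_ne_zero, sg_ne_zero] using h1

/-- A vector annihilated by all simple root vectors is a multiple of `K o t`. -/
theorem eq_smul_K (hm : 4 < m) (hn : 0 < n) {o t : Idx m n} (ho : pos o = 0)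
    (ht : pos t = 1) (po : par o = 0) (pt : par t = 0) {v : osp G}
    (hv : ∀ k j : Idx m n, pos j = pos k + 1 → bracket G (F.K k (dual j)) v = 0) :
    v = F.co o t v • F.K o t := by
  have hL : pos t < m + 2 * n := pos_lt t
  have swap : ∀ {a b}, F.co a b v = 0 → F.co b a v = 0 := by
    intro a b h; rw [co_swap, h, mul_zero]
  -- The root vector built from j and its predecessor k isolates v^{jb}, unless b is k or j*; the
  -- two position conditions exclude these.
  have row : ∀ j b : Idx m n, 1 ≤ pos j → pos b + 1 ≠ pos j → pos b + pos j + 1 ≠ m + 2 * n →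
      F.co j b v = 0 := by
    intro j b hj hb hb'
    have h1 := pos_lt j
    obtain ⟨k, hk⟩ := exists_pos_eq (m := m) (n := n) (i := pos j - 1) (by omega)
    refine F.co_eq_zero_of_bracket hn (hv k j (by omega)) (by omega)
      (Or.inl ?_) (Or.inl ?_)
    · rintro rfl; omega
    · rintro rfl; rw [pos_dual] at hb'; omega
  have upper : ∀ a b : Idx m n, pos a ≤ pos b → 2 ≤ pos b → pos a + pos b + 1 ≠ m + 2 * n →
      F.co a b v = 0 := by
    intro a b hab hb hL'
    by_cases h1 : pos a + 1 = pos b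
    · exact row a b (by omega) (by omega) (by omega)
    · exact swap (row b a (by omega) (by omega) (by omega))
  -- The components v^{aa*}, missed by `row`, are handled from the centre outwards, each root vector
  -- linking consecutive ones. At the centre, for even m the root 2δ_n applies; for odd m the index
  -- is self-dual and antisymmetry suffices.
  have diag : ∀ i (a : Idx m n), pos a + i = (m + 2 * n - 1) / 2 → F.co a (dual a) v = 0 := by
    intro i
    induction i with
    | zero =>
      intro a ha
      have h1 := pos_dual a
      have h2 := pos_lt a
      by_cases hm' : m % 2 = 0
      · exact swap (F.co_eq_zero_of_bracket hn (hv a (dual a) (by omega)) (by omega)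
          (Or.inr rfl) (Or.inr rfl))
      · have h3 : dual a = a := pos_injective (by omega)
        rw [h3]
        rcases a with a | ⟨a, ha'⟩
        · exact F.co_self_inl a v
        · exfalso
          simp only [dual, Sum.map_inr, Sum.inr.injEq, Fin.ext_iff, Fin.val_rev] at h3
          omega
    | succ i ih =>
      intro a ha
      obtain ⟨j, hj⟩ := exists_pos_eq (m := m) (n := n) (i := pos a + 1) (by omega)
      refine F.co_dual_eq_zero_of_bracket (hv a j hj) ?_ (ih j (by omega))
      rintro rfl; rw [pos_dual] at hj; omega
  have diag' : ∀ a : Idx m n, F.co a (dual a) v = 0 := by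
    intro a
    have h1 := pos_dual a
    have h2 := pos_lt a
    by_cases h : pos a ≤ (m + 2 * n - 1) / 2
    · exact diag ((m + 2 * n - 1) / 2 - pos a) a (by omega)
    · have := diag ((m + 2 * n - 1) / 2 - pos (dual a)) (dual a) (by omega)
      rw [dual_dual] at this
      exact swap this
  have all : ∀ a b : Idx m n, pos a ≤ pos b → 2 ≤ pos b → F.co a b v = 0 := by
    intro a b hab hb
    by_cases h : pos a + pos b + 1 = m + 2 * n
    · have : b = dual a := pos_injective (by rw [pos_dual]; omega)
      rw [this]; exact diag' a
    · exact upper a b hab hb h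
  have self : ∀ a, par a = 0 → F.co a a v = 0 := by
    intro a ha
    have h := F.co_swap a a v
    rw [sg_of_even ha] at h
    linear_combination (1 / 2 : ℂ) * h
  apply F.ext_co
  intro a b
  have hto : o ≠ t := by rintro rfl; omega
  rw [map_smul, co_K, smul_eq_mul, sg_of_even po]
  by_cases ha : 2 ≤ pos a
  · have h1 : a ≠ o := by rintro rfl; omega
    have h2 : a ≠ t := by rintro rfl; omega
    have : F.co a b v = 0 := by
      rcases le_total (pos a) (pos b) with h | h
      · exact all a b h (by omega)
      · exact swap (all b a h ha)
    simp [this, h1, h2]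
  by_cases hb : 2 ≤ pos b
  · have h1 : b ≠ o := by rintro rfl; omega
    have h2 : b ≠ t := by rintro rfl; omega
    simp [all a b (by omega) hb, h1, h2]
  have ha' : a = o ∨ a = t := by
    rcases Nat.lt_or_ge (pos a) 1 with h | h
    · exact Or.inl (pos_injective (by omega))
    · exact Or.inr (pos_injective (by omega))
  have hb' : b = o ∨ b = t := by
    rcases Nat.lt_or_ge (pos b) 1 with h | h
    · exact Or.inl (pos_injective (by omega))
    · exact Or.inr (pos_injective (by omega))
  rcases ha' with rfl | rfl <;> rcases hb' with rfl | rfl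
  · simp [hto, self _ po]
  · simp [hto]
  · rw [co_swap, sg_of_even po]; simp [hto.symm]
  · simp [hto.symm, self _ pt]

theorem eq_smul_K_of_isHighestWeightVector (hm : 4 < m) (hn : 0 < n) {o t : Idx m n}
    (ho : pos o = 0) (ht : pos t = 1) (po : par o = 0) (pt : par t = 0) {v : osp G}
    (hv : W.IsHighestWeightVector v) : v = F.co o t v • F.K o t := by
  refine F.eq_smul_K hm hn ho ht po pt fun k j hkj => ?_
  obtain ⟨α, hα, h⟩ := F.exists_simpleRoot hkj hn
  exact hv.2.2 α hα _ (F.isRootVector_K h)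

theorem theta_K (p q : Idx m n) : theta G (F.K p q) = (sg p p * sg q q) • F.K p q := by
  rw [theta, LinearMap.sub_apply, ospEven_K, ospOdd_K]
  rcases par_cases p with hp | hp <;> rcases par_cases q with hq | hq <;> simp [sg, hp, hq] <;> module

/-- The Cartan product is the space of Weyl tensors. -/
theorem cartanProduct_eq (hM1 : (m : ℂ) - 2 * n ≠ 1) (hM2 : (m : ℂ) - 2 * n ≠ 2) (hm : 4 < m)
    (hn : 0 < n) {o t r : Idx m n} (hs : Sep o t r) (ho : pos o = 0) (ht : pos t = 1) :
    W.cartanProduct = F.weyl := by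
  have hw := F.K_tmul_K_mem_weyl hs
  apply le_antisymm
  · refine sInf_le ⟨F.weyl_isSubrep, fun v hv => ?_⟩
    rw [F.eq_smul_K_of_isHighestWeightVector hm hn ho ht hs.par_o hs.par_t hv,
      ← TensorProduct.smul_tmul', TensorProduct.tmul_smul]
    exact F.weyl.smul_mem _ (F.weyl.smul_mem _ hw)
  · refine le_sInf fun N hN => ?_
    have h1 := hN.2 _ (F.isHighestWeightVector_K hm hn ho ht hs.par_o hs.par_t)
    have hθ : tensorTheta G (F.K o t ⊗ₜ F.K o t) = F.K o t ⊗ₜ F.K o t := by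
      rw [tensorTheta, TensorProduct.map_tmul, theta_K, sg_of_even hs.par_o, sg_of_even hs.par_t]
      simp
    -- `N` need not be parity-stable, so `eq_weyl` is applied to the parity-stable part of its
    -- intersection with the Weyl tensors.
    have h2 : F.K o t ⊗ₜ F.K o t ∈ (N ⊓ F.weyl) ⊓ (N ⊓ F.weyl).comap (tensorTheta G) :=
      ⟨⟨h1, hw⟩, by change tensorTheta G _ ∈ N ⊓ F.weyl; rw [hθ]; exact ⟨h1, hw⟩⟩
    have hsub := hN.1.inf F.weyl_isSubrep
    rw [← F.eq_weyl hM1 hM2 hs (hsub.inf hsub.comap_theta) (inf_le_left.trans inf_le_right)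
      (fun h => F.K_tmul_K_ne_zero hs ((Submodule.mem_bot ℂ).1 (h ▸ h2)))
      (fun T hT => ⟨hT.2, by
        change tensorTheta G (tensorTheta G T) ∈ N ⊓ F.weyl; rw [tensorTheta_tensorTheta]; exact hT.1⟩)]
    exact inf_le_left.trans inf_le_left

end Frame

end

/-! ### Existence and uniqueness of the invariant projection. -/

section

variable {m n : ℕ} {G : Metric m n} {W : WittBasis G}

theorem _root_.Submodule.exists_projection_of_isCompl {V : Type*} [AddCommGroup V] [Module ℂ V]
    {N N' : Submodule ℂ V} (h : IsCompl N N') :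
    ∃ P : V →ₗ[ℂ] V, (∀ x ∈ N, P x = x) ∧ ∀ x ∈ N', P x = 0 :=
  ⟨LinearMap.ofIsCompl h N.subtype 0, fun x hx => LinearMap.ofIsCompl_apply_left h ⟨x, hx⟩,
    fun x hx => LinearMap.ofIsCompl_apply_right h ⟨x, hx⟩⟩

namespace Frame

variable (F : Frame W) {o t r : Idx m n}

theorem exists_isCartanProjection (h : IsCompl F.weyl (perp F.weyl))
    (hW : W.cartanProduct = F.weyl) : ∃ P, W.IsCartanProjection P := by
  obtain ⟨P, hP, hP'⟩ := Submodule.exists_projection_of_isCompl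
    (V := osp G ⊗[ℂ] osp G) (N := F.weyl) (N' := perp F.weyl) h
  have hdec : ∀ s : osp G ⊗[ℂ] osp G, ∃ x ∈ F.weyl, ∃ y ∈ perp F.weyl, x + y = s := fun s =>
    Submodule.mem_sup.1 (by rw [h.sup_eq_top]; trivial)
  refine ⟨P, ⟨fun X s => ?_, ?_, ?_⟩⟩
  · obtain ⟨x, hx, y, hy, rfl⟩ := hdec s
    rw [map_add, map_add, map_add, map_add, hP _ hx, hP' _ hy, hP _ (F.weyl_isSubrep X x hx),
      hP' _ (F.perp_isSubrep F.weyl_isSubrep (fun _ => F.weyl_theta) X y hy), map_zero]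
  · rw [hW]
    ext s
    constructor
    · rintro ⟨s, rfl⟩
      obtain ⟨x, hx, y, hy, rfl⟩ := hdec s
      rw [map_add, hP _ hx, hP' _ hy, add_zero]; exact hx
    · exact fun hs => ⟨s, hP s hs⟩
  · rw [hW]; exact hP

/-- If the image of the annihilator were nonzero, it would contain E ⊗ E = P s with s in the
annihilator. The opposite extremal element, applied four times, gives a nonzero result on P s but
zero on s. -/
theorem isCartanProjection_perp (hM1 : (m : ℂ) - 2 * n ≠ 1) (hM2 : (m : ℂ) - 2 * n ≠ 2)
    (hs : Sep o t r) (hW : W.cartanProduct = F.weyl) {P} (hP : W.IsCartanProjection P)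
    {s : osp G ⊗[ℂ] osp G} (hsp : s ∈ perp F.weyl) : P s = 0 := by
  have hperp := F.perp_isSubrep F.weyl_isSubrep (fun _ => F.weyl_theta)
  have hU : (perp F.weyl).map P = ⊥ := by
    by_contra hne
    have hw := F.K_tmul_K_mem hM1 hM2 hs (U := (perp F.weyl).map P)
      (by
        rintro X _ ⟨s, hs, rfl⟩
        exact ⟨_, hperp X s hs, hP.invariant X s⟩)
      (by
        rintro _ ⟨s, -, rfl⟩
        rw [← hW, ← hP.range_eq]; exact ⟨s, rfl⟩) hne
    obtain ⟨s, hs1, hs2⟩ := hw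
    have h1 := F.tensorAct_pow_four hs.dual s
    have h2 := F.tensorAct_pow_four hs.dual (F.K o t ⊗ₜ F.K o t)
    rw [← hs2] at h2
    simp only [← hP.invariant] at h2
    have h3 := hperp (F.K (dual o) (dual t)) _ (hperp (F.K (dual o) (dual t)) _
      (hperp (F.K (dual o) (dual t)) _ (hperp (F.K (dual o) (dual t)) _ hs1)))
    have h4 : P ((24 * F.cc (dual (dual o)) (dual (dual t)) (dual (dual o)) (dual (dual t)) s) •
        F.K (dual o) (dual t) ⊗ₜ F.K (dual o) (dual t)) = 0 := by
      have h5 := F.weyl.smul_mem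
        (24 * F.cc (dual (dual o)) (dual (dual t)) (dual (dual o)) (dual (dual t)) s)
        (F.K_tmul_K_mem_weyl hs.dual)
      rw [h1] at h3
      -- The fourfold action on s lies in the annihilator and is also a multiple of a Weyl tensor,
      -- hence zero.
      have h6 := (F.isCompl_weyl hM1 hM2 hs).disjoint.le_bot ⟨h5, h3⟩
      rw [(Submodule.mem_bot ℂ).1 h6, map_zero]
    rw [h1, h4, hs2] at h2
    refine F.K_tmul_K_ne_zero hs.dual ((smul_eq_zero.1 h2.symm).resolve_left ?_)
    simp [co_K, hs.o_t, hs.o_t.symm]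
  exact (Submodule.mem_bot ℂ).1 (hU ▸ Submodule.mem_map_of_mem hsp)

theorem existsUnique_isCartanProjection (hM1 : (m : ℂ) - 2 * n ≠ 1) (hM2 : (m : ℂ) - 2 * n ≠ 2)
    (hs : Sep o t r) (hW : W.cartanProduct = F.weyl) : ∃! P, W.IsCartanProjection P := by
  have h := F.isCompl_weyl hM1 hM2 hs
  obtain ⟨P, hP⟩ := F.exists_isCartanProjection h hW
  refine ⟨P, hP, fun P' hP' => LinearMap.ext fun s => ?_⟩
  obtain ⟨x, hx, y, hy, rfl⟩ : ∃ x ∈ F.weyl, ∃ y ∈ perp F.weyl, x + y = s :=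
    Submodule.mem_sup.1 (by rw [h.sup_eq_top]; trivial)
  rw [map_add, map_add, F.isCartanProjection_perp hM1 hM2 hs hW hP hy,
    F.isCartanProjection_perp hM1 hM2 hs hW hP' hy, hP.apply_of_mem _ (hW ▸ hx),
    hP'.apply_of_mem _ (hW ▸ hx)]

end Frame

end

/-! ### Tensors orthogonal to the Weyl tensors and the relations they impose on L. -/

section

variable {m n : ℕ} {G : Metric m n} {W : WittBasis G}
variable {A : Type*} [Ring A] [Algebra ℂ A]

/-- The linear map `X ⊗ Y ↦ L X * L Y - ½ L [X, Y] - l ⟨X, Y⟩`. -/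
def relator (l : ℂ) (L : osp G →ₗ[ℂ] A) : osp G ⊗[ℂ] osp G →ₗ[ℂ] A :=
  TensorProduct.lift ((LinearMap.mul ℂ A).compl₁₂ L L)
    - (1 / 2 : ℂ) • L ∘ₗ TensorProduct.lift (bracket G)
    - l • Algebra.linearMap ℂ A ∘ₗ TensorProduct.lift (formL G)

theorem relator_tmul (l : ℂ) (L : osp G →ₗ[ℂ] A) (X Y : osp G) : relator l L (X ⊗ₜ Y) =
    L X * L Y - (1 / 2 : ℂ) • L (bracket G X Y) - l • algebraMap ℂ A (form G X Y) := rfl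

theorem bracket_comm_of_odd {X Y : osp G} (hX : ospEven G X = 0) (hY : ospEven G Y = 0) :
    bracket G X Y = bracket G Y X := by
  have hX' : evenPart X.1 = 0 := congrArg Subtype.val hX
  have hY' : evenPart Y.1 = 0 := congrArg Subtype.val hY
  ext1
  change superBracket X.1 Y.1 = superBracket Y.1 X.1
  simp only [superBracket, hX', hY']
  noncomm_ring

namespace Frame

variable (F : Frame W)

/-- Super antisymmetry of the bracket. -/
theorem bracket_K_comm (a b c d : Idx m n) : bracket G (F.K c d) (F.K a b) =
    -(sg a c * sg a d * (sg b c * sg b d)) • bracket G (F.K a b) (F.K c d) := by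
  by_cases hab : par a = par b
  · rw [bracket_comm_of_even (by rw [ospOdd_K, if_pos hab])]
    have : sg a c * sg a d * (sg b c * sg b d) = 1 := by
      rw [mul_mul_mul_comm]; simp [sg, hab, ← mul_pow]
    rw [this]; module
  · by_cases hcd : par c = par d
    · rw [bracket_comm_of_even (X := F.K a b) (by rw [ospOdd_K, if_pos hcd])]
      have : sg a c * sg a d * (sg b c * sg b d) = 1 := by simp [sg, hcd, ← mul_pow]
      rw [this]; module
    · rw [bracket_comm_of_odd (by rw [ospEven_K, if_neg hcd]) (by rw [ospEven_K, if_neg hab])]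
      have : sg a c * sg a d * (sg b c * sg b d) = -1 := by
        rcases par_cases a with ha | ha <;> rcases par_cases b with hb | hb <;>
          rcases par_cases c with hc | hc <;> rcases par_cases d with hd | hd <;>
          simp [sg, ha, hb, hc, hd] at hab hcd ⊢
      rw [this]; module

theorem form_K_comm (a b c d : Idx m n) : form G (F.K c d) (F.K a b) =
    sg a c * sg a d * (sg b c * sg b d) * form G (F.K a b) (F.K c d) := by
  rw [form_K, form_K, co_K, co_K]
  have e : ∀ {x y : Idx m n}, dual x = y ↔ dual y = x := fun {x y} =>
    ⟨fun h => by rw [← h, dual_dual], fun h => by rw [← h, dual_dual]⟩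
  rw [if_congr (P := dual d = a ∧ dual c = b) (Q := dual b = c ∧ dual a = d)
      ⟨fun h => ⟨e.1 h.2, e.1 h.1⟩, fun h => ⟨e.1 h.2, e.1 h.1⟩⟩ rfl rfl,
    if_congr (P := dual d = b ∧ dual c = a) (Q := dual b = d ∧ dual a = c)
      ⟨fun h => ⟨e.1 h.1, e.1 h.2⟩, fun h => ⟨e.1 h.1, e.1 h.2⟩⟩ rfl rfl]
  have h1 : dual b = c ∧ dual a = d →
      eta c * eta d = sg a c * sg a d * (sg b c * sg b d) * (eta a * eta b) := by
    rintro ⟨rfl, rfl⟩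
    simp only [eta_dual, sg_dual_right, sg_comm b a]
    linear_combination (-sg a a * sg b b * eta a * eta b) * sg_mul_self a b
  have h2 : dual b = d ∧ dual a = c →
      eta c * eta d * sg a b = sg a c * sg a d * (sg b c * sg b d) * (eta a * eta b) * sg c d := by
    rintro ⟨rfl, rfl⟩
    simp only [eta_dual, sg_dual_right, sg_dual_left, sg_comm b a]
    linear_combination (-sg a a * sg b b * eta a * eta b * sg a b) * sg_mul_self a b
  by_cases c1 : dual b = c ∧ dual a = d <;> by_cases c2 : dual b = d ∧ dual a = c
  · simp only [if_pos c1, if_pos c2]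
    linear_combination 2 * h1 c1 - 2 * h2 c2
  · simp only [if_pos c1, if_neg c2]
    linear_combination 2 * h1 c1
  · simp only [if_neg c1, if_pos c2]
    linear_combination -2 * h2 c2
  · simp only [if_neg c1, if_neg c2]; ring

/-- Dual to the pair symmetry of Weyl tensors; it yields the supercommutation relations of L. -/
theorem comm_mem_perp (a b c d : Idx m n) : F.K a b ⊗ₜ F.K c d
    - (sg a c * sg a d * (sg b c * sg b d)) • F.K c d ⊗ₜ F.K a b ∈ perp F.weyl := by
  refine mem_perp.2 fun T hT => ?_
  have h := F.weyl_pair hT (dual d) (dual c) (dual b) (dual a)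
  simp only [sg_dual_left, sg_dual_right] at h
  rw [map_sub, map_smul, LinearMap.sub_apply, LinearMap.smul_apply, F.tensorForm_K, F.tensorForm_K,
    h, smul_eq_mul, sg_comm a c, sg_comm a d, sg_comm b c, sg_comm b d]
  have h1 := sg_mul_self d a
  have h2 := sg_mul_self d b
  have h3 := sg_mul_self c a
  have h4 := sg_mul_self c b
  have h5 : (sg c a * sg d a * (sg c b * sg d b)) * (sg d b * sg d a * (sg c b * sg c a)) = 1 := by
    calc _ = (sg d a * sg d a) * (sg d b * sg d b) * (sg c a * sg c a) * (sg c b * sg c b) := by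
          ring
      _ = 1 := by rw [h1, h2, h3, h4]; norm_num
  linear_combination (-4 * eta a * eta b * eta c * eta d *
    F.cc (dual d) (dual c) (dual b) (dual a) T) * h5

/-- The cyclic sums that pair to zero with Weyl tensors. -/
theorem cyclic_mem_perp {a o t : Idx m n} (ha : par a = 0) (ho : par o = 0) (ht : par t = 0)
    (b : Idx m n) : F.K b a ⊗ₜ F.K o t - F.K b o ⊗ₜ F.K a t + F.K b t ⊗ₜ F.K a o ∈ perp F.weyl := by
  refine mem_perp.2 fun T hT => ?_
  have h := weyl_bianchi hT (dual t) (dual o) (dual a) (dual b)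
  rw [F.cc_swap_left (dual t) (dual a)] at h
  simp only [sg_dual_left, sg_of_even ht, sg_of_even ho] at h
  rw [map_add, map_sub, LinearMap.add_apply, LinearMap.sub_apply, F.tensorForm_K, F.tensorForm_K,
    F.tensorForm_K, eta_of_even ha, eta_of_even ho, eta_of_even ht]
  linear_combination 4 * eta b * h

/-- The contractions that pair to zero with Weyl tensors. -/
theorem trace_mem_perp (a d : Idx m n) :
    ∑ b, eta (dual b) • F.K a b ⊗ₜ F.K (dual b) d ∈ perp F.weyl := by
  refine mem_perp.2 fun T hT => ?_
  have h := Frame.weyl_trace hT (dual d) (dual a)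
  rw [map_sum, LinearMap.sum_apply, ← mul_zero (4 * eta a * eta d), ← h, Finset.mul_sum]
  refine Finset.sum_congr rfl fun b _ => ?_
  rw [map_smul, LinearMap.smul_apply, F.tensorForm_K, dual_dual, smul_eq_mul]
  linear_combination (4 * eta a * eta b * eta d * F.cc (dual d) b (dual b) (dual a) T) *
    eta_mul_self (dual b)

theorem bracket_K_of_even {a c d : Idx m n} (ha : par a = 0) (hc : par c = 0) (hd : par d = 0)
    (b : Idx m n) : bracket G (F.K b a) (F.K c d) =
      (if c = dual a then F.K b d else 0) - (if b = dual c then F.K a d else 0)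
      + ((if d = dual a then F.K c b else 0) - (if b = dual d then F.K c a else 0)) := by
  have h : ∀ {x : Idx m n} (V : osp G), par x = 0 →
      (if x = dual b then (sg b a * eta b) • V else 0) = if b = dual x then V else 0 := by
    intro x V hx
    by_cases hb : b = dual x
    · rw [if_pos hb, if_pos (eq_dual_comm.1 hb), sg_of_even' ha, hb, eta_of_even (by simpa)]
      simp
    · rw [if_neg hb, if_neg fun h => hb (eq_dual_comm.1 h)]
  rw [bracket_K, h _ hc, h _ hd, sg_of_even' hc, sg_of_even' hc, eta_of_even ha]
  simp only [one_smul, mul_one]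

/-- The substitution b ↦ b* changes the sign of the sum. -/
theorem sum_K_dual : ∑ b, eta b • F.K (dual b) b = 0 := by
  have h1 : ∑ b, eta b • F.K (dual b) b = -∑ b, eta b • F.K (dual b) b := by
    conv_lhs => rw [← sum_dual]
    rw [← Finset.sum_neg_distrib]
    refine Finset.sum_congr rfl fun b _ => ?_
    rw [dual_dual, F.K_swap (dual b) b, sg_dual_left, eta_dual, smul_smul]
    have := sg_mul_self b b
    rw [show sg b b * eta b * -sg b b = -eta b by linear_combination (-eta b) * this, neg_smul]
  have h2 : (2 : ℂ) • ∑ b, eta b • F.K (dual b) b = 0 := by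
    rw [two_smul]; nth_rewrite 1 [h1]; exact neg_add_cancel _
  exact (smul_eq_zero.1 h2).resolve_left two_ne_zero

/-- M comes from contracting b with itself, -1 from each of b = a and b = d*, and the remaining
terms are a multiple of `sum_K_dual`. -/
theorem sum_bracket_K {a d : Idx m n} (ha : par a = 0) (hd : par d = 0) :
    ∑ b, eta (dual b) • bracket G (F.K a b) (F.K (dual b) d) =
      ((m : ℂ) - 2 * n - 2) • F.K a d := by
  have h : ∀ b, eta (dual b) • bracket G (F.K a b) (F.K (dual b) d) =
      sg b b • F.K a d - (if b = a then F.K a d else 0) - (if b = dual d then F.K a d else 0)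
        - (if d = dual a then (1 : ℂ) else 0) • (eta b • F.K (dual b) b) := by
    intro b
    have h0 : eta (dual b) * eta b = sg b b := by
      rw [eta_dual, mul_assoc, eta_mul_self, mul_one]
    rw [bracket_K, if_pos rfl, smul_add, smul_sub, smul_smul, h0]
    have h1 : eta (dual b) • (if dual b = dual a then (sg a b * eta a) • F.K b d else 0) =
        if b = a then F.K a d else 0 := by
      by_cases hb : b = a
      · rw [hb, if_pos rfl, if_pos rfl, sg_of_even ha, eta_of_even (a := dual a) (by simpa),
          eta_of_even ha]; simp
      · rw [if_neg hb, if_neg (by rwa [dual_inj]), smul_zero]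
    have h2 : eta (dual b) • ((sg a (dual b) * sg b (dual b)) •
        ((if d = dual b then eta b • F.K (dual b) a else 0) -
          if d = dual a then (sg a b * eta a) • F.K (dual b) b else 0)) =
        -(if b = dual d then F.K a d else 0)
          - (if d = dual a then (1 : ℂ) else 0) • (eta b • F.K (dual b) b) := by
      rw [sg_of_even ha, sg_of_even ha, sg_dual_right, eta_of_even ha, one_mul, one_mul, smul_smul,
        smul_sub, eta_dual]
      have h3 : sg b b * eta b * sg b b = eta b := by
        linear_combination eta b * sg_mul_self b b
      rw [h3]
      congr 1
      · by_cases hb : b = dual d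
        · rw [hb, dual_dual, if_pos rfl, if_pos rfl, eta_of_even (by simpa), F.K_swap a d,
            sg_of_even ha]; module
        · rw [if_neg hb, if_neg fun h => hb (eq_dual_comm.1 h)]; simp
      · split_ifs <;> simp
    rw [h1, h2]; abel
  simp only [h, Finset.sum_sub_distrib, ← Finset.smul_sum, F.sum_K_dual, ← Finset.sum_smul,
    sum_sg_self, Finset.sum_ite_eq', Finset.mem_univ, if_true]
  module

theorem sum_form_K {a d : Idx m n} (ha : par a = 0) (hd : par d = 0) :
    ∑ b, eta (dual b) * form G (F.K a b) (F.K (dual b) d) =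
      if d = dual a then 2 * ((m : ℂ) - 2 * n - 1) else 0 := by
  have h : ∀ b, eta (dual b) * form G (F.K a b) (F.K (dual b) d) =
      (if d = dual a then 2 * sg b b else 0) - if b = a then (if d = dual a then 2 else 0) else 0 := by
    intro b
    rw [form_K, co_K, eta_of_even ha, sg_of_even' hd, eta_dual]
    have h0 := eta_mul_self b
    by_cases h1 : d = dual a
    · subst h1
      by_cases h2 : b = a
      · subst h2; simp [eta_of_even ha, sg_of_even ha]
      · simp [dual_inj, h2]
        linear_combination 2 * sg b b * h0
    · by_cases h2 : b = a
      · subst h2; simp [h1, eq_comm (a := dual b) (b := d)]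
      · simp [h1, dual_inj, h2, Ne.symm h1, eq_comm (a := a) (b := b)]
  simp only [h, Finset.sum_sub_distrib, Finset.sum_ite_eq', Finset.mem_univ, if_true]
  split_ifs
  · rw [← Finset.mul_sum, sum_sg_self]; ring
  · simp

variable {l : ℂ} {L : osp G →ₗ[ℂ] A} (hL : ∀ s ∈ perp F.weyl, relator l L s = 0)
include hL

/-- In the commutator relation the form terms cancel and the bracket terms add, so L(X) = 0 implies
L([X,Y]) = 0 and vanishing spreads along brackets. -/
theorem L_bracket_eq_zero {a b : Idx m n} (h : L (F.K a b) = 0) (c d : Idx m n) :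
    L (bracket G (F.K a b) (F.K c d)) = 0 := by
  have h1 := hL _ (F.comm_mem_perp a b c d)
  have h5 : (sg a c * sg a d * (sg b c * sg b d)) * (sg a c * sg a d * (sg b c * sg b d)) = 1 := by
    rw [mul_mul_mul_comm, mul_mul_mul_comm (sg a c), mul_mul_mul_comm (sg b c)]; simp
  rw [map_sub, map_smul, relator_tmul, relator_tmul, F.bracket_K_comm a b c d,
    F.form_K_comm a b c d, h] at h1
  generalize sg a c * sg a d * (sg b c * sg b d) = s at h1 h5
  rw [map_mul (algebraMap ℂ A), map_smul, ← Algebra.smul_def] at h1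
  have h2 : L (bracket G (F.K a b) (F.K c d)) = 0 := by
    have : (0:A) = -((1/2 : ℂ) * (1 + s * s)) • L (bracket G (F.K a b) (F.K c d))
        - (l * (1 - s * s)) • algebraMap ℂ A (form G (F.K a b) (F.K c d)) := by
      rw [← h1, zero_mul, mul_zero]
      module
    rw [h5] at this
    simpa using this
  exact h2

/-- As b_a, b_o, b_t are mutually orthogonal, all form terms vanish and the brackets only leave
contractions with b. -/
theorem L_cyclic {a o t : Idx m n} (hs : Sep o t a) (b : Idx m n) :
    L (F.K b a) * L (F.K o t) - L (F.K b o) * L (F.K a t) + L (F.K b t) * L (F.K a o) =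
      (if b = dual a then L (F.K o t) else 0) - (if b = dual o then L (F.K a t) else 0)
        + (if b = dual t then L (F.K a o) else 0) := by
  obtain ⟨ho, ht, ha, hoo, htt, hot, hodt, hao, hado, hat, hadt, -⟩ := hs
  have h1 := hL _ (F.cyclic_mem_perp ha ho ht b)
  have n1 : ¬ o = dual a := fun h => hado (eq_dual_comm.1 h)
  have n2 : ¬ t = dual a := fun h => hadt (eq_dual_comm.1 h)
  have n3 : ¬ t = dual o := fun h => hodt (eq_dual_comm.1 h)
  have f1 : form G (F.K b a) (F.K o t) = 0 := by
    rw [form_K, co_K]; simp [Ne.symm n1, Ne.symm n2]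
  have f2 : form G (F.K b o) (F.K a t) = 0 := by
    rw [form_K, co_K]; simp [Ne.symm hado, Ne.symm n3]
  have f3 : form G (F.K b t) (F.K a o) = 0 := by
    rw [form_K, co_K]; simp [Ne.symm hadt, Ne.symm hodt]
  rw [map_add, map_sub, relator_tmul, relator_tmul, relator_tmul, f1, f2, f3,
    F.bracket_K_of_even ha ho ht, F.bracket_K_of_even ho ha ht, F.bracket_K_of_even ht ha ho,
    if_neg n1, if_neg n2, if_neg hado, if_neg n3, if_neg hadt, if_neg hodt, F.K_swap o t,
    F.K_swap a o, sg_of_even ho, sg_of_even ha] at h1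
  have hm : ∀ (P : Prop) [Decidable P] (V : osp G),
      L (if P then V else 0) = if P then L V else 0 := fun P _ V => by split_ifs <;> simp
  have hm' : ∀ (P : Prop) [Decidable P] (V : osp G),
      (if P then (-1 : ℂ) • V else 0) = -(if P then V else 0) := fun P _ V => by
    split_ifs <;> module
  simp only [map_zero, smul_zero, hm', map_add, map_sub, map_neg, hm] at h1
  rw [← sub_eq_zero]
  refine Eq.trans ?_ h1
  module

theorem L_trace {a d : Idx m n} (ha : par a = 0) (hd : par d = 0) :
    ∑ b, eta (dual b) • (L (F.K a b) * L (F.K (dual b) d)) =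
      ((((m : ℂ) - 2 * n) - 2) / 2) • L (F.K a d)
      + (if d = dual a then algebraMap ℂ A (2 * l * ((m : ℂ) - 2 * n - 1)) else 0) := by
  have h1 := hL _ (F.trace_mem_perp a d)
  simp only [map_sum, map_smul, relator_tmul, smul_sub, Finset.sum_sub_distrib] at h1
  have h2 : ∑ b, eta (dual b) • (1 / 2 : ℂ) • L (bracket G (F.K a b) (F.K (dual b) d)) =
      ((((m : ℂ) - 2 * n) - 2) / 2) • L (F.K a d) := by
    have := congrArg (fun V => (1 / 2 : ℂ) • L V) (F.sum_bracket_K ha hd)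
    simp only [map_sum, map_smul, Finset.smul_sum] at this
    simp only [smul_comm (eta _) (1 / 2 : ℂ), this]
    module
  have h3 : ∑ b, eta (dual b) • l • algebraMap ℂ A (form G (F.K a b) (F.K (dual b) d)) =
      if d = dual a then algebraMap ℂ A (2 * l * ((m : ℂ) - 2 * n - 1)) else 0 := by
    have := congrArg (fun x => l • algebraMap ℂ A x) (F.sum_form_K ha hd)
    simp only [map_sum, Finset.smul_sum, map_mul, ← Algebra.smul_def (R := ℂ) (A := A)] at this
    simp only [smul_comm (eta _) l, this]
    split_ifs
    · rw [Algebra.smul_def, ← map_mul]; congr 1; ring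
    · simp
  rw [h2, h3] at h1
  rw [sub_sub, sub_eq_zero] at h1
  exact h1

/-- The cyclic relation at b*, multiplied on the left by L(K a* b) and summed. Associativity
brackets the left side so that `L_trace` applies; the deltas collapse the right side. -/
theorem sum_L_mul_cyclic {a o t : Idx m n} (hs : Sep o t a) :
    (∑ b, eta (dual b) • (L (F.K (dual a) b) * L (F.K (dual b) a))) * L (F.K o t)
      - (∑ b, eta (dual b) • (L (F.K (dual a) b) * L (F.K (dual b) o))) * L (F.K a t)
      + (∑ b, eta (dual b) • (L (F.K (dual a) b) * L (F.K (dual b) t))) * L (F.K a o) =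
      L (F.K (dual a) a) * L (F.K o t) - L (F.K (dual a) o) * L (F.K a t) + L (F.K (dual a) t) * L (F.K a o) := by
  have h1 : ∀ (x : Idx m n) (V : A), par x = 0 →
      ∑ b, eta (dual b) • (L (F.K (dual a) b) * (if dual b = dual x then V else 0)) = L (F.K (dual a) x) * V := by
    intro x V hx
    rw [Finset.sum_eq_single x]
    · rw [if_pos rfl, eta_of_even (by simpa), one_smul]
    · intro b _ hb
      rw [if_neg fun h => hb (dual_inj.1 h), mul_zero, smul_zero]
    · simp
  rw [← h1 a _ hs.par_r, ← h1 o _ hs.par_o, ← h1 t _ hs.par_t]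
  simp only [Finset.sum_mul, ← Finset.sum_sub_distrib, ← Finset.sum_add_distrib, ← smul_sub,
    ← smul_add, ← mul_sub, ← mul_add, smul_mul_assoc, mul_assoc]
  refine Finset.sum_congr rfl fun b _ => ?_
  rw [F.L_cyclic hL hs]

/-- With α = (M - 2)/2 and β = 2λ(M - 1), the summed relation is (α - 1) times the cyclic expression
at b = a*, plus β L(K o t), equal to zero. That expression is L(K o t) by `L_cyclic`, so (α + β - 1)
L(K o t) = 0. -/
theorem L_eq_zero_of_sep {a o t : Idx m n} (hs : Sep o t a)
    (hl : ((m : ℂ) - 2 * n - 2) / 2 + 2 * l * ((m : ℂ) - 2 * n - 1) ≠ 1) : L (F.K o t) = 0 := by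
  have h1 := F.sum_L_mul_cyclic hL hs
  have h2 := F.L_cyclic hL hs (dual a)
  have hpa : par (dual a) = 0 := by simpa using hs.par_r
  rw [F.L_trace hL hpa hs.par_r, F.L_trace hL hpa hs.par_o, F.L_trace hL hpa hs.par_t, dual_dual,
    if_pos rfl, if_neg hs.r_o.symm, if_neg hs.r_t.symm, add_zero, add_zero] at h1
  rw [if_pos rfl, if_neg fun h => hs.r_o (dual_inj.1 h), if_neg fun h => hs.r_t (dual_inj.1 h),
    sub_zero, add_zero] at h2
  generalize ((m : ℂ) - 2 * n - 2) / 2 = α at h1 hl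
  generalize 2 * l * ((m : ℂ) - 2 * n - 1) = β at h1 hl
  have h3 : (α + β - 1) • L (F.K o t) = 0 := by
    rw [add_mul, ← Algebra.smul_def, smul_mul_assoc, smul_mul_assoc, smul_mul_assoc] at h1
    linear_combination (norm := module) h1 - (α - 1) • h2
  exact (smul_eq_zero.1 h3).resolve_left fun h => hl (by linear_combination h)

theorem L_eq_zero_left {r o t : Idx m n} (hs : Sep o t r)
    (hl : ((m : ℂ) - 2 * n - 2) / 2 + 2 * l * ((m : ℂ) - 2 * n - 1) ≠ 1) (x : Idx m n) :
    L (F.K o x) = 0 := by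
  have hs' : Sep o (dual t) r := by
    obtain ⟨ho, ht, hr, hoo, htt, hot, hodt, hro, hrdo, hrt, hrdt, hu⟩ := hs
    exact ⟨ho, by simpa, hr, hoo, by simpa using htt.symm, hodt, by simpa, hro, hrdo, hrdt,
      by simpa, hu⟩
  have h1 := F.L_eq_zero_of_sep hL hs hl
  have h2 := F.L_eq_zero_of_sep hL hs' hl
  obtain ⟨ho, ht, hr, hoo, htt, hot, hodt, hro, hrdo, hrt, hrdt, hu⟩ := hs
  have n3 : ¬ t = dual o := fun h => hodt (eq_dual_comm.1 h)
  by_cases x1 : x = t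
  · rw [x1, h1]
  by_cases x2 : x = dual t
  · rw [x2, h2]
  by_cases x3 : x = o
  · have : F.K o o = 0 := by
      have h := F.K_swap o o
      rw [sg_of_even ho] at h
      have h' : (2 : ℂ) • F.K o o = 0 := by rw [two_smul]; nth_rewrite 1 [h]; module
      exact (smul_eq_zero.1 h').resolve_left two_ne_zero
    rw [x3, this, map_zero]
  by_cases x4 : x = dual o
  -- The two brackets give K o o* + K t t* and K o o* - K t t*; adding them isolates K o o*.
  · have e1 := F.L_bracket_eq_zero hL h1 (dual t) (dual o)
    have e2 := F.L_bracket_eq_zero hL h2 t (dual o)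
    simp only [bracket_K, dual_inj, dual_dual, hot, hot.symm, n3, if_true, if_false,
      sg_of_even ho, sg_of_even ht, eta_of_even ho, eta_of_even ht, map_sub, map_add, map_smul,
      map_zero, sg_dual_left, Ne.symm n3,
      eta_of_even (a := dual t) (by simpa)] at e1 e2
    rw [F.K_swap t (dual t), sg_of_even ht, map_smul] at e1
    have h3 : (2 : ℂ) • L (F.K o (dual o)) = 0 := by
      refine Eq.trans ?_ (congrArg₂ (· + ·) e1 e2 |>.trans (add_zero 0))
      module
    rw [x4]
    exact (smul_eq_zero.1 h3).resolve_left two_ne_zero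
  · have e1 := F.L_bracket_eq_zero hL h1 (dual t) x
    rw [bracket_K, if_pos rfl, if_neg fun h => hot (dual_inj.1 h).symm, if_neg x2, if_neg x4,
      eta_of_even ht] at e1
    simpa using e1

/-- A linear map that kills the relators of all tensors orthogonal to the Weyl tensors is zero. -/
theorem L_eq_zero {r o t : Idx m n} (hs : Sep o t r)
    (hl : ((m : ℂ) - 2 * n - 2) / 2 + 2 * l * ((m : ℂ) - 2 * n - 1) ≠ 1) : L = 0 := by
  have h1 := F.L_eq_zero_left hL hs hl
  have h2 := F.L_eq_zero_left hL hs.dual hl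
  have swap : ∀ {x y}, L (F.K x y) = 0 → L (F.K y x) = 0 := by
    intro x y h; rw [K_swap, map_smul, h, smul_zero]
  have key : ∀ x y, L (F.K x y) = 0 := by
    intro x y
    by_cases x1 : x = o
    · rw [x1, h1]
    by_cases x2 : x = dual o
    · rw [x2, h2]
    by_cases y1 : y = o
    · rw [y1]; exact swap (h1 _)
    by_cases y2 : y = dual o
    · rw [y2]; exact swap (h2 _)
    -- [K x o, K o* y] is K x y, up to a term in K o* o that L already kills.
    have e := F.L_bracket_eq_zero hL (swap (h1 x)) (dual o) y
    rw [bracket_K, if_pos rfl, if_neg fun h => x1 (dual_inj.1 h).symm, if_neg y2,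
      eta_of_even hs.par_o] at e
    split_ifs at e with h
    · simpa [h2] using e
    · simpa using e
  refine LinearMap.ext fun X => ?_
  rw [F.eq_sum_K X]
  simp [key]

end Frame

end

/-! ### Passing from the quotient algebra back to the ideal. -/

section

variable {m n : ℕ} {G : Metric m n} {W : WittBasis G}

/-- For m = 5 the third index is the self-dual middle one, which `Sep` permits. -/
theorem sep_inl (hm : 4 < m) (hn : 0 < n) : Sep (Sum.inl ⟨0, by omega⟩ : Idx m n)
    (Sum.inl ⟨1, by omega⟩) (Sum.inl ⟨2, by omega⟩) := by
  refine ⟨rfl, rfl, rfl, ?_, ?_, ?_, ?_, ?_, ?_, ?_, ?_, Sum.inr ⟨0, by omega⟩, rfl⟩ <;>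
  · simp only [dual, Sum.map_inl, ne_eq, Sum.inl.injEq, Fin.ext_iff, Fin.val_rev]
    omega

/-- The generators of the quotient algebra satisfy the relations given by the tensors
that the projection kills. -/
theorem relator_mkₐ {P : osp G ⊗[ℂ] osp G →ₗ[ℂ] osp G ⊗[ℂ] osp G} {l : ℂ}
    {s : osp G ⊗[ℂ] osp G} (hs : P s = 0) :
    relator l ((((quadraticIdeal G P l).ringCon.mkₐ ℂ).toLinearMap) ∘ₗ TensorAlgebra.ι ℂ) s = 0 := by
  set φ := (quadraticIdeal G P l).ringCon.mkₐ ℂ with hφ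
  -- Modulo the ideal, the relator of any tensor equals the image of its projection.
  have key : ∀ s, relator l (φ.toLinearMap ∘ₗ TensorAlgebra.ι ℂ) s
      = φ (toTensorAlgebra G (P s)) := by
    intro s
    induction s using TensorProduct.induction_on with
    | zero => simp
    | tmul X Y =>
      have hmem : toTensorAlgebra G (X ⊗ₜ[ℂ] Y) - toTensorAlgebra G (P (X ⊗ₜ[ℂ] Y))
          - (1 / 2 : ℂ) • TensorAlgebra.ι ℂ (bracket G X Y)
          - algebraMap ℂ _ (l * form G X Y) ∈ quadraticIdeal G P l :=
        TwoSidedIdeal.subset_span ⟨X, Y, rfl⟩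
      have h0 : φ (toTensorAlgebra G (X ⊗ₜ[ℂ] Y) - toTensorAlgebra G (P (X ⊗ₜ[ℂ] Y))
          - (1 / 2 : ℂ) • TensorAlgebra.ι ℂ (bracket G X Y)
          - algebraMap ℂ _ (l * form G X Y)) = 0 :=
        Quotient.sound ((TwoSidedIdeal.mem_iff _ _).1 hmem)
      have h1 : toTensorAlgebra G (X ⊗ₜ[ℂ] Y) = TensorAlgebra.ι ℂ X * TensorAlgebra.ι ℂ Y := rfl
      rw [map_sub, map_sub, map_sub, h1, map_mul, map_smul, AlgHom.commutes, map_mul (algebraMap _ _),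
        ← Algebra.smul_def] at h0
      rw [relator_tmul]
      simp only [LinearMap.comp_apply, AlgHom.toLinearMap_apply]
      rw [← sub_eq_zero, ← h0]
      abel
    | add s t h h' => rw [map_add, map_add, map_add, map_add, h, h']
  rw [key, hs, map_zero, map_zero]

end

end OSp

end

theorem mainTheorem5 (m n : ℕ) (hm : 4 < m) (hn : 1 < n)
    (hM1 : (m : ℤ) - 2 * n ≠ 1) (hM2 : (m : ℤ) - 2 * n ≠ 2)
    (G : OSp.Metric m n) (W : OSp.WittBasis G) :
    (∃! P, W.IsCartanProjection P) ∧
    ∀ P, W.IsCartanProjection P →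
      ∀ l : ℂ, l ≠ -((((m : ℂ) - 2 * n) - 4) / (4 * (((m : ℂ) - 2 * n) - 1))) →
        ∀ X : OSp.osp G, TensorAlgebra.ι ℂ X ∈ OSp.quadraticIdeal G P l := by
  obtain ⟨F⟩ := W.nonempty_frame
  have h1 : (m : ℂ) - 2 * n ≠ 1 := by exact_mod_cast hM1
  have h2 : (m : ℂ) - 2 * n ≠ 2 := by exact_mod_cast hM2
  have hn' : 0 < n := by omega
  have hs := OSp.sep_inl hm hn'
  have hd : 0 < m / 2 ∧ 1 < m / 2 := by omega
  have hW := F.cartanProduct_eq h1 h2 hm hn' hs (by simp [OSp.pos, hd.1]) (by simp [OSp.pos, hd.2])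
  refine ⟨F.existsUnique_isCartanProjection h1 h2 hs hW, fun P hP l hl X => ?_⟩
  have hL := F.L_eq_zero (l := l)
    (fun s hsp => OSp.relator_mkₐ (F.isCartanProjection_perp h1 h2 hs hW hP hsp)) hs (by
      -- Multiplied out, (M - 2)/2 + 2λ(M - 1) = 1 is the excluded value of λ; dividing by M - 1
      -- uses M ≠ 1.
      intro h
      apply hl
      have h3 : (m : ℂ) - 2 * n - 1 ≠ 0 := sub_ne_zero.2 h1
      field_simp
      linear_combination 2 * h)
  have hX := LinearMap.congr_fun hL X
  rw [TwoSidedIdeal.mem_iff]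
  exact Quotient.exact hX
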